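/- **Theorem 5.2.** $\textsc{Incorrect-APSP} \le_3 \textsc{APSP}$: there is a subcubic reduction from Incorrect-APSP to APSP. Here the notions are as follows. Let $G=(V,E,w)$ be a weighted directed graph with $V=\{1,\dots,n\}$, $n\ge 1$, and integer weights $w:E\to[-M,M]$, without negative cycles. Its adjacency matrix $A(G)$ has $A[i,i]=0$, $A[i,j]=w(i,j)$ for $i\ne j$ with $(i,j)\in E$, and $A[i,j]=\infty$ otherwise. *APSP*: given such a $G$, compute the matrix whose entry $(i,j)$ is the minimum total weight of a path from $i$ to $j$ ($\infty$ if there is none). *Incorrect-APSP*: given such a $G$, compute the matrix obtained from $A=A(G)$ by executing, in place, for $i=1,\dots,n$, for $j=1,\dots,n$, for $k=1,\dots,n$ (nested in this order): $A[i,j]\leftarrow\min(A[i,j],\,A[i,k]+A[k,j])$. *Subcubic reduction* $P\le_3 Q$: there is a single algorithm $\mathcal A$ with oracle access to $Q$, on a word RAM with unit-cost operations on words of $O(\log(n+M))$ bits, an oracle call on $N$ vertices being charged $\Theta(N^2)$ steps, such that for every $\varepsilon>0$ there is $\delta>0$ with the following properties, for every oracle that answers all instances of $Q$ correctly (its answers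 to other queries being arbitrary) and every instance of $P$ with $n$ vertices and weights in $[-M,M]$: 1. $\mathcal A$ outputs a solution of $P$ on the instance; 2. $\mathcal A$ halts after $O(n^{3-\delta})$ steps; 3. if $m_1,m_2,\dots$ are the numbers of vertices of the instances submitted to the oracle, then $\sum_i m_i^{3-\varepsilon}=O(n^{3-\delta})$. The constants in $O(n^{3-\delta})$ depend only on $\mathcal A$, $\varepsilon$ and $\delta$; in particular not on $M$, on the instance or on the oracle. -/

import Mathlib

namespace FineGrained

/-! ### Weighted directed graphs and the two problems -/

/-- A weighted directed graph on the vertex set `Fin n` with integer weights: `G i j = ⊤` means that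
`(i, j)` is not an edge, and `G i j = w` that `(i, j)` is an edge of weight `w`. Loops are allowed.
The same type is used for `n × n` matrices over `ℤ ∪ {∞}`. -/
abbrev WMatrix (n : ℕ) : Type := Matrix (Fin n) (Fin n) (WithTop ℤ)

/-- `HasPath G i j x`: there is a (not necessarily simple) path from `i` to `j` along edges of `G`
whose total weight is `x`; the path without edges has weight `0`. -/
inductive HasPath {n : ℕ} (G : WMatrix n) : Fin n → Fin n → ℤ → Prop
  | nil (i : Fin n) : HasPath G i i 0
  | cons {i j k : Fin n} {w x : ℤ} (hw : G i j = (w : WithTop ℤ)) (hp : HasPath G j k x) :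
      HasPath G i k (w + x)

/-- No closed path (equivalently, no cycle, loops included) has negative weight. -/
def NoNegativeCycle {n : ℕ} (G : WMatrix n) : Prop :=
  ∀ (i : Fin n) (x : ℤ), HasPath G i i x → 0 ≤ x

/-- The adjacency matrix: `0` on the diagonal, edge weights elsewhere, `∞` for missing edges. -/
def adjacencyMatrix {n : ℕ} (G : WMatrix n) : WMatrix n :=
  fun i j => if i = j then 0 else G i j

/-- The assignment `A[i, j] ← min (A[i, j], A[i, k] + A[k, j])`. -/
def relax {n : ℕ} (A : WMatrix n) (i j k : Fin n) : WMatrix n :=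
  fun a b => if a = i ∧ b = j then min (A i j) (A i k + A k j) else A a b

/-- The IJK algorithm: `for i`, `for j`, `for k`, perform the assignment above, in place, all loops
in increasing order. -/
def ijkAlgorithm {n : ℕ} (A : WMatrix n) : WMatrix n :=
  (List.finRange n).foldl (fun A i =>
    (List.finRange n).foldl (fun A j =>
      (List.finRange n).foldl (fun A k => relax A i j k) A) A) A

/-- A computational problem on weighted graphs whose answers are matrices; the size of an instance
is its number of vertices. `IsInstance` is the promise on the input. -/
structure MatrixProblem where
  IsInstance : ∀ {n : ℕ}, WMatrix n → Prop
  IsSolution : ∀ {n : ℕ}, WMatrix n → WMatrix n → Prop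

/-- All-pairs shortest paths in graphs without negative cycles: `D i j` is the minimum weight of a
path from `i` to `j`, and `∞` when there is no path. -/
def APSP : MatrixProblem where
  IsInstance G := NoNegativeCycle G
  IsSolution G D := ∀ i j (d : ℤ), D i j = (d : WithTop ℤ) ↔ IsLeast {x : ℤ | HasPath G i j x} d

/-- Given a graph without negative cycles, compute the matrix that the IJK algorithm returns on its
adjacency matrix. -/
def IncorrectAPSP : MatrixProblem where
  IsInstance G := NoNegativeCycle G
  IsSolution G R := R = ijkAlgorithm (adjacencyMatrix G)

/-- An oracle: it answers a query of every size by a matrix of the same size. -/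
abbrev Oracle : Type := ∀ N : ℕ, WMatrix N → WMatrix N

/-- The oracle answers every instance of the problem correctly. Nothing is said about its answers to
queries that violate the promise. -/
def Oracle.Solves (O : Oracle) (B : MatrixProblem) : Prop :=
  ∀ (N : ℕ) (X : WMatrix N), B.IsInstance X → B.IsSolution X (O N X)

/-! ### A word RAM with oracle calls -/

/-- Finitely many of the registers are used by a program; the memory is addressed indirectly. -/
structure State where
  reg : ℕ → ℤ
  mem : ℤ → ℤ

/-- Integer expressions: constants, registers, indirect reads, arithmetic and comparison. -/
inductive Expr where
  | lit (c : ℤ)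
  | reg (r : ℕ)
  | load (a : Expr)
  | add (a b : Expr)
  | sub (a b : Expr)
  | mul (a b : Expr)
  | lt (a b : Expr)

/-- The value of an expression; a comparison has the value `1` if true and `0` if false. -/
def Expr.eval (s : State) : Expr → ℤ
  | .lit c => c
  | .reg r => s.reg r
  | .load a => s.mem (a.eval s)
  | .add a b => a.eval s + b.eval s
  | .sub a b => a.eval s - b.eval s
  | .mul a b => a.eval s * b.eval s
  | .lt a b => if a.eval s < b.eval s then 1 else 0

/-- The value of the expression and of each of its subexpressions, hence every address that it
reads, has absolute value at most `W`. -/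
def Expr.Fits (W : ℕ) (s : State) : Expr → Prop
  | .lit c => |c| ≤ W
  | .reg r => |s.reg r| ≤ W
  | .load a => a.Fits W s ∧ |(Expr.load a).eval s| ≤ W
  | .add a b => a.Fits W s ∧ b.Fits W s ∧ |(Expr.add a b).eval s| ≤ W
  | .sub a b => a.Fits W s ∧ b.Fits W s ∧ |(Expr.sub a b).eval s| ≤ W
  | .mul a b => a.Fits W s ∧ b.Fits W s ∧ |(Expr.mul a b).eval s| ≤ W
  | .lt a b => a.Fits W s ∧ b.Fits W s ∧ |(Expr.lt a b).eval s| ≤ W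

/-- The number of steps that the evaluation takes: one for each node of the expression. -/
def Expr.cost : Expr → ℕ
  | .lit _ => 1
  | .reg _ => 1
  | .load a => a.cost + 1
  | .add a b => a.cost + b.cost + 1
  | .sub a b => a.cost + b.cost + 1
  | .mul a b => a.cost + b.cost + 1
  | .lt a b => a.cost + b.cost + 1

/-- Programs. `store a e` writes the value of `e` to the memory cell `a`; a test counts as true if
its value is not `0`; `call N x y` asks the oracle for the answer to the matrix of size `N` that is
stored from address `x` on, and stores the answer from address `y` on. -/
inductive Program where
  | skip
  | assign (r : ℕ) (e : Expr)
  | store (a e : Expr)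
  | seq (p q : Program)
  | ite (e : Expr) (p q : Program)
  | loop (e : Expr) (p : Program)
  | call (N x y : Expr)

/-- A matrix is stored by rows, with two cells for each entry: the first is `0` if the entry is `∞`
and nonzero otherwise, the second holds the value of a finite entry. -/
def readMatrix (mem : ℤ → ℤ) (base : ℤ) (n : ℕ) : WMatrix n := fun i j =>
  if mem (base + 2 * ((i : ℤ) * n + j)) = 0 then ⊤
  else ((mem (base + 2 * ((i : ℤ) * n + j) + 1) : ℤ) : WithTop ℤ)

/-- The two cells (flag and value) of an entry, and the contents of cell number `q` of the stored
matrix. -/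
def matrixCell {n : ℕ} (R : WMatrix n) (q : ℕ) : ℤ :=
  if h : q / 2 / n < n ∧ q / 2 % n < n then
    let x : WithTop ℤ := R ⟨q / 2 / n, h.1⟩ ⟨q / 2 % n, h.2⟩
    if q % 2 = 0 then (if x = ⊤ then 0 else 1) else x.untopD 0
  else 0

/-- Overwrite the cells `base, …, base + 2n² - 1` by the matrix `R`. -/
def writeMatrix (mem : ℤ → ℤ) (base : ℤ) {n : ℕ} (R : WMatrix n) : ℤ → ℤ := fun a =>
  if base ≤ a ∧ a < base + 2 * (n * n : ℕ) then matrixCell R (a - base).toNat else mem a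

/-- `Exec O W p s s' t Q`: with oracle `O` and with all words bounded by `W` in absolute value, the
program `p`, started in state `s`, halts in state `s'` after `t` steps, and `Q` lists the sizes of
its oracle queries. A computation in which a word exceeds `W` does not halt. An oracle call is charged
for reading the query and writing the answer. -/
inductive Exec (O : Oracle) (W : ℕ) : Program → State → State → ℕ → List ℕ → Prop
  | skip (s : State) : Exec O W .skip s s 1 []
  | assign (s : State) (r : ℕ) (e : Expr) (he : e.Fits W s) :
      Exec O W (.assign r e) s { s with reg := Function.update s.reg r (e.eval s) } (e.cost + 1) []
  | store (s : State) (a e : Expr) (ha : a.Fits W s) (he : e.Fits W s) :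
      Exec O W (.store a e) s { s with mem := Function.update s.mem (a.eval s) (e.eval s) }
        (a.cost + e.cost + 1) []
  | seq {p q : Program} {s s' s'' : State} {t t' : ℕ} {Q Q' : List ℕ}
      (hp : Exec O W p s s' t Q) (hq : Exec O W q s' s'' t' Q') :
      Exec O W (.seq p q) s s'' (t + t') (Q ++ Q')
  | ite_true {e : Expr} {p q : Program} {s s' : State} {t : ℕ} {Q : List ℕ}
      (hf : e.Fits W s) (he : e.eval s ≠ 0) (hp : Exec O W p s s' t Q) :
      Exec O W (.ite e p q) s s' (e.cost + 1 + t) Q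
  | ite_false {e : Expr} {p q : Program} {s s' : State} {t : ℕ} {Q : List ℕ}
      (hf : e.Fits W s) (he : e.eval s = 0) (hq : Exec O W q s s' t Q) :
      Exec O W (.ite e p q) s s' (e.cost + 1 + t) Q
  | loop_done {e : Expr} {p : Program} {s : State} (hf : e.Fits W s) (he : e.eval s = 0) :
      Exec O W (.loop e p) s s (e.cost + 1) []
  | loop_step {e : Expr} {p : Program} {s s' s'' : State} {t t' : ℕ} {Q Q' : List ℕ}
      (hf : e.Fits W s) (he : e.eval s ≠ 0) (hp : Exec O W p s s' t Q)
      (hl : Exec O W (.loop e p) s' s'' t' Q') :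
      Exec O W (.loop e p) s s'' (e.cost + 1 + t + t') (Q ++ Q')
  | call (s : State) (eN x y : Expr) (N : ℕ)
      (hN : eN.Fits W s) (hx : x.Fits W s) (hy : y.Fits W s) (hNe : eN.eval s = N)
      (hxW : |x.eval s| + 2 * (N * N : ℕ) ≤ W) (hyW : |y.eval s| + 2 * (N * N : ℕ) ≤ W)
      (hans : ∀ (i j : Fin N) (w : ℤ),
        O N (readMatrix s.mem (x.eval s) N) i j = (w : WithTop ℤ) → |w| ≤ W) :
      Exec O W (.call eN x y) s
        { s with mem := writeMatrix s.mem (y.eval s) (O N (readMatrix s.mem (x.eval s) N)) }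
        (eN.cost + x.cost + y.cost + 2 * (N * N) + 1) [N]

/-- The start: register `0` holds `n`, the input matrix is stored from address `0` on, and all other
registers and memory cells are `0`. -/
def initialState {n : ℕ} (G : WMatrix n) : State where
  reg := fun r => if r = 0 then (n : ℤ) else 0
  mem := writeMatrix (fun _ => 0) 0 G

/-- Subcubic reduction from `A` to `B`: one oracle program `P` such that for every `ε > 0` there is
`δ > 0` for which, on all instances of `A` with `n` vertices and weights in `[-M, M]` and for every
oracle that solves `B`, the program halts with a solution (stored from address `0` on) after
`O(n ^ (3 - δ))` steps, and the sizes `m₁, m₂, …` of its queries satisfy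
`∑ mᵢ ^ (3 - ε) = O(n ^ (3 - δ))`. The words have `O(log (n + M))` bits. -/
def SubcubicReduction (A B : MatrixProblem) : Prop :=
  ∃ (P : Program) (c : ℕ), ∀ ε : ℝ, 0 < ε → ∃ δ : ℝ, 0 < δ ∧ ∃ C : ℝ,
    ∀ O : Oracle, O.Solves B →
      ∀ (n M : ℕ) (G : WMatrix n), 1 ≤ n → A.IsInstance G →
        (∀ (i j : Fin n) (w : ℤ), G i j = (w : WithTop ℤ) → |w| ≤ M) →
        ∃ (s : State) (t : ℕ) (Q : List ℕ),
          Exec O ((n + M + 2) ^ c) P (initialState G) s t Q ∧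
          A.IsSolution G (readMatrix s.mem 0 n) ∧
          (t : ℝ) ≤ C * (n : ℝ) ^ (3 - δ) ∧
          (Q.map fun m => (m : ℝ) ^ (3 - ε)).sum ≤ C * (n : ℝ) ^ (3 - δ)

end FineGrained

namespace FineGrained

/-! ### Walks -/

/-! The algorithm settles each entry in a single visit, in row-major order. Without negative cycles
the diagonal stays `0`, and the output `F` obeys a recursion in the weights `w` (`ijkAlgorithm_eq`):
`F i j` is the minimum of `w i j` and of sums over `k`, where the entry `(i, k)` is final if `k <
j`, the entry `(k, j)` is final if `k < i`, and both are weights otherwise. By the position of `k`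
there are four kinds of split (`IJKSystem`): peaks `w + w` with `k` above both ends, low splits `F +
F` with `k` below both, right splits `F i k + w k j` with `i < k < j`, and left splits `w i k + F k
j` with `j < k < i`.

All peaks come from one query on `3 * n` vertices (`peak_answer_eq`). The rest is divide and
conquer. Take a block of rows and columns whose first half, of width `s`, is solved and whose other
entries include all splits below the block. One query on at most `6 * s` vertices solves the two
mixed quadrants and adds to the last quadrant all splits in the first half (`PanelReady.update`).
Indeed, unrolling left and low splits writes a lower entry as a descending chain of weights, one
known entry and an ascending chain of solved entries; an upper entry is a descending chain of solved
entries, one known entry and an ascending chain of weights. The query graph has a layer for each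
chain. It is acyclic whatever the signs of the weights, so the oracle's promise holds. Zero edges
from the first pair of layers to the second produce the sums `F i k + F k j`.

Unrolled, the recursion performs at each time `t = 1, …, n - 1` a step of cost `O(lowBit t ^ 2)`
(`dyadic_steps`). These costs add up to `O(n ^ 2)` (`sum_lowBit_sq`), including the charge for the
queries. A query of size `m = O(n)` is charged at least `m ^ 2`, so the sum of the `m ^ (3 - ε)` is
at most `O(n ^ (1 - ε))` times the running time if `ε ≤ 1`; hence `δ = min ε 1`.

Words must also stay short, although `F` need not be a distance. If `F i j` is finite, the recursion
yields a path of a special shape (`IJKSystem.lowHigh`). It can be chosen with few steps, and the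
relations then bound `F` along it by `3 * M * n` (`IJKSystem.le`). -/

theorem HasPath.trans {n : ℕ} {G : WMatrix n} {i j k : Fin n} {x y : ℤ}
    (h : HasPath G i j x) (h' : HasPath G j k y) : HasPath G i k (x + y) := by
  induction h with
  | nil i => simpa using h'
  | cons hw _ ih => rw [add_assoc]; exact .cons hw (ih h')

theorem HasPath.single {n : ℕ} {G : WMatrix n} {i j : Fin n} {x : ℤ} (h : G i j = x) :
    HasPath G i j x := by simpa using HasPath.cons h (.nil j)

/-- Walks inside the vertex set `S`, with total weight and number of edges. -/
inductive WalkIn {n : ℕ} (G : WMatrix n) (S : Finset (Fin n)) : Fin n → Fin n → ℤ → ℕ → Prop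
  | nil (i : Fin n) : i ∈ S → WalkIn G S i i 0 0
  | cons {i j k : Fin n} {w x : ℤ} {l : ℕ} (hi : i ∈ S) (hw : G i j = (w : WithTop ℤ))
      (hp : WalkIn G S j k x l) : WalkIn G S i k (w + x) (l + 1)

theorem WalkIn.hasPath {n : ℕ} {G : WMatrix n} {S : Finset (Fin n)} {i j : Fin n} {x : ℤ} {l : ℕ}
    (h : WalkIn G S i j x l) : HasPath G i j x := by
  induction h with
  | nil i _ => exact .nil i
  | cons _ hw _ ih => exact .cons hw ih

theorem HasPath.walkIn {n : ℕ} {G : WMatrix n} {i j : Fin n} {x : ℤ}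
    (h : HasPath G i j x) : ∃ l, WalkIn G Finset.univ i j x l := by
  induction h with
  | nil i => exact ⟨0, .nil i (Finset.mem_univ _)⟩
  | cons hw _ ih => obtain ⟨l, hl⟩ := ih; exact ⟨l + 1, .cons (Finset.mem_univ _) hw hl⟩

theorem WalkIn.mono {n : ℕ} {G : WMatrix n} {S T : Finset (Fin n)} (hST : S ⊆ T) {i j : Fin n}
    {x : ℤ} {l : ℕ} (h : WalkIn G S i j x l) : WalkIn G T i j x l := by
  induction h with
  | nil i hi => exact .nil i (hST hi)
  | cons hi hw _ ih => exact .cons (hST hi) hw ih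

/-- Split a walk at its last visit of `v`. -/
theorem WalkIn.last_visit {n : ℕ} {G : WMatrix n} {S : Finset (Fin n)} (v : Fin n) {i j : Fin n}
    {x : ℤ} {l : ℕ} (h : WalkIn G S i j x l) :
    (∃ l', WalkIn G (S.erase v) i j x l') ∨
    (∃ y, HasPath G i v y ∧ ((j = v ∧ x = y) ∨
      ∃ (k : Fin n) (w z : ℤ) (l' : ℕ), G v k = (w : WithTop ℤ) ∧ WalkIn G (S.erase v) k j z l' ∧ x = y + (w + z))) := by
  induction h with
  | nil i hi =>
    by_cases hv : i = v
    · subst hv; exact .inr ⟨0, .nil _, .inl ⟨rfl, rfl⟩⟩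
    · exact .inl ⟨0, .nil i (Finset.mem_erase.2 ⟨hv, hi⟩)⟩
  | @cons i j k w x l hi hw hp ih =>
    rcases ih with ⟨l', hl'⟩ | ⟨y, hy, hrest⟩
    · by_cases hv : i = v
      · subst hv
        exact .inr ⟨0, .nil _, .inr ⟨j, w, x, l', hw, hl', by simp⟩⟩
      · exact .inl ⟨_, .cons (Finset.mem_erase.2 ⟨hv, hi⟩) hw hl'⟩
    · refine .inr ⟨w + y, .cons hw hy, ?_⟩
      rcases hrest with ⟨rfl, rfl⟩ | ⟨k', w', z, l', h1, h2, rfl⟩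
      · exact .inl ⟨rfl, rfl⟩
      · exact .inr ⟨k', w', z, l', h1, h2, by ring⟩

/-- The part up to the last visit of the start is closed, hence of nonnegative weight, and can be
dropped. What follows avoids the start, so the induction removes it from `S`. -/
theorem WalkIn.shorten {n : ℕ} {G : WMatrix n} (hG : NoNegativeCycle G) (S : Finset (Fin n)) :
    ∀ {i j : Fin n} {x : ℤ} {l : ℕ}, WalkIn G S i j x l →
      ∃ x' l', x' ≤ x ∧ l' + 1 ≤ S.card ∧ WalkIn G S i j x' l' := by
  induction S using Finset.strongInduction with
  | H S ih =>
    intro i j x l h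
    have hi : i ∈ S := by cases h <;> assumption
    have hc : (S.erase i).card + 1 = S.card := Finset.card_erase_add_one hi
    rcases h.last_visit i with ⟨l', hl'⟩ | ⟨y, hy, hrest⟩
    · have : i ∈ S.erase i := by cases hl' <;> assumption
      simp at this
    · have h0 := hG i y hy
      rcases hrest with ⟨rfl, rfl⟩ | ⟨k, w, z, l', h1, h2, rfl⟩
      · exact ⟨0, 0, h0, by omega, .nil _ hi⟩
      · obtain ⟨x', l'', hx, hl, hwalk⟩ := ih _ (Finset.erase_ssubset hi) h2
        exact ⟨w + x', l'' + 1, by omega, by omega,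
          .cons hi h1 (hwalk.mono (Finset.erase_subset _ _))⟩

theorem WalkIn.abs_le {n : ℕ} {G : WMatrix n} {S : Finset (Fin n)} {B : ℕ}
    (hB : ∀ (i j : Fin n) (w : ℤ), G i j = (w : WithTop ℤ) → |w| ≤ B) {i j : Fin n} {x : ℤ} {l : ℕ}
    (h : WalkIn G S i j x l) : |x| ≤ (l : ℤ) * B := by
  induction h with
  | nil i _ => simp
  | @cons i j k w x l hi hw hp ih =>
    have h1 := hB _ _ _ hw
    have h2 := abs_add_le w x
    push_cast
    linarith

theorem HasPath.exists_short {n : ℕ} {G : WMatrix n} (hG : NoNegativeCycle G) {B : ℕ}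
    (hB : ∀ (i j : Fin n) (w : ℤ), G i j = (w : WithTop ℤ) → |w| ≤ B) {i j : Fin n} {x : ℤ}
    (h : HasPath G i j x) : ∃ x', x' ≤ x ∧ |x'| ≤ (n : ℤ) * B ∧ HasPath G i j x' := by
  obtain ⟨l, hl⟩ := h.walkIn
  obtain ⟨x', l', hx, hl', hw⟩ := hl.shorten hG
  refine ⟨x', hx, (hw.abs_le hB).trans ?_, hw.hasPath⟩
  have : l' ≤ n := by simp at hl'; omega
  gcongr

/-- The answers to a query with bounded weights are bounded. -/
theorem APSP_solution_abs_le {n : ℕ} {G D : WMatrix n} (hG : NoNegativeCycle G) {B : ℕ}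
    (hB : ∀ (i j : Fin n) (w : ℤ), G i j = (w : WithTop ℤ) → |w| ≤ B)
    (hD : APSP.IsSolution G D) (i j : Fin n) (d : ℤ) (h : D i j = (d : WithTop ℤ)) :
    |d| ≤ (n : ℤ) * B := by
  obtain ⟨h1, h2⟩ := (hD i j d).1 h
  obtain ⟨x', hx, hx', hp⟩ := HasPath.exists_short hG hB h1
  have := h2 hp
  rw [le_antisymm this hx]; exact hx'

/-- A weight below all path weights is below the distance. -/
theorem APSP_solution_ge {n : ℕ} {G D : WMatrix n} (hD : APSP.IsSolution G D) {i j : Fin n}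
    {a : WithTop ℤ} (h : ∀ x, HasPath G i j x → a ≤ (x : WithTop ℤ)) : a ≤ D i j := by
  rcases hd : D i j with _ | d
  · exact le_top
  · exact h d ((hD i j d).1 hd).1

/-- `IsSolution` ties finite entries to existing minima only, so an entry could be `∞` if the path
weights had no least element. Shortening bounds them from below, hence a minimum exists. -/
theorem APSP_solution_le {n : ℕ} {G D : WMatrix n} (hG : NoNegativeCycle G)
    (hD : APSP.IsSolution G D) {i j : Fin n} {x : ℤ} (h : HasPath G i j x) :
    D i j ≤ (x : WithTop ℤ) := by
  classical
  have hB : ∃ B : ℕ, ∀ (i j : Fin n) (w : ℤ), G i j = (w : WithTop ℤ) → |w| ≤ B := by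
    refine ⟨∑ i, ∑ j, ((G i j).untopD 0).natAbs, fun i j w hw => ?_⟩
    have h1 : ((G i j).untopD 0).natAbs ≤ ∑ i, ∑ j, ((G i j).untopD 0).natAbs :=
      (Finset.single_le_sum (f := fun j => ((G i j).untopD 0).natAbs) (fun _ _ => Nat.zero_le _)
        (Finset.mem_univ j)).trans
      (Finset.single_le_sum (f := fun i => ∑ j, ((G i j).untopD 0).natAbs)
        (fun _ _ => Nat.zero_le _) (Finset.mem_univ i))
    rw [hw] at h1
    simp only [WithTop.untopD_coe] at h1
    rw [Int.abs_eq_natAbs]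
    exact_mod_cast h1
  obtain ⟨B, hB⟩ := hB
  have hbdd : ∀ y, HasPath G i j y → -((n : ℤ) * B) ≤ y := fun y hy => by
    obtain ⟨x', hx, hx', -⟩ := HasPath.exists_short hG hB hy
    exact (abs_le.1 hx').1.trans hx
  obtain ⟨d, hd, hmin⟩ := Int.exists_least_of_bdd (P := fun y => HasPath G i j y)
    ⟨_, fun z hz => hbdd z hz⟩ ⟨x, h⟩
  rw [(hD i j d).2 ⟨hd, fun y hy => hmin y hy⟩]
  exact WithTop.coe_le_coe.2 (hmin x h)

/-- A graph whose edges increase a rank has no closed walks but the trivial ones. -/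
theorem noNegativeCycle_of_rank {n : ℕ} {G : WMatrix n} (ρ : Fin n → ℕ)
    (hρ : ∀ i j, G i j ≠ ⊤ → ρ i < ρ j) : NoNegativeCycle G := by
  have key : ∀ i j x, HasPath G i j x → ρ i < ρ j ∨ (i = j ∧ x = 0) := by
    intro i j x h
    induction h with
    | nil i => exact .inr ⟨rfl, rfl⟩
    | cons hw _ ih =>
      have := hρ _ _ (by rw [hw]; exact WithTop.coe_ne_top)
      rcases ih with h | ⟨rfl, -⟩
      · exact .inl (this.trans h)
      · exact .inl this
  intro i x h
  rcases key i i x h with h | ⟨-, rfl⟩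
  · exact absurd h (lt_irrefl _)
  · exact le_rfl

/-! ### The output of the IJK algorithm -/

/-- The entries of a matrix, indexed by natural numbers; `∞` outside the range. -/
def entry {n : ℕ} (A : WMatrix n) (i j : ℕ) : WithTop ℤ :=
  if h : i < n ∧ j < n then A ⟨i, h.1⟩ ⟨j, h.2⟩ else ⊤

theorem entry_val {n : ℕ} (A : WMatrix n) (i j : Fin n) : entry A i j = A i j := by
  simp [entry]

theorem entry_eq_top {n : ℕ} (A : WMatrix n) {i j : ℕ} (h : ¬(i < n ∧ j < n)) :
    entry A i j = ⊤ := dif_neg h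

/-- The closed form of the result of the IJK algorithm on the matrix `w`. -/
def ijkValue (n : ℕ) (w : ℕ → ℕ → WithTop ℤ) (i j : ℕ) : WithTop ℤ :=
  min (w i j) ((Finset.range n).inf fun k =>
    -- When `(i, j)` is treated, `(i, k)` has already been settled exactly if `k < j`, and `(k, j)`
    -- exactly if `k < i`.
    (if _h : k < j then ijkValue n w i k else w i k) +
    (if _h : k < i then ijkValue n w k j else w k j))
termination_by i + j

theorem ijkValue_le_weight (n : ℕ) (w : ℕ → ℕ → WithTop ℤ) (i j : ℕ) : ijkValue n w i j ≤ w i j := by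
  rw [ijkValue]; exact min_le_left _ _

theorem ijkValue_le_term (n : ℕ) (w : ℕ → ℕ → WithTop ℤ) (i j : ℕ) {k : ℕ} (hk : k < n) :
    ijkValue n w i j ≤ (if k < j then ijkValue n w i k else w i k) +
      (if k < i then ijkValue n w k j else w k j) := by
  rw [ijkValue]
  refine (min_le_right _ _).trans ((Finset.inf_le (Finset.mem_range.2 hk)).trans ?_)
  simp

theorem ijkValue_cases (n : ℕ) (w : ℕ → ℕ → WithTop ℤ) (i j : ℕ) :
    ijkValue n w i j = w i j ∨ ∃ k < n, ijkValue n w i j =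
      (if k < j then ijkValue n w i k else w i k) +
      (if k < i then ijkValue n w k j else w k j) := by
  rcases Nat.eq_zero_or_pos n with rfl | hn
  · left; rw [ijkValue]; simp
  · obtain ⟨k, hk, h⟩ := Finset.exists_mem_eq_inf (Finset.range n) ⟨0, Finset.mem_range.2 hn⟩
      (fun k => (if _h : k < j then ijkValue n w i k else w i k) +
        (if _h : k < i then ijkValue n w k j else w k j))
    have h1 : ijkValue n w i j = min (w i j) ((Finset.range n).inf fun k =>
        (if _h : k < j then ijkValue n w i k else w i k) +
        (if _h : k < i then ijkValue n w k j else w k j)) := by rw [ijkValue]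
    rw [h] at h1
    rcases min_choice (w i j) ((if _h : k < j then ijkValue n w i k else w i k) +
        (if _h : k < i then ijkValue n w k j else w k j)) with h2 | h2
    · left; rw [h1, h2]
    · right; refine ⟨k, Finset.mem_range.1 hk, ?_⟩; rw [h1, h2]; simp

/-- A final value enters the recursion only with `k < j` or `k < i`, which lowers `i + j`. Without
negative cycles this bounds the result from below and forces the diagonal to be `0`. -/
theorem ijkValue_hasPath {n : ℕ} {G : WMatrix n} {w : ℕ → ℕ → WithTop ℤ}
    (hw : ∀ (i j : Fin n) (x : ℤ), w i j = x → HasPath G i j x) :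
    ∀ (i j : Fin n) (x : ℤ), ijkValue n w i j = x → HasPath G i j x := by
  have key : ∀ (N : ℕ) (i j : Fin n), (i : ℕ) + j = N → ∀ x : ℤ, ijkValue n w i j = x →
      HasPath G i j x := by
    intro N
    induction N using Nat.strong_induction_on with
    | _ N ih =>
      rintro i j rfl x hx
      rcases ijkValue_cases n w i j with h | ⟨k, hk, h⟩
      · exact hw i j x (h ▸ hx)
      · rw [h] at hx
        obtain ⟨a, b, ha, hb, rfl⟩ := WithTop.add_eq_coe.1 hx
        refine HasPath.trans (j := ⟨k, hk⟩) ?_ ?_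
        · split_ifs at ha with h1
          · exact ih (i + k) (by omega) i ⟨k, hk⟩ rfl a ha.symm
          · exact hw i ⟨k, hk⟩ a ha.symm
        · split_ifs at hb with h1
          · exact ih (k + j) (by omega) ⟨k, hk⟩ j rfl b hb.symm
          · exact hw ⟨k, hk⟩ j b hb.symm
  exact fun i j => key _ i j rfl

theorem HasPath.of_adjacencyMatrix {n : ℕ} {G : WMatrix n} (i j : Fin n) (x : ℤ)
    (h : entry (adjacencyMatrix G) i j = x) : HasPath G i j x := by
  rw [entry_val, adjacencyMatrix] at h
  split_ifs at h with hij
  · subst hij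
    have : x = 0 := by exact_mod_cast h.symm
    subst this; exact .nil i
  · exact .single h

theorem ijkValue_diag {n : ℕ} {G : WMatrix n} (hG : NoNegativeCycle G) (i : Fin n) :
    ijkValue n (entry (adjacencyMatrix G)) i i = 0 := by
  refine le_antisymm ?_ ?_
  · refine (ijkValue_le_weight _ _ _ _).trans ?_
    rw [entry_val]; simp [adjacencyMatrix]
  · rcases h : ijkValue n (entry (adjacencyMatrix G)) i i with _ | x
    · exact le_top
    · exact WithTop.coe_le_coe.2 (hG i x (ijkValue_hasPath HasPath.of_adjacencyMatrix i i x h))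

theorem ijkValue_range {n : ℕ} {w : ℕ → ℕ → WithTop ℤ} (hw : ∀ i j, w i j ≠ ⊤ → i < n ∧ j < n)
    (i j : ℕ) : ijkValue n w i j ≠ ⊤ → i < n ∧ j < n := by
  have key : ∀ (N i j : ℕ), i + j = N → ijkValue n w i j ≠ ⊤ → i < n ∧ j < n := by
    intro N
    induction N using Nat.strong_induction_on with
    | _ N ih =>
      rintro i j rfl hx
      rcases ijkValue_cases n w i j with h | ⟨k, hk, h⟩
      · exact hw i j (h ▸ hx)
      · rw [h] at hx
        obtain ⟨ha, hb⟩ := WithTop.add_ne_top.1 hx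
        constructor
        · split_ifs at ha with h1
          · exact (ih _ (by omega) i k rfl ha).1
          · exact (hw i k ha).1
        · split_ifs at hb with h1
          · exact (ih _ (by omega) k j rfl hb).2
          · exact (hw k j hb).2
  exact key _ i j rfl

/-! ### The loops of the algorithm follow the closed form. -/

theorem foldl_finRange_induct {n : ℕ} {β : Type*} (f : β → Fin n → β) (P : ℕ → β → Prop) (b : β)
    (h0 : P 0 b) (hs : ∀ (k : Fin n) (b : β), P k b → P (k + 1) (f b k)) :
    P n ((List.finRange n).foldl f b) := by
  induction n with
  | zero => simpa using h0
  | succ n ih =>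
    rw [List.finRange_succ_last, List.foldl_append, List.foldl_map]
    exact hs (Fin.last n) _ (ih (fun b k => f b k.castSucc) (fun k b h => hs k.castSucc b h))

theorem foldl_relax_diag {n : ℕ} (A : WMatrix n) (i : Fin n) (h0 : A i i = 0)
    (h : ∀ k, 0 ≤ A i k + A k i) (l : List (Fin n)) :
    l.foldl (fun A k => relax A i i k) A = A := by
  induction l with
  | nil => rfl
  | cons k l ih =>
    have : relax A i i k = A := by
      ext a b
      unfold relax
      split_ifs with hab
      · obtain ⟨rfl, rfl⟩ := hab
        rw [h0]; exact min_eq_left (h k)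
      · rfl
    rw [List.foldl_cons, this, ih]

/-- Only the entry `(i, j)` changes, and it is read back only for `k = i` or `k = j`, where the zero
diagonal makes the sum equal to the entry itself. So all other sums may be read from the initial
matrix, and the order of the `k` is irrelevant. -/
theorem foldl_relax {n : ℕ} (i j : Fin n) (hij : i ≠ j) (l : List (Fin n)) :
    ∀ A : WMatrix n, A i i = 0 → A j j = 0 → ∀ a b,
    l.foldl (fun A k => relax A i j k) A a b =
      if a = i ∧ b = j then min (A i j) (l.toFinset.inf fun k => A i k + A k j) else A a b := by
  induction l with
  | nil =>
    intro A _ _ a b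
    split_ifs with h
    · obtain ⟨rfl, rfl⟩ := h; simp
    · rfl
  | cons k l ih =>
    intro A hi hj a b
    have hne : ∀ a b, ¬(a = i ∧ b = j) → relax A i j k a b = A a b := fun a b h => if_neg h
    have heq : relax A i j k i j = min (A i j) (A i k + A k j) := if_pos ⟨rfl, rfl⟩
    rw [List.foldl_cons, ih (relax A i j k) (by rw [hne _ _ (by tauto), hi])
      (by rw [hne _ _ (by rintro ⟨rfl, -⟩; exact hij rfl), hj])]
    split_ifs with h
    · rw [List.toFinset_cons, Finset.inf_insert, ← min_assoc, ← heq]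
      have hle : relax A i j k i j ≤ A i j := heq ▸ min_le_left _ _
      have hterm : ∀ k', min (relax A i j k i j) (relax A i j k i k' + relax A i j k k' j) =
          min (relax A i j k i j) (A i k' + A k' j) := by
        intro k'
        by_cases h1 : k' = j
        · subst h1
          rw [hne k' k' (by rintro ⟨rfl, -⟩; exact hij rfl), hj, add_zero, add_zero, min_self,
            min_eq_left hle]
        · by_cases h2 : k' = i
          · subst h2
            rw [hne k' k' (by rintro ⟨-, rfl⟩; exact hij rfl), hi, zero_add, zero_add, min_self,
              min_eq_left hle]
          · rw [hne i k' (by tauto), hne k' j (by tauto)]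
      apply le_antisymm
      · refine le_min (min_le_left _ _) (Finset.le_inf fun k' hk' => ?_)
        have h1 := (min_le_min_left (relax A i j k i j) (Finset.inf_le
          (f := fun k' => relax A i j k i k' + relax A i j k k' j) hk')).trans (hterm k').le
        exact h1.trans (min_le_right _ _)
      · refine le_min (min_le_left _ _) (Finset.le_inf fun k' hk' => ?_)
        have h1 := (min_le_min_left (relax A i j k i j) (Finset.inf_le
          (f := fun k' => A i k' + A k' j) hk')).trans (hterm k').ge
        exact h1.trans (min_le_right _ _)
    · exact hne a b h

/-- The matrix held by the IJK algorithm just before it treats the entry `(i, j)`. -/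
def ijkState (n : ℕ) (w : ℕ → ℕ → WithTop ℤ) (i j : ℕ) : WMatrix n := fun a b =>
  if (a : ℕ) < i ∨ ((a : ℕ) = i ∧ (b : ℕ) < j) then ijkValue n w a b else w a b

theorem ijkState_hasPath {n : ℕ} {G : WMatrix n} (i j : ℕ) (a b : Fin n) (x : ℤ)
    (h : ijkState n (entry (adjacencyMatrix G)) i j a b = x) : HasPath G a b x := by
  unfold ijkState at h
  split_ifs at h with h1
  · exact ijkValue_hasPath HasPath.of_adjacencyMatrix a b x h
  · exact HasPath.of_adjacencyMatrix a b x h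

theorem ijkState_step {n : ℕ} {G : WMatrix n} (hG : NoNegativeCycle G) (i j : Fin n) :
    (List.finRange n).foldl (fun A k => relax A i j k)
      (ijkState n (entry (adjacencyMatrix G)) i j) =
      ijkState n (entry (adjacencyMatrix G)) i (j + 1) := by
  have hdiag : ∀ k : Fin n, ijkState n (entry (adjacencyMatrix G)) i j k k = 0 := by
    intro k
    unfold ijkState
    split_ifs
    · exact ijkValue_diag hG k
    · rw [entry_val]; simp [adjacencyMatrix]
  have hkeep : ∀ a b : Fin n, ¬(a = i ∧ b = j) →
      ijkState n (entry (adjacencyMatrix G)) i j a b =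
        ijkState n (entry (adjacencyMatrix G)) i (j + 1) a b := by
    intro a b hab
    have : ((a : ℕ) < i ∨ ((a : ℕ) = i ∧ (b : ℕ) < j)) ↔
        ((a : ℕ) < i ∨ ((a : ℕ) = i ∧ (b : ℕ) < j + 1)) := by
      rw [Fin.ext_iff, Fin.ext_iff] at hab; omega
    unfold ijkState
    simp only [this]
  have hnew : ijkState n (entry (adjacencyMatrix G)) i (j + 1) i j =
      ijkValue n (entry (adjacencyMatrix G)) i j := by simp [ijkState]
  by_cases hij : i = j
  · subst hij
    rw [foldl_relax_diag _ _ (hdiag i)]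
    · ext a b
      by_cases hab : a = i ∧ b = i
      · obtain ⟨rfl, rfl⟩ := hab
        rw [hdiag, hnew, ijkValue_diag hG]
      · exact hkeep a b hab
    -- Every entry held by the algorithm is the weight of a path, so this sum is the weight of a
    -- closed path.
    · intro k
      rcases h : ijkState n (entry (adjacencyMatrix G)) i i i k +
        ijkState n (entry (adjacencyMatrix G)) i i k i with _ | x
      · exact le_top
      · obtain ⟨a, b, ha, hb, rfl⟩ := WithTop.add_eq_coe.1 h
        exact WithTop.coe_le_coe.2 (hG i _ ((ijkState_hasPath _ _ _ _ _ ha.symm).trans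
          (ijkState_hasPath _ _ _ _ _ hb.symm)))
  · ext a b
    rw [foldl_relax i j hij _ _ (hdiag i) (hdiag j)]
    split_ifs with hab
    · obtain ⟨rfl, rfl⟩ := hab
      rw [hnew]
      have h1 : ijkState n (entry (adjacencyMatrix G)) a b a b = entry (adjacencyMatrix G) a b := by
        simp [ijkState]
      have hterm : ∀ k : Fin n, ijkState n (entry (adjacencyMatrix G)) a b a k +
          ijkState n (entry (adjacencyMatrix G)) a b k b =
          (if (k : ℕ) < b then ijkValue n (entry (adjacencyMatrix G)) a k
            else entry (adjacencyMatrix G) a k) +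
          (if (k : ℕ) < a then ijkValue n (entry (adjacencyMatrix G)) k b
            else entry (adjacencyMatrix G) k b) := by
        intro k; simp [ijkState]
      rw [h1]
      apply le_antisymm
      · rcases ijkValue_cases n (entry (adjacencyMatrix G)) a b with h | ⟨k, hk, h⟩
        · rw [h]; exact min_le_left _ _
        · rw [h]
          refine (min_le_right _ _).trans ((Finset.inf_le (b := ⟨k, hk⟩) (by simp)).trans ?_)
          rw [hterm]
      · refine le_min (ijkValue_le_weight _ _ _ _) (Finset.le_inf fun k _ => ?_)
        rw [hterm]
        exact ijkValue_le_term _ _ _ _ k.2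
    · exact hkeep a b hab

theorem ijkAlgorithm_eq {n : ℕ} {G : WMatrix n} (hG : NoNegativeCycle G) (i j : Fin n) :
    ijkAlgorithm (adjacencyMatrix G) i j = ijkValue n (entry (adjacencyMatrix G)) i j := by
  have hrow : ∀ i : Fin n, (List.finRange n).foldl (fun A j =>
      (List.finRange n).foldl (fun A k => relax A i j k) A)
      (ijkState n (entry (adjacencyMatrix G)) i 0) =
      ijkState n (entry (adjacencyMatrix G)) (i + 1) 0 := by
    intro i
    have := foldl_finRange_induct (fun A j => (List.finRange n).foldl (fun A k => relax A i j k) A)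
      (fun j A => A = ijkState n (entry (adjacencyMatrix G)) i j) _ rfl
      (fun j A h => by rw [h]; exact ijkState_step hG i j)
    rw [this]
    ext a b
    -- Column `n` of row `i` is the same moment as column `0` of row `i + 1`.
    have : ((a : ℕ) < i ∨ ((a : ℕ) = i ∧ (b : ℕ) < n)) ↔
        ((a : ℕ) < i + 1 ∨ ((a : ℕ) = i + 1 ∧ (b : ℕ) < 0)) := by
      have := b.2; omega
    unfold ijkState
    simp only [this]
  have h := foldl_finRange_induct (fun A i => (List.finRange n).foldl (fun A j =>
      (List.finRange n).foldl (fun A k => relax A i j k) A) A)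
      (fun i A => A = ijkState n (entry (adjacencyMatrix G)) i 0) (adjacencyMatrix G)
      (by ext a b; simp [ijkState, entry_val])
      (fun i A h => by rw [h]; exact hrow i)
  unfold ijkAlgorithm
  rw [h]
  simp [ijkState]

/-- The relations between the weights `w` and the result `F` of the IJK algorithm. -/
structure IJKSystem (n : ℕ) (w F : ℕ → ℕ → WithTop ℤ) : Prop where
  weight_range : ∀ i j, w i j ≠ ⊤ → i < n ∧ j < n
  range : ∀ i j, F i j ≠ ⊤ → i < n ∧ j < n
  weight_diag : ∀ i < n, w i i = 0
  diag : ∀ i < n, F i i = 0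
  edge : ∀ i j, F i j ≤ w i j
  peak : ∀ {i j k}, i < k → j < k → F i j ≤ w i k + w k j
  low : ∀ {i j k}, k < i → k < j → F i j ≤ F i k + F k j
  right : ∀ {i j k}, i < k → k < j → F i j ≤ F i k + w k j
  left : ∀ {i j k}, j < k → k < i → F i j ≤ w i k + F k j
  cases : ∀ i j, F i j ≠ ⊤ → F i j = w i j ∨
    (∃ k, i < k ∧ j < k ∧ F i j = w i k + w k j) ∨
    (∃ k, k < i ∧ k < j ∧ F i j = F i k + F k j) ∨
    (∃ k, i < k ∧ k < j ∧ F i j = F i k + w k j) ∨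
    (∃ k, j < k ∧ k < i ∧ F i j = w i k + F k j)

/-- Reversing all edges exchanges left and right splits and keeps the other two kinds, so that
arguments for `i < j` also serve for `j < i`. -/
theorem IJKSystem.transpose {n : ℕ} {w F : ℕ → ℕ → WithTop ℤ} (h : IJKSystem n w F) :
    IJKSystem n (fun i j => w j i) (fun i j => F j i) where
  weight_range i j hw := (h.weight_range j i hw).symm
  range i j hw := (h.range j i hw).symm
  weight_diag := h.weight_diag
  diag := h.diag
  edge i j := h.edge j i
  peak h1 h2 := by rw [add_comm]; exact h.peak h2 h1
  low h1 h2 := by rw [add_comm]; exact h.low h2 h1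
  right h1 h2 := by rw [add_comm]; exact h.left h1 h2
  left h1 h2 := by rw [add_comm]; exact h.right h1 h2
  cases i j hF := by
    rcases h.cases j i hF with h | ⟨k, h1, h2, h⟩ | ⟨k, h1, h2, h⟩ | ⟨k, h1, h2, h⟩ | ⟨k, h1, h2, h⟩
    · exact .inl h
    · exact .inr (.inl ⟨k, h2, h1, by rw [add_comm]; exact h⟩)
    · exact .inr (.inr (.inl ⟨k, h2, h1, by rw [add_comm]; exact h⟩))
    · exact .inr (.inr (.inr (.inr ⟨k, h1, h2, by rw [add_comm]; exact h⟩)))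
    · exact .inr (.inr (.inr (.inl ⟨k, h1, h2, by rw [add_comm]; exact h⟩)))

/-- The position of `k` relative to `i` and `j` decides which summands are final. The cases `k = i`
and `k = j` add nothing to the edge, because the diagonal is `0`. -/
theorem ijkSystem {n : ℕ} {G : WMatrix n} (hG : NoNegativeCycle G) :
    IJKSystem n (entry (adjacencyMatrix G)) (ijkValue n (entry (adjacencyMatrix G))) := by
  set w := entry (adjacencyMatrix G) with hwdef
  have hwr : ∀ i j, w i j ≠ ⊤ → i < n ∧ j < n := fun i j h => by
    by_contra hc; exact h (entry_eq_top _ hc)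
  have hFr := ijkValue_range hwr
  have hFd : ∀ i < n, ijkValue n w i i = 0 := fun i hi => ijkValue_diag hG ⟨i, hi⟩
  have hwd : ∀ i < n, w i i = 0 := fun i hi => by
    rw [hwdef, entry_val _ ⟨i, hi⟩ ⟨i, hi⟩]; simp [adjacencyMatrix]
  refine ⟨hwr, hFr, hwd, hFd, ijkValue_le_weight n w, ?_, ?_, ?_, ?_, ?_⟩
  · intro i j k h1 h2
    by_cases hk : k < n
    · have := ijkValue_le_term n w i j hk
      rwa [if_neg (by omega), if_neg (by omega)] at this
    · have : w i k = ⊤ := by by_contra hc; exact hk (hwr _ _ hc).2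
      simp [this]
  · intro i j k h1 h2
    by_cases hk : k < n
    · have := ijkValue_le_term n w i j hk
      rwa [if_pos (by omega), if_pos (by omega)] at this
    · have : ijkValue n w i k = ⊤ := by by_contra hc; exact hk (hFr _ _ hc).2
      simp [this]
  · intro i j k h1 h2
    by_cases hk : k < n
    · have := ijkValue_le_term n w i j hk
      rwa [if_pos (by omega), if_neg (by omega)] at this
    · have : ijkValue n w i k = ⊤ := by by_contra hc; exact hk (hFr _ _ hc).2
      simp [this]
  · intro i j k h1 h2
    by_cases hk : k < n
    · have := ijkValue_le_term n w i j hk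
      rwa [if_neg (by omega), if_pos (by omega)] at this
    · have : w i k = ⊤ := by by_contra hc; exact hk (hwr _ _ hc).2
      simp [this]
  · intro i j hF
    rcases ijkValue_cases n w i j with h | ⟨k, hk, h⟩
    · exact .inl h
    · rcases lt_trichotomy k i with h1 | rfl | h1 <;> rcases lt_trichotomy k j with h2 | rfl | h2
      · rw [if_pos h2, if_pos h1] at h; exact .inr (.inr (.inl ⟨k, h1, h2, h⟩))
      · rw [if_neg (lt_irrefl _), if_pos h1, hFd _ hk, add_zero] at h; exact .inl h
      · rw [if_neg (by omega), if_pos h1] at h; exact .inr (.inr (.inr (.inr ⟨k, h2, h1, h⟩)))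
      · rw [if_pos h2, if_neg (lt_irrefl _), hFd _ hk, zero_add] at h; exact .inl h
      · exact .inl ((hFd _ hk).trans (hwd _ hk).symm)
      · rw [if_neg (by omega), if_neg (lt_irrefl _), hwd _ hk, zero_add] at h; exact .inl h
      · rw [if_pos h2, if_neg (by omega)] at h; exact .inr (.inr (.inr (.inl ⟨k, h1, h2, h⟩)))
      · rw [if_neg (lt_irrefl _), if_neg (by omega), hwd _ hk, add_zero] at h; exact .inl h
      · rw [if_neg (by omega), if_neg (by omega)] at h; exact .inr (.inl ⟨k, h1, h2, h⟩)

/-! ### Finite entries of the result are small -/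

/-- There is an edge from `x` to `y`, or a path of two edges through a vertex larger than both. -/
def PeakStep (w : ℕ → ℕ → WithTop ℤ) (x y : ℕ) : Prop :=
  w x y ≠ ⊤ ∨ ∃ z, x < z ∧ y < z ∧ w x z ≠ ⊤ ∧ w z y ≠ ⊤

open Classical in
/-- The unweighted graph of those peak steps that start at a vertex at most `a`. -/
noncomputable def lowGraph (n : ℕ) (w : ℕ → ℕ → WithTop ℤ) (a : ℕ) : WMatrix n := fun x y =>
  if (x : ℕ) ≤ a ∧ PeakStep w x y then 1 else ⊤

theorem lowGraph_eq {n : ℕ} {w : ℕ → ℕ → WithTop ℤ} {a : ℕ} {x y : Fin n} (hx : (x : ℕ) ≤ a)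
    (h : PeakStep w x y) : lowGraph n w a x y = ((1 : ℤ) : WithTop ℤ) := if_pos ⟨hx, h⟩

theorem of_lowGraph_eq {n : ℕ} {w : ℕ → ℕ → WithTop ℤ} {a : ℕ} {x y : Fin n} {v : ℤ}
    (h : lowGraph n w a x y = v) : ((x : ℕ) ≤ a ∧ PeakStep w x y) ∧ v = 1 := by
  unfold lowGraph at h
  split_ifs at h with h1
  · exact ⟨h1, by exact_mod_cast h.symm⟩
  · exact absurd h WithTop.top_ne_coe

theorem PeakStep.transpose {w : ℕ → ℕ → WithTop ℤ} {x y : ℕ}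
    (h : PeakStep (fun i j => w j i) x y) : PeakStep w y x := by
  rcases h with h | ⟨z, h1, h2, h3, h4⟩
  · exact .inl h
  · exact .inr ⟨z, h2, h1, h4, h3⟩

/-- The vertex `y` can be reached from `x` in the graph `lowGraph n w a`. -/
def LowReach (n : ℕ) (w : ℕ → ℕ → WithTop ℤ) (a : ℕ) (x y : Fin n) : Prop :=
  ∃ v, HasPath (lowGraph n w a) x y v

theorem LowReach.trans {n : ℕ} {w : ℕ → ℕ → WithTop ℤ} {a : ℕ} {x y z : Fin n}
    (h : LowReach n w a x y) (h' : LowReach n w a y z) : LowReach n w a x z := by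
  obtain ⟨v, hv⟩ := h
  obtain ⟨v', hv'⟩ := h'
  exact ⟨_, hv.trans hv'⟩

theorem LowReach.refl {n : ℕ} {w : ℕ → ℕ → WithTop ℤ} {a : ℕ} (x : Fin n) :
    LowReach n w a x x := ⟨0, .nil x⟩

theorem LowReach.single {n : ℕ} {w : ℕ → ℕ → WithTop ℤ} {a : ℕ} {x y : Fin n} (hx : (x : ℕ) ≤ a)
    (h : PeakStep w x y) : LowReach n w a x y := ⟨1, .single (lowGraph_eq hx h)⟩

theorem LowReach.mono {n : ℕ} {w : ℕ → ℕ → WithTop ℤ} {a k : ℕ} (hk : k ≤ a) {x y : Fin n}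
    (h : LowReach n w k x y) : LowReach n w a x y := by
  obtain ⟨v, hv⟩ := h
  induction hv with
  | nil i => exact .refl i
  | cons hw _ ih =>
    obtain ⟨⟨h1, h2⟩, -⟩ := of_lowGraph_eq hw
    exact (LowReach.single (h1.trans hk) h2).trans ih

theorem HasPath.low_source {n : ℕ} {w : ℕ → ℕ → WithTop ℤ} {k : ℕ} {x y : Fin n} {v : ℤ}
    (h : HasPath (lowGraph n w k) x y v) : x = y ∨ (x : ℕ) ≤ k := by
  cases h with
  | nil => exact .inl rfl
  | cons hw _ => exact .inr (of_lowGraph_eq hw).1.1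

/-- Reversal turns targets into sources. An inner vertex is itself the source of a step and so at
most `k`; only the end `y` needs a bound of its own. -/
theorem LowReach.transpose {n : ℕ} {w : ℕ → ℕ → WithTop ℤ} {a k : ℕ} (hk : k ≤ a) {x y : Fin n}
    (hy : (y : ℕ) ≤ a) (h : LowReach n (fun i j => w j i) k x y) : LowReach n w a y x := by
  obtain ⟨v, hv⟩ := h
  induction hv with
  | nil i => exact .refl i
  | @cons i j l w x hw hp ih =>
    obtain ⟨⟨h1, h2⟩, -⟩ := of_lowGraph_eq hw
    refine (ih hy).trans (.single ?_ h2.transpose)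
    rcases hp.low_source with rfl | h
    · exact hy
    · exact h.trans hk

/-- Paths along edges to larger vertices. -/
abbrev IncReach (n : ℕ) (w : ℕ → ℕ → WithTop ℤ) : Fin n → Fin n → Prop :=
  Relation.ReflTransGen fun x y => x < y ∧ w x y ≠ ⊤

theorem IncReach.lowReach_transpose {n : ℕ} {w : ℕ → ℕ → WithTop ℤ} {a : ℕ} {c y : Fin n}
    (h : IncReach n (fun i j => w j i) c y) (hy : (y : ℕ) ≤ a) : LowReach n w a y c := by
  induction h with
  | refl => exact .refl _
  | tail _ hxy ih =>
    have := hxy.1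
    exact (LowReach.single hy (.inl hxy.2)).trans (ih (by rw [Fin.lt_def] at this; omega))

/-- The shape of a path that is found by the IJK algorithm from `a` to `b`, where `a < b`: peak
steps from vertices at most `a`, followed by edges to larger vertices. -/
def LowHigh (n : ℕ) (w : ℕ → ℕ → WithTop ℤ) (a b : Fin n) : Prop :=
  ∃ c, a < c ∧ LowReach n w a a c ∧ IncReach n w c b

/-- The vertices of the increasing path that do not exceed `a` are moved to the low part. The path
ends at `b > a`, so it meets a first vertex above `a`. -/
theorem LowHigh.of_incReach {n : ℕ} {w : ℕ → ℕ → WithTop ℤ} {a b d : Fin n} (hab : a < b)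
    (h : LowReach n w a a d) (h' : IncReach n w d b) : LowHigh n w a b := by
  induction h' using Relation.ReflTransGen.head_induction_on with
  | refl => exact ⟨b, hab, h, .refl⟩
  | @head d e hde hr ih =>
    by_cases hd : a < d
    · exact ⟨d, hd, h, .head hde hr⟩
    · exact ih (h.trans (.single (not_lt.1 hd) (.inl hde.2)))

/-- At a low split `k`, the transposed system gives a path from `a` to `k` whose steps all start at
vertices at most `a`, and the system itself gives one from `k` to `b`; the first joins the low part.
A right split appends an increasing edge, and a left split cannot occur for `a < b`. -/
theorem IJKSystem.lowHigh {n : ℕ} : ∀ (N : ℕ) {w F : ℕ → ℕ → WithTop ℤ}, IJKSystem n w F →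
    ∀ a b : Fin n, (a : ℕ) + b = N → a < b → F a b ≠ ⊤ → LowHigh n w a b := by
  intro N
  induction N using Nat.strong_induction_on with
  | _ N ih =>
    rintro w F h a b rfl hab hF
    have hab' : (a : ℕ) < b := hab
    rcases h.cases a b hF with e | ⟨k, h1, h2, e⟩ | ⟨k, h1, h2, e⟩ | ⟨k, h1, h2, e⟩ | ⟨k, h1, h2, e⟩
    · exact ⟨b, hab, .single le_rfl (.inl (e ▸ hF)), .refl⟩
    · rw [e] at hF
      obtain ⟨ha, hb⟩ := WithTop.add_ne_top.1 hF
      exact ⟨b, hab, .single le_rfl (.inr ⟨k, h1, h2, ha, hb⟩), .refl⟩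
    · rw [e] at hF
      obtain ⟨ha, hb⟩ := WithTop.add_ne_top.1 hF
      have hk : k < n := (h.range _ _ ha).2
      obtain ⟨c, hc, hc1, hc2⟩ := ih (k + a) (by omega) h.transpose ⟨k, hk⟩ a rfl
        (Fin.lt_def.2 h1) ha
      obtain ⟨d, hd, hd1, hd2⟩ := ih (k + b) (by omega) h ⟨k, hk⟩ b rfl (Fin.lt_def.2 h2) hb
      have hca : (c : ℕ) ≤ a := by
        have : ∀ y, IncReach n (fun i j => w j i) c y → c ≤ y := by
          intro y hy
          induction hy with
          | refl => exact le_rfl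
          | tail _ h ih => exact ih.trans h.1.le
        exact this a hc2
      have e1 : LowReach n w a a c := IncReach.lowReach_transpose hc2 le_rfl
      have e2 : LowReach n w a c ⟨k, hk⟩ := LowReach.transpose h1.le hca hc1
      have e3 : LowReach n w a ⟨k, hk⟩ d := hd1.mono h1.le
      exact LowHigh.of_incReach hab (e1.trans (e2.trans e3)) hd2
    · rw [e] at hF
      obtain ⟨ha, hb⟩ := WithTop.add_ne_top.1 hF
      have hk : k < n := (h.range _ _ ha).2
      obtain ⟨c, hc, hc1, hc2⟩ := ih (a + k) (by omega) h a ⟨k, hk⟩ rfl (Fin.lt_def.2 h1) ha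
      exact ⟨c, hc, hc1, hc2.tail ⟨Fin.lt_def.2 h2, hb⟩⟩
    · omega

/-- Nonempty walks of peak steps with inner vertices below `s`. -/
inductive InnerWalk (n : ℕ) (w : ℕ → ℕ → WithTop ℤ) (s : ℕ) : Fin n → Fin n → ℕ → Prop
  | single {x y : Fin n} (h : PeakStep w x y) : InnerWalk n w s x y 1
  | cons {x z y : Fin n} {l : ℕ} (h : PeakStep w x z) (hz : (z : ℕ) < s)
      (hw : InnerWalk n w s z y l) : InnerWalk n w s x y (l + 1)

theorem HasPath.innerWalk {n : ℕ} {w : ℕ → ℕ → WithTop ℤ} {a : ℕ} {x y : Fin n} {v : ℤ}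
    (h : HasPath (lowGraph n w a) x y v) :
    (x = y ∧ v = 0) ∨ ((x : ℕ) ≤ a ∧ ∃ l : ℕ, v = l ∧ InnerWalk n w (a + 1) x y l) := by
  induction h with
  | nil i => exact .inl ⟨rfl, rfl⟩
  | cons hw hp ih =>
    obtain ⟨⟨h1, h2⟩, rfl⟩ := of_lowGraph_eq hw
    rcases ih with ⟨rfl, rfl⟩ | ⟨hz, l, rfl, hl⟩
    · exact .inr ⟨h1, 1, by simp, .single h2⟩
    · exact .inr ⟨h1, l + 1, by push_cast; ring, .cons h2 (by omega) hl⟩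

/-- The walk is cut at its first and at its last visit of `s`. What lies between is discarded, hence
only an inequality between the lengths. -/
theorem InnerWalk.split {n : ℕ} {w : ℕ → ℕ → WithTop ℤ} {s : Fin n} {x y : Fin n} {l : ℕ}
    (h : InnerWalk n w (s + 1) x y l) : InnerWalk n w s x y l ∨
      ∃ l₁ l₂, l₁ + l₂ ≤ l ∧ InnerWalk n w s x s l₁ ∧ InnerWalk n w s s y l₂ := by
  induction h with
  | single h => exact .inl (.single h)
  | @cons x z y l h hz hw ih =>
    by_cases hzs : z = s
    · subst hzs
      rcases ih with ih | ⟨l₁, l₂, hl, h1, h2⟩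
      · exact .inr ⟨1, l, by omega, .single h, ih⟩
      · exact .inr ⟨1, l₂, by omega, .single h, h2⟩
    · have hz' : (z : ℕ) < s := by rw [Fin.ext_iff] at hzs; omega
      rcases ih with ih | ⟨l₁, l₂, hl, h1, h2⟩
      · exact .inl (.cons h hz' ih)
      · exact .inr ⟨l₁ + 1, l₂, by omega, .cons h hz' h1, h2⟩

theorem IJKSystem.le_of_peakStep {n : ℕ} {w F : ℕ → ℕ → WithTop ℤ} (h : IJKSystem n w F) {M : ℕ}
    (hM : ∀ i j, w i j ≠ ⊤ → w i j ≤ ((M : ℤ) : WithTop ℤ)) {x y : ℕ} (hs : PeakStep w x y) :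
    F x y ≤ ((2 * M : ℤ) : WithTop ℤ) := by
  rcases hs with hs | ⟨z, h1, h2, h3, h4⟩
  · exact (h.edge x y).trans ((hM _ _ hs).trans (WithTop.coe_le_coe.2 (by omega)))
  · refine (h.peak h1 h2).trans ((add_le_add (hM _ _ h3) (hM _ _ h4)).trans ?_)
    rw [← WithTop.coe_add]; exact WithTop.coe_le_coe.2 (by omega)

/-- Vertex elimination as in Floyd-Warshall: the largest inner vertex allowed lies below both ends,
so `low` joins the two pieces. One peak step weighs at most `2 * M`. -/
theorem IJKSystem.le_of_innerWalk {n : ℕ} {w F : ℕ → ℕ → WithTop ℤ} (h : IJKSystem n w F) {M : ℕ}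
    (hM : ∀ i j, w i j ≠ ⊤ → w i j ≤ ((M : ℤ) : WithTop ℤ)) (s : ℕ) :
    ∀ {x y : Fin n} {l : ℕ}, s ≤ x → s ≤ y → InnerWalk n w s x y l →
      F x y ≤ ((2 * M * l : ℤ) : WithTop ℤ) := by
  induction s with
  | zero =>
    intro x y l _ _ hw
    cases hw with
    | single hs => simpa using h.le_of_peakStep hM hs
    | cons _ hz _ => omega
  | succ s ih =>
    intro x y l hx hy hw
    have hs : s < n := by omega
    rcases InnerWalk.split (s := ⟨s, hs⟩) hw with hw | ⟨l₁, l₂, hl, h1, h2⟩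
    · exact ih (by omega) (by omega) hw
    · refine (h.low (k := s) (by omega) (by omega)).trans
        ((add_le_add (ih (y := ⟨s, hs⟩) (by omega) le_rfl h1)
          (ih (x := ⟨s, hs⟩) le_rfl (by omega) h2)).trans ?_)
      rw [← WithTop.coe_add]
      refine WithTop.coe_le_coe.2 ?_
      have : (l₁ : ℤ) + l₂ ≤ l := by exact_mod_cast hl
      nlinarith

/-- Finiteness of `F a b` provides a path of the shape `LowHigh`. As an unweighted path, its low
part shortens to at most `n` peak steps and contributes at most `2 * M * n`. Each increasing edge
then adds at most `M` by `right`, and there are at most `b` of them. -/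
theorem IJKSystem.le_of_lt {n : ℕ} {w F : ℕ → ℕ → WithTop ℤ} (h : IJKSystem n w F) {M : ℕ}
    (hM : ∀ i j, w i j ≠ ⊤ → w i j ≤ ((M : ℤ) : WithTop ℤ)) {a b : Fin n} (hab : a < b)
    (hF : F a b ≠ ⊤) : F a b ≤ ((3 * M * n : ℤ) : WithTop ℤ) := by
  obtain ⟨c, hac, ⟨v, hv⟩, hinc⟩ := IJKSystem.lowHigh _ h a b rfl hab hF
  have hG : NoNegativeCycle (lowGraph n w a) := by
    intro i x hx
    rcases hx.innerWalk with ⟨-, h⟩ | ⟨-, l, rfl, -⟩ <;> omega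
  obtain ⟨v', -, hv', hp⟩ := HasPath.exists_short hG (B := 1)
    (fun i j u hu => by rw [(of_lowGraph_eq hu).2]; simp) hv
  rcases hp.innerWalk with ⟨rfl, -⟩ | ⟨-, l, rfl, hl⟩
  · exact absurd hac (lt_irrefl _)
  have hln : (l : ℤ) ≤ n := by simpa using hv'
  -- The relation `low` needs inner vertices strictly below `a`, so only the part after the last
  -- visit of `a` is kept.
  obtain ⟨l', hl', hw⟩ : ∃ l' ≤ l, InnerWalk n w a a c l' := by
    rcases hl.split with h | ⟨l₁, l₂, hl, -, h2⟩
    · exact ⟨l, le_rfl, h⟩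
    · exact ⟨l₂, by omega, h2⟩
  have hc : F a c ≤ ((2 * M * n : ℤ) : WithTop ℤ) := by
    refine (h.le_of_innerWalk hM a le_rfl hac.le hw).trans (WithTop.coe_le_coe.2 ?_)
    have : (l' : ℤ) ≤ n := by omega
    gcongr
  have key : ∀ y : Fin n, IncReach n w c y →
      a < y ∧ F a y ≤ ((2 * M * n + M * (y : ℕ) : ℤ) : WithTop ℤ) := by
    intro y hy
    induction hy with
    | refl => exact ⟨hac, hc.trans (WithTop.coe_le_coe.2 (by nlinarith))⟩
    | @tail x y _ hxy ih =>
      obtain ⟨h1, h2⟩ := ih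
      refine ⟨h1.trans hxy.1, (h.right h1 hxy.1).trans
        ((add_le_add h2 (hM _ _ hxy.2)).trans ?_)⟩
      rw [← WithTop.coe_add]
      refine WithTop.coe_le_coe.2 ?_
      have : ((x : ℕ) : ℤ) + 1 ≤ (y : ℕ) := by have := hxy.1; rw [Fin.lt_def] at this; omega
      nlinarith
  refine (key b hinc).2.trans (WithTop.coe_le_coe.2 ?_)
  have : ((b : ℕ) : ℤ) ≤ n := by omega
  nlinarith

theorem IJKSystem.le {n : ℕ} {w F : ℕ → ℕ → WithTop ℤ} (h : IJKSystem n w F) {M : ℕ}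
    (hM : ∀ i j, w i j ≠ ⊤ → w i j ≤ ((M : ℤ) : WithTop ℤ)) {i j : ℕ}
    (hF : F i j ≠ ⊤) : F i j ≤ ((3 * M * n : ℤ) : WithTop ℤ) := by
  obtain ⟨hi, hj⟩ := h.range _ _ hF
  rcases lt_trichotomy i j with hij | rfl | hij
  · exact h.le_of_lt hM (a := ⟨i, hi⟩) (b := ⟨j, hj⟩) hij hF
  · rw [h.diag _ hi]; exact WithTop.coe_le_coe.2 (by positivity)
  · exact h.transpose.le_of_lt (fun i j => hM j i) (a := ⟨j, hj⟩) (b := ⟨i, hi⟩) hij hF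

/-! ### Values of partial computations -/

/-- The minimum of the weight and of all sums through a vertex larger than both ends. -/
def peakValue (n : ℕ) (w : ℕ → ℕ → WithTop ℤ) (i j : ℕ) : WithTop ℤ :=
  min (w i j) ((Finset.range n).inf fun k => if i < k ∧ j < k then w i k + w k j else ⊤)

/-- The minimum of the peak value and of all sums `F i k + F k j` with `k < κ`. -/
def partialValue (n : ℕ) (w F : ℕ → ℕ → WithTop ℤ) (κ i j : ℕ) : WithTop ℤ :=
  min (peakValue n w i j) ((Finset.range κ).inf fun k => F i k + F k j)

theorem le_peakValue {n : ℕ} {w : ℕ → ℕ → WithTop ℤ} {i j : ℕ} {a : WithTop ℤ}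
    (h1 : a ≤ w i j) (h2 : ∀ k < n, i < k → j < k → a ≤ w i k + w k j) : a ≤ peakValue n w i j := by
  refine le_min h1 (Finset.le_inf fun k hk => ?_)
  split_ifs with h
  · exact h2 k (Finset.mem_range.1 hk) h.1 h.2
  · exact le_top

theorem peakValue_le_weight (n : ℕ) (w : ℕ → ℕ → WithTop ℤ) (i j : ℕ) :
    peakValue n w i j ≤ w i j := min_le_left _ _

theorem peakValue_le {n : ℕ} {w : ℕ → ℕ → WithTop ℤ} {i j k : ℕ} (hk : k < n) (h1 : i < k)
    (h2 : j < k) : peakValue n w i j ≤ w i k + w k j :=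
  (min_le_right _ _).trans ((Finset.inf_le (Finset.mem_range.2 hk)).trans (by simp [h1, h2]))

theorem le_partialValue {n : ℕ} {w F : ℕ → ℕ → WithTop ℤ} {κ i j : ℕ} {a : WithTop ℤ}
    (h1 : a ≤ peakValue n w i j) (h2 : ∀ k < κ, a ≤ F i k + F k j) :
    a ≤ partialValue n w F κ i j :=
  le_min h1 (Finset.le_inf fun k hk => h2 k (Finset.mem_range.1 hk))

theorem partialValue_le_peakValue (n : ℕ) (w F : ℕ → ℕ → WithTop ℤ) (κ i j : ℕ) :
    partialValue n w F κ i j ≤ peakValue n w i j := min_le_left _ _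

theorem partialValue_le {n : ℕ} {w F : ℕ → ℕ → WithTop ℤ} {κ i j k : ℕ} (hk : k < κ) :
    partialValue n w F κ i j ≤ F i k + F k j :=
  (min_le_right _ _).trans (Finset.inf_le (Finset.mem_range.2 hk))

theorem partialValue_zero (n : ℕ) (w F : ℕ → ℕ → WithTop ℤ) (i j : ℕ) :
    partialValue n w F 0 i j = peakValue n w i j := by simp [partialValue]

theorem partialValue_anti {n : ℕ} {w F : ℕ → ℕ → WithTop ℤ} {κ κ' : ℕ} (h : κ ≤ κ') (i j : ℕ) :
    partialValue n w F κ' i j ≤ partialValue n w F κ i j :=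
  le_partialValue (partialValue_le_peakValue _ _ _ _ _ _) fun _ hk => partialValue_le (hk.trans_le h)

namespace IJKSystem

variable {n : ℕ} {w F : ℕ → ℕ → WithTop ℤ}

theorem le_peak (h : IJKSystem n w F) (i j : ℕ) : F i j ≤ peakValue n w i j :=
  le_peakValue (h.edge i j) fun _ _ h1 h2 => h.peak h1 h2

/-- The restriction on `κ` matters: a sum `F i k + F k j` is a legitimate bound only for `k` below
both ends. -/
theorem le_partial (h : IJKSystem n w F) {κ i j : ℕ} (hi : κ ≤ i) (hj : κ ≤ j) :
    F i j ≤ partialValue n w F κ i j :=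
  le_partialValue (h.le_peak i j) fun k hk => h.low (by omega) (by omega)

/-- The base of the dyadic recursion: a block with a single entry needs no further step. -/
theorem partial_diag (h : IJKSystem n w F) {κ i : ℕ} (hi : i < n) (hκ : κ ≤ i) :
    partialValue n w F κ i i = F i i := by
  refine le_antisymm ?_ (h.le_partial hκ hκ)
  rw [h.diag i hi, ← h.weight_diag i hi]
  exact (partialValue_le_peakValue _ _ _ _ _ _).trans (peakValue_le_weight _ _ _ _)

/-- The upper bound by a split at `k < i` holds whatever the position of `j`. -/
theorem left' (h : IJKSystem n w F) {i j k : ℕ} (hk : k < i) : F i j ≤ w i k + F k j := by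
  rcases lt_trichotomy k j with h1 | rfl | h1
  · exact (h.low hk h1).trans (add_le_add_left (h.edge i k) _)
  · by_cases hkn : k < n
    · rw [h.diag k hkn, add_zero]; exact h.edge i k
    · have : w i k = ⊤ := by by_contra hc; exact hkn (h.weight_range _ _ hc).2
      simp [this]
  · exact h.left h1 hk

theorem _root_.FineGrained.abs_peakValue_le {B : ℤ} (hB : 0 ≤ B)
    (hw : ∀ i j (x : ℤ), w i j = x → |x| ≤ B) {i j : ℕ} {x : ℤ} (hx : peakValue n w i j = x) :
    |x| ≤ 2 * B := by
  rcases min_choice (w i j)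
    ((Finset.range n).inf fun k => if i < k ∧ j < k then w i k + w k j else ⊤) with e | e
  · have := hw i j x (by rw [← e]; exact hx)
    linarith
  · rw [peakValue, e] at hx
    rcases (Finset.range n).eq_empty_or_nonempty with h0 | h0
    · rw [h0] at hx; simp at hx
    · obtain ⟨k, -, hk⟩ := Finset.exists_mem_eq_inf _ h0
        (fun k => if i < k ∧ j < k then w i k + w k j else ⊤)
      rw [hk] at hx
      split_ifs at hx with hc
      · obtain ⟨a, b, ha, hb, rfl⟩ := WithTop.add_eq_coe.1 hx
        have h1 := hw _ _ _ ha.symm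
        have h2 := hw _ _ _ hb.symm
        have := abs_add_le a b
        linarith
      · exact absurd hx WithTop.top_ne_coe

theorem _root_.FineGrained.abs_partialValue_le {B : ℤ} (hB : 0 ≤ B)
    (hw : ∀ i j (x : ℤ), w i j = x → |x| ≤ B) (hF : ∀ i j (x : ℤ), F i j = x → |x| ≤ B)
    {κ i j : ℕ} {x : ℤ} (hx : partialValue n w F κ i j = x) : |x| ≤ 2 * B := by
  rcases min_choice (peakValue n w i j) ((Finset.range κ).inf fun k => F i k + F k j) with e | e
  · exact abs_peakValue_le hB hw (by rw [← e]; exact hx)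
  · rw [partialValue, e] at hx
    rcases (Finset.range κ).eq_empty_or_nonempty with h0 | h0
    · rw [h0] at hx; simp at hx
    · obtain ⟨k, -, hk⟩ := Finset.exists_mem_eq_inf _ h0 (fun k => F i k + F k j)
      rw [hk] at hx
      obtain ⟨a, b, ha, hb, rfl⟩ := WithTop.add_eq_coe.1 hx
      have h1 := hF _ _ _ ha.symm
      have h2 := hF _ _ _ hb.symm
      have := abs_add_le a b
      linarith

end IJKSystem

/-! ### The graph of a panel step -/

/-- Edges of the panel graph from row `x` of block `a` to row `y` of block `b`. -/
def panelEdge (w X : ℕ → ℕ → WithTop ℤ) (a x b y : ℕ) : WithTop ℤ :=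
  -- Blocks `0` and `1` spell entries below the solved square: weights down the rows (left splits),
  -- one entry of `X`, then solved entries upwards (low splits). Blocks `2` and `3` spell entries to
  -- its right: solved entries downwards (low splits), one entry of `X`, then weights upwards (right
  -- splits).
  if (((a = 0 ∧ b ≤ 1) ∨ (a = 2 ∧ b = 2)) ∧ y < x) ∨ (((a = 1 ∧ b = 1) ∨ (2 ≤ a ∧ b = 3)) ∧ x < y)
  then (if (a = 0 ∧ b = 0) ∨ (a = 3 ∧ b = 3) then w x y else X x y)
  else if a = 1 ∧ b = 2 ∧ x = y then 0 else ⊤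

theorem panelEdge_cases {w X : ℕ → ℕ → WithTop ℤ} {a x b y : ℕ} (ha : a ≤ 3)
    (h : panelEdge w X a x b y ≠ ⊤) :
    (a = 0 ∧ b = 0 ∧ y < x ∧ panelEdge w X a x b y = w x y) ∨
    (a = 0 ∧ b = 1 ∧ y < x ∧ panelEdge w X a x b y = X x y) ∨
    (a = 1 ∧ b = 1 ∧ x < y ∧ panelEdge w X a x b y = X x y) ∨
    (a = 1 ∧ b = 2 ∧ x = y ∧ panelEdge w X a x b y = 0) ∨
    (a = 2 ∧ b = 2 ∧ y < x ∧ panelEdge w X a x b y = X x y) ∨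
    (a = 2 ∧ b = 3 ∧ x < y ∧ panelEdge w X a x b y = X x y) ∨
    (a = 3 ∧ b = 3 ∧ x < y ∧ panelEdge w X a x b y = w x y) := by
  have hb : b ≤ 3 := by
    by_contra hb
    refine h ?_
    unfold panelEdge
    rw [if_neg (by omega), if_neg (by omega)]
  interval_cases a <;> interval_cases b <;> simp [panelEdge] at h ⊢ <;>
    first | exact ⟨h.1, fun hc => absurd h.1 (by omega)⟩ | tauto

/-- The block of a node of the panel graph: blocks `0` and `3` have `m` nodes, blocks `1` and `2`
have `s` nodes. -/
def panelBlock (s m p : ℕ) : ℕ :=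
  (if m ≤ p then 1 else 0) + (if m + s ≤ p then 1 else 0) + (if m + 2 * s ≤ p then 1 else 0)

/-- The row of the big matrix that belongs to a node. -/
def panelRow (lo s m p : ℕ) : ℕ :=
  if m + 2 * s ≤ p then lo + (p - (m + 2 * s)) else if m + s ≤ p then lo + (p - (m + s))
  else if m ≤ p then lo + (p - m) else lo + p

/-- The node of block `a` and row `lo + x`. -/
def panelNode (s m a x : ℕ) : ℕ :=
  (if a = 0 then 0 else if a = 1 then m else if a = 2 then m + s else m + 2 * s) + x

theorem panelBlock_le (s m p : ℕ) : panelBlock s m p ≤ 3 := by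
  unfold panelBlock; split_ifs <;> omega

theorem panelRow_ge (lo s m p : ℕ) : lo ≤ panelRow lo s m p := by
  unfold panelRow; split_ifs <;> omega

theorem panelRow_lt {lo s m p : ℕ} (hp : p < 2 * m + 2 * s) (hs : s ≤ m) :
    panelRow lo s m p < lo + m := by
  unfold panelRow; split_ifs <;> omega

theorem panelRow_lt' {lo s m p : ℕ} (h1 : panelBlock s m p = 1 ∨ panelBlock s m p = 2) :
    panelRow lo s m p < lo + s := by
  unfold panelRow; unfold panelBlock at h1; split_ifs at * <;> omega

theorem panelNode_lt {s m a x : ℕ} (hx : x < m) :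
    panelNode s m a x < 2 * m + 2 * s := by
  unfold panelNode; split_ifs <;> omega

theorem panelBlock_node {s m a x : ℕ} (ha : a ≤ 3) (hx : x < m) (hx' : a = 1 ∨ a = 2 → x < s) :
    panelBlock s m (panelNode s m a x) = a := by
  unfold panelNode panelBlock; split_ifs <;> omega

theorem panelRow_node {lo s m a x : ℕ} (hx : x < m) (hx' : a = 1 ∨ a = 2 → x < s) :
    panelRow lo s m (panelNode s m a x) = lo + x := by
  unfold panelNode panelRow; split_ifs <;> omega

/-- The query of a panel step. -/
def panelGraph (w X : ℕ → ℕ → WithTop ℤ) (lo s m : ℕ) : WMatrix (2 * m + 2 * s) := fun p q =>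
  panelEdge w X (panelBlock s m p) (panelRow lo s m p) (panelBlock s m q) (panelRow lo s m q)

/-- The weights may be negative, so the promise must come from the shape: rows fall within blocks
`0` and `2`, rise within blocks `1` and `3`, and the block never decreases. The factor `lo + m + 1`
lets the block dominate the row. -/
theorem panelGraph_noNegativeCycle (w X : ℕ → ℕ → WithTop ℤ) {lo s m : ℕ} (hs : s ≤ m) :
    NoNegativeCycle (panelGraph w X lo s m) := by
  refine noNegativeCycle_of_rank (fun p => panelBlock s m p * (lo + m + 1) +
    if panelBlock s m p = 0 ∨ panelBlock s m p = 2 then lo + m - panelRow lo s m p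
    else panelRow lo s m p) ?_
  intro p q h
  have h1 := panelRow_lt (lo := lo) p.2 hs
  have h2 := panelRow_lt (lo := lo) q.2 hs
  rcases panelEdge_cases (panelBlock_le _ _ _) h with ⟨e1, e2, e3, -⟩ | ⟨e1, e2, e3, -⟩ |
    ⟨e1, e2, e3, -⟩ | ⟨e1, e2, e3, -⟩ | ⟨e1, e2, e3, -⟩ | ⟨e1, e2, e3, -⟩ | ⟨e1, e2, e3, -⟩ <;>
  · simp only [e1, e2]
    norm_num
    omega

/-- `HasPath` grows at its start, whereas the invariants follow a path from its start to its current
end; hence the generalisation over the weight already spent. -/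
theorem HasPath.forward_induct {n : ℕ} {G : WMatrix n} (I : Fin n → ℤ → Prop)
    (hI : ∀ p q (x c : ℤ), I p x → G p q = (c : WithTop ℤ) → I q (x + c)) {i j : Fin n} {x : ℤ}
    (h : HasPath G i j x) (h0 : I i 0) : I j x := by
  have key : ∀ {i j : Fin n} {x : ℤ}, HasPath G i j x → ∀ x0, I i x0 → I j (x0 + x) := by
    intro i j x h
    induction h with
    | nil i => intro x0 h0; simpa using h0
    | @cons i j k c x hw _ ih =>
      intro x0 h0
      rw [← add_assoc]
      exact ih _ (hI _ _ _ _ h0 hw)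
  simpa using key h 0 h0

theorem APSP_solution_triangle {n : ℕ} {G D : WMatrix n} (hG : NoNegativeCycle G)
    (hD : APSP.IsSolution G D) (p r q : Fin n) : D p q ≤ D p r + D r q := by
  rcases h : D p r + D r q with _ | x
  · exact le_top
  · obtain ⟨a, b, ha, hb, rfl⟩ := WithTop.add_eq_coe.1 h
    exact APSP_solution_le hG hD
      (((hD _ _ _).1 ha.symm).1.trans ((hD _ _ _).1 hb.symm).1)

theorem APSP_solution_le_edge {n : ℕ} {G D : WMatrix n} (hG : NoNegativeCycle G)
    (hD : APSP.IsSolution G D) (p q : Fin n) : D p q ≤ G p q := by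
  rcases h : G p q with _ | x
  · exact le_top
  · exact APSP_solution_le hG hD (.single h)

/-! ### Correctness of a panel step -/

/-- The state of the block `[lo, lo + m)` before a panel step: the first `s` rows and columns are
solved, the other entries account for all splits below `lo`. -/
structure PanelReady (n : ℕ) (w F X : ℕ → ℕ → WithTop ℤ) (lo s m : ℕ) : Prop where
  solved : ∀ i j, lo ≤ i → i < lo + s → lo ≤ j → j < lo + s → X i j = F i j
  partly : ∀ i j, lo ≤ i → i < lo + m → lo ≤ j → j < lo + m → (lo + s ≤ i ∨ lo + s ≤ j) →
    X i j = partialValue n w F lo i j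

section

variable {n : ℕ} {w F X : ℕ → ℕ → WithTop ℤ} {lo s m : ℕ}

theorem PanelReady.ge (hX : PanelReady n w F X lo s m) (h : IJKSystem n w F) {i j : ℕ}
    (h1 : lo ≤ i) (h2 : i < lo + m) (h3 : lo ≤ j) (h4 : j < lo + m) : F i j ≤ X i j := by
  by_cases hc : lo + s ≤ i ∨ lo + s ≤ j
  · rw [hX.partly i j h1 h2 h3 h4 hc]; exact h.le_partial h1 h3
  · rw [hX.solved i j h1 (by omega) h3 (by omega)]

/-- The invariant along a path of the panel graph: `x` is the weight so far, `(a, r)` the current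
block and row. The walk starts in block `0` and row `i`, or in block `2` if `i` is `none`; the bound
`T` is for the ends of walks in block `3`. -/
def PanelInvariant (F : ℕ → ℕ → WithTop ℤ) (mid : ℕ) (i : Option ℕ) (T : ℕ → WithTop ℤ)
    (a r : ℕ) (x : ℤ) : Prop :=
  (a = 0 → ∃ i₀, i = some i₀ ∧ ∀ j, F i₀ j ≤ x + F r j) ∧
  (a = 1 → ∃ i₀, i = some i₀ ∧ F i₀ r ≤ x) ∧
  (a = 2 → ∀ j, mid ≤ j → T j ≤ x + F r j) ∧
  (a = 3 → ∃ (k : ℕ) (x₀ : ℤ), k < r ∧ k < mid ∧ (∀ j, mid ≤ j → T j ≤ x₀ + F k j) ∧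
    x₀ + F k r ≤ x)

/-- Soundness: no path undercuts the value that is wanted. Each edge uses one relation: `left'`
within block `0`, `low` within blocks `1` and `2`, `right` within block `3`. The zero edge turns a
bound for `F i₀ r` into one for `F i₀ r + F r j`, which `hi` compares with `T j`. -/
theorem PanelReady.invariant (hX : PanelReady n w F X lo s m) (h : IJKSystem n w F) (hs : s ≤ m)
    {i : Option ℕ} {T : ℕ → WithTop ℤ}
    (hi : ∀ i₀, i = some i₀ → lo + s ≤ i₀ ∧ ∀ k < lo + s, ∀ j, lo + s ≤ j → T j ≤ F i₀ k + F k j)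
    {p q : Fin (2 * m + 2 * s)} {x : ℤ} (hp : HasPath (panelGraph w X lo s m) p q x)
    (h0 : PanelInvariant F (lo + s) i T (panelBlock s m p) (panelRow lo s m p) 0) :
    PanelInvariant F (lo + s) i T (panelBlock s m q) (panelRow lo s m q) x := by
  refine hp.forward_induct (fun q x => PanelInvariant F (lo + s) i T (panelBlock s m q)
    (panelRow lo s m q) x) ?_ h0
  intro p q x c hI hc
  have hpl := panelRow_ge lo s m p
  have hql := panelRow_ge lo s m q
  have hpu := panelRow_lt (lo := lo) p.2 hs
  have hqu := panelRow_lt (lo := lo) q.2 hs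
  have hpu' := panelRow_lt' (lo := lo) (s := s) (m := m) (p := p)
  have hqu' := panelRow_lt' (lo := lo) (s := s) (m := m) (p := q)
  have hcne : panelEdge w X (panelBlock s m p) (panelRow lo s m p) (panelBlock s m q)
    (panelRow lo s m q) ≠ ⊤ := by
    unfold panelGraph at hc; rw [hc]; exact WithTop.coe_ne_top
  have hcases := panelEdge_cases (panelBlock_le s m p) hcne
  unfold panelGraph at hc
  rw [hc] at hcases
  generalize panelBlock s m p = a at *
  generalize panelBlock s m q = b at *
  generalize panelRow lo s m p = u at *
  generalize panelRow lo s m q = v at *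
  obtain ⟨I0, I1, I2, I3⟩ := hI
  have hadd : ((x + c : ℤ) : WithTop ℤ) = x + c := WithTop.coe_add x c
  rcases hcases with ⟨rfl, rfl, e, ec⟩ | ⟨rfl, rfl, e, ec⟩ | ⟨rfl, rfl, e, ec⟩ | ⟨rfl, rfl, e, ec⟩ |
    ⟨rfl, rfl, e, ec⟩ | ⟨rfl, rfl, e, ec⟩ | ⟨rfl, rfl, e, ec⟩
  · obtain ⟨i₀, e0, h1⟩ := I0 rfl
    refine ⟨fun _ => ⟨i₀, e0, fun j => ?_⟩, by omega, by omega, by omega⟩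
    rw [hadd, ec, add_assoc]
    exact (h1 j).trans (by gcongr; exact h.left' e)
  · obtain ⟨i₀, e0, h1⟩ := I0 rfl
    refine ⟨by omega, fun _ => ⟨i₀, e0, ?_⟩, by omega, by omega⟩
    rw [hadd, ec]
    exact (h1 v).trans (by gcongr; exact hX.ge h hpl hpu hql hqu)
  · obtain ⟨i₀, e0, h1⟩ := I1 rfl
    refine ⟨by omega, fun _ => ⟨i₀, e0, ?_⟩, by omega, by omega⟩
    have hmid := (hi i₀ e0).1
    have hv := hqu' (.inl rfl)
    rw [hadd, ec]
    exact (h.low (by omega) e).trans (by gcongr; exact hX.ge h hpl hpu hql hqu)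
  · obtain ⟨i₀, e0, h1⟩ := I1 rfl
    refine ⟨by omega, by omega, fun _ j hj => ?_, by omega⟩
    subst e
    rw [hadd, ec, add_zero]
    exact ((hi i₀ e0).2 u (hpu' (.inl rfl)) j hj).trans (by gcongr)
  · have h1 := I2 rfl
    refine ⟨by omega, by omega, fun _ j hj => ?_, by omega⟩
    have hu := hpu' (.inr rfl)
    rw [hadd, ec, add_assoc]
    exact (h1 j hj).trans (by
      gcongr
      exact (h.low e (by omega)).trans (by gcongr; exact hX.ge h hpl hpu hql hqu))
  · have h1 := I2 rfl
    refine ⟨by omega, by omega, by omega, fun _ => ⟨u, x, e, hpu' (.inr rfl), h1, ?_⟩⟩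
    rw [hadd, ec]
    gcongr
    exact hX.ge h hpl hpu hql hqu
  · obtain ⟨k, x₀, hk, hk', h1, h2⟩ := I3 rfl
    refine ⟨by omega, by omega, by omega, fun _ => ⟨k, x₀, by omega, hk', h1, ?_⟩⟩
    rw [hadd, ec]
    calc (x₀ : WithTop ℤ) + F k v ≤ x₀ + (F k u + w u v) := by gcongr; exact h.right hk e
      _ = x₀ + F k u + w u v := (add_assoc _ _ _).symm
      _ ≤ x + w u v := by gcongr

/-- The node from which the new value of an entry in row `lo + x` is read. -/
def panelSource (s m x : ℕ) : ℕ := if x < s then panelNode s m 2 x else panelNode s m 0 x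

/-- The node to which the new value of an entry in column `lo + x` is read. -/
def panelTarget (s m x : ℕ) : ℕ := if x < s then panelNode s m 1 x else panelNode s m 3 x

/-- A start in block `2` takes `F` itself as the bound `T`. From block `0`, block `3` is reached
only through a zero edge at a solved row, so there `T` is the partial value that counts these
splits. -/
theorem PanelReady.le_answer (hX : PanelReady n w F X lo s m) (h : IJKSystem n w F) (hs : s ≤ m)
    {D : WMatrix (2 * m + 2 * s)} (hD : APSP.IsSolution (panelGraph w X lo s m) D)
    {x y : ℕ} (hx : x < m) (hy : y < m) :
    (if s ≤ x ∧ s ≤ y then partialValue n w F (lo + s) (lo + x) (lo + y) else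
      F (lo + x) (lo + y)) ≤ entry D (panelSource s m x) (panelTarget s m y) := by
  by_cases hxs : x < s <;> by_cases hys : y < s
  all_goals
    simp only [panelSource, panelTarget, hxs, hys, if_true, if_false]
    rw [entry, dif_pos ⟨panelNode_lt hx, panelNode_lt hy⟩]
    refine APSP_solution_ge hD fun z hz => ?_
  -- Both indices are solved already. Block `1` cannot be reached from block `2`, so the answer is
  -- `∞` and the entry will be kept.
  · have := hX.invariant h hs (i := none) (T := F (lo + x)) (by simp) hz (by
      rw [panelBlock_node (by omega) hx (by omega), panelRow_node hx (by omega)]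
      exact ⟨by omega, by omega, fun _ j _ => by simp, by omega⟩)
    rw [panelBlock_node (by omega) hy (by omega), panelRow_node hy (by omega)] at this
    obtain ⟨i₀, h1, -⟩ := this.2.1 rfl
    cases h1
  · have := hX.invariant h hs (i := none) (T := F (lo + x)) (by simp) hz (by
      rw [panelBlock_node (by omega) hx (by omega), panelRow_node hx (by omega)]
      exact ⟨by omega, by omega, fun _ j _ => by simp, by omega⟩)
    rw [panelBlock_node (by omega) hy (by omega), panelRow_node hy (by omega)] at this
    obtain ⟨k, x₀, -, -, h1, h2⟩ := this.2.2.2 rfl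
    rw [if_neg (by omega)]
    exact (h1 _ (by omega)).trans h2
  · have := hX.invariant h hs (i := some (lo + x)) (T := partialValue n w F (lo + s) (lo + x))
      (by
        intro i₀ hi
        cases hi
        exact ⟨by omega, fun k hk j _ => partialValue_le hk⟩) hz (by
      rw [panelBlock_node (by omega) hx (by omega), panelRow_node hx (by omega)]
      exact ⟨fun _ => ⟨_, rfl, by simp⟩, by omega, by omega, by omega⟩)
    rw [panelBlock_node (by omega) hy (by omega), panelRow_node hy (by omega)] at this
    obtain ⟨i₀, h1, h2⟩ := this.2.1 rfl
    cases h1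
    rw [if_neg (by omega)]
    exact h2
  · have := hX.invariant h hs (i := some (lo + x)) (T := partialValue n w F (lo + s) (lo + x))
      (by
        intro i₀ hi
        cases hi
        exact ⟨by omega, fun k hk j _ => partialValue_le hk⟩) hz (by
      rw [panelBlock_node (by omega) hx (by omega), panelRow_node hx (by omega)]
      exact ⟨fun _ => ⟨_, rfl, by simp⟩, by omega, by omega, by omega⟩)
    rw [panelBlock_node (by omega) hy (by omega), panelRow_node hy (by omega)] at this
    obtain ⟨k, x₀, -, -, h1, h2⟩ := this.2.2.2 rfl
    rw [if_pos (by omega)]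
    exact (h1 _ (by omega)).trans h2

/-- The answer to the panel query between two nodes given by block and row. -/
def panelAnswer (lo s m : ℕ) (D : WMatrix (2 * m + 2 * s)) (a x b y : ℕ) : WithTop ℤ :=
  entry D (panelNode s m a (x - lo)) (panelNode s m b (y - lo))

/-- The row `x` belongs to the block `a`. -/
def PanelRowOf (lo s m a x : ℕ) : Prop :=
  a ≤ 3 ∧ lo ≤ x ∧ x < lo + m ∧ (a = 1 ∨ a = 2 → x < lo + s)

theorem panelAnswer_le_edge (hs : s ≤ m) {D : WMatrix (2 * m + 2 * s)}
    (hD : APSP.IsSolution (panelGraph w X lo s m) D) {a x b y : ℕ} (hx : PanelRowOf lo s m a x)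
    (hy : PanelRowOf lo s m b y) :
    panelAnswer lo s m D a x b y ≤ panelEdge w X a x b y := by
  obtain ⟨ha, h1, h2, h3⟩ := hx
  obtain ⟨hb, h4, h5, h6⟩ := hy
  have hx : panelNode s m a (x - lo) < 2 * m + 2 * s := panelNode_lt (by omega)
  have hy : panelNode s m b (y - lo) < 2 * m + 2 * s := panelNode_lt (by omega)
  have := APSP_solution_le_edge (panelGraph_noNegativeCycle w X hs) hD ⟨_, hx⟩ ⟨_, hy⟩
  rw [panelGraph, panelBlock_node ha (by omega) (by omega),
    panelBlock_node hb (by omega) (by omega), panelRow_node (by omega) (by omega),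
    panelRow_node (by omega) (by omega), Nat.add_sub_cancel' h1, Nat.add_sub_cancel' h4] at this
  rw [panelAnswer, entry, dif_pos ⟨hx, hy⟩]
  exact this

theorem panelAnswer_triangle (hs : s ≤ m) {D : WMatrix (2 * m + 2 * s)}
    (hD : APSP.IsSolution (panelGraph w X lo s m) D) {a x b y c z : ℕ} (hx : PanelRowOf lo s m a x)
    (hy : PanelRowOf lo s m b y) (hz : PanelRowOf lo s m c z) :
    panelAnswer lo s m D a x c z ≤
      panelAnswer lo s m D a x b y + panelAnswer lo s m D b y c z := by
  obtain ⟨ha, h1, h2, h3⟩ := hx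
  obtain ⟨hb, h4, h5, h6⟩ := hy
  obtain ⟨hc, h7, h8, h9⟩ := hz
  have hx : panelNode s m a (x - lo) < 2 * m + 2 * s := panelNode_lt (by omega)
  have hy : panelNode s m b (y - lo) < 2 * m + 2 * s := panelNode_lt (by omega)
  have hz : panelNode s m c (z - lo) < 2 * m + 2 * s := panelNode_lt (by omega)
  simp only [panelAnswer, entry, hx, hy, hz, and_self, dif_pos]
  exact APSP_solution_triangle (panelGraph_noNegativeCycle w X hs) hD _ _ _

/-- Completeness, by following the case that attains `F i j`. Edges, peaks and splits below `lo` are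
contained in `X`. Of any other split, one summand is an edge of the graph, and the other is either a
solved entry of `X` or found by induction on `i + j`. -/
theorem PanelReady.answer_le_left (hX : PanelReady n w F X lo s m) (h : IJKSystem n w F)
    (hs : s ≤ m) {D : WMatrix (2 * m + 2 * s)}
    (hD : APSP.IsSolution (panelGraph w X lo s m) D) :
    ∀ N i j, i + j = N → lo + s ≤ i → i < lo + m → lo ≤ j → j < lo + s →
      panelAnswer lo s m D 0 i 1 j ≤ F i j := by
  intro N
  induction N using Nat.strong_induction_on with
  | _ N ih =>
    rintro i j rfl hi hi' hj hj'
    have ri : PanelRowOf lo s m 0 i := ⟨by omega, by omega, hi', by omega⟩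
    have rj : PanelRowOf lo s m 1 j := ⟨by omega, hj, by omega, by omega⟩
    have hdirect : panelAnswer lo s m D 0 i 1 j ≤ partialValue n w F lo i j := by
      rw [← hX.partly i j (by omega) hi' hj (by omega) (.inl hi)]
      refine (panelAnswer_le_edge hs hD ri rj).trans (le_of_eq ?_)
      rw [panelEdge, if_pos (by omega), if_neg (by omega)]
    by_cases hF : F i j = ⊤
    · rw [hF]; exact le_top
    rcases h.cases i j hF with e | ⟨k, h1, h2, e⟩ | ⟨k, h1, h2, e⟩ | ⟨k, h1, h2, e⟩ | ⟨k, h1, h2, e⟩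
    · rw [e]
      exact hdirect.trans ((partialValue_le_peakValue _ _ _ _ _ _).trans
        (peakValue_le_weight _ _ _ _))
    · have hk : k < n := (h.weight_range i k fun hc => hF (by rw [e, hc, WithTop.top_add])).2
      rw [e]
      exact hdirect.trans ((partialValue_le_peakValue _ _ _ _ _ _).trans (peakValue_le hk h1 h2))
    · rw [e]
      by_cases hk : k < lo
      · exact hdirect.trans (partialValue_le hk)
      · have rk : PanelRowOf lo s m 1 k := ⟨by omega, by omega, by omega, by omega⟩
        refine (panelAnswer_triangle hs hD ri rk rj).trans
          (add_le_add (ih (i + k) (by omega) i k rfl hi hi' (by omega) (by omega)) ?_)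
        refine (panelAnswer_le_edge hs hD rk rj).trans (le_of_eq ?_)
        rw [panelEdge, if_pos (by omega), if_neg (by omega),
          hX.solved k j (by omega) (by omega) hj hj']
    · omega
    · rw [e]
      by_cases hk : k < lo + s
      · have rk : PanelRowOf lo s m 0 k := ⟨by omega, by omega, by omega, by omega⟩
        refine (panelAnswer_triangle hs hD ri rk rj).trans (add_le_add ?_ ?_)
        · refine (panelAnswer_le_edge hs hD ri rk).trans (le_of_eq ?_)
          rw [panelEdge, if_pos (by omega), if_pos (by omega)]
        · refine (panelAnswer_le_edge hs hD rk rj).trans (le_of_eq ?_)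
          rw [panelEdge, if_pos (by omega), if_neg (by omega),
            hX.solved k j (by omega) (by omega) hj hj']
      · have rk : PanelRowOf lo s m 0 k := ⟨by omega, by omega, by omega, by omega⟩
        refine (panelAnswer_triangle hs hD ri rk rj).trans
          (add_le_add ?_ (ih (k + j) (by omega) k j rfl (by omega) (by omega) hj hj'))
        refine (panelAnswer_le_edge hs hD ri rk).trans (le_of_eq ?_)
        rw [panelEdge, if_pos (by omega), if_pos (by omega)]

theorem PanelReady.answer_le_right (hX : PanelReady n w F X lo s m) (h : IJKSystem n w F)
    (hs : s ≤ m) {D : WMatrix (2 * m + 2 * s)}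
    (hD : APSP.IsSolution (panelGraph w X lo s m) D) :
    ∀ N i j, i + j = N → lo ≤ i → i < lo + s → lo + s ≤ j → j < lo + m →
      panelAnswer lo s m D 2 i 3 j ≤ F i j := by
  intro N
  induction N using Nat.strong_induction_on with
  | _ N ih =>
    rintro i j rfl hi hi' hj hj'
    have ri : PanelRowOf lo s m 2 i := ⟨by omega, by omega, by omega, by omega⟩
    have rj : PanelRowOf lo s m 3 j := ⟨by omega, by omega, by omega, by omega⟩
    have hdirect : panelAnswer lo s m D 2 i 3 j ≤ partialValue n w F lo i j := by
      rw [← hX.partly i j (by omega) (by omega) (by omega) (by omega) (.inr hj)]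
      refine (panelAnswer_le_edge hs hD ri rj).trans (le_of_eq ?_)
      rw [panelEdge, if_pos (by omega), if_neg (by omega)]
    by_cases hF : F i j = ⊤
    · rw [hF]; exact le_top
    rcases h.cases i j hF with e | ⟨k, h1, h2, e⟩ | ⟨k, h1, h2, e⟩ | ⟨k, h1, h2, e⟩ | ⟨k, h1, h2, e⟩
    · rw [e]
      exact hdirect.trans ((partialValue_le_peakValue _ _ _ _ _ _).trans
        (peakValue_le_weight _ _ _ _))
    · have hk : k < n := (h.weight_range i k fun hc => hF (by rw [e, hc, WithTop.top_add])).2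
      rw [e]
      exact hdirect.trans ((partialValue_le_peakValue _ _ _ _ _ _).trans (peakValue_le hk h1 h2))
    · rw [e]
      by_cases hk : k < lo
      · exact hdirect.trans (partialValue_le hk)
      · have rk : PanelRowOf lo s m 2 k := ⟨by omega, by omega, by omega, by omega⟩
        refine (panelAnswer_triangle hs hD ri rk rj).trans
          (add_le_add ?_ (ih (k + j) (by omega) k j rfl (by omega) (by omega) hj hj'))
        refine (panelAnswer_le_edge hs hD ri rk).trans (le_of_eq ?_)
        rw [panelEdge, if_pos (by omega), if_neg (by omega),
          hX.solved i k (by omega) (by omega) (by omega) (by omega)]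
    · rw [e]
      by_cases hk : k < lo + s
      · have rk : PanelRowOf lo s m 3 k := ⟨by omega, by omega, by omega, by omega⟩
        refine (panelAnswer_triangle hs hD ri rk rj).trans (add_le_add ?_ ?_)
        · refine (panelAnswer_le_edge hs hD ri rk).trans (le_of_eq ?_)
          rw [panelEdge, if_pos (by omega), if_neg (by omega),
            hX.solved i k (by omega) (by omega) (by omega) (by omega)]
        · refine (panelAnswer_le_edge hs hD rk rj).trans (le_of_eq ?_)
          rw [panelEdge, if_pos (by omega), if_pos (by omega)]
      · have rk : PanelRowOf lo s m 3 k := ⟨by omega, by omega, by omega, by omega⟩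
        refine (panelAnswer_triangle hs hD ri rk rj).trans
          (add_le_add (ih (i + k) (by omega) i k rfl hi hi' (by omega) (by omega)) ?_)
        refine (panelAnswer_le_edge hs hD rk rj).trans (le_of_eq ?_)
        rw [panelEdge, if_pos (by omega), if_pos (by omega)]
    · omega

/-- The path goes from `i` to `k` in blocks `0` and `1`, crosses the zero edge at `k`, and goes on
to `j` in blocks `2` and `3`. -/
theorem PanelReady.answer_le_last (hX : PanelReady n w F X lo s m) (h : IJKSystem n w F)
    (hs : s ≤ m) {D : WMatrix (2 * m + 2 * s)}
    (hD : APSP.IsSolution (panelGraph w X lo s m) D) {i j k : ℕ} (hi : lo + s ≤ i)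
    (hi' : i < lo + m) (hj : lo + s ≤ j) (hj' : j < lo + m) (hk : lo ≤ k) (hk' : k < lo + s) :
    panelAnswer lo s m D 0 i 3 j ≤ F i k + F k j := by
  have ri : PanelRowOf lo s m 0 i := ⟨by omega, by omega, by omega, by omega⟩
  have rj : PanelRowOf lo s m 3 j := ⟨by omega, by omega, by omega, by omega⟩
  have r1 : PanelRowOf lo s m 1 k := ⟨by omega, by omega, by omega, by omega⟩
  have r2 : PanelRowOf lo s m 2 k := ⟨by omega, by omega, by omega, by omega⟩
  refine (panelAnswer_triangle hs hD ri r1 rj).trans (add_le_add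
    (hX.answer_le_left h hs hD _ i k rfl hi hi' hk hk') ?_)
  refine (panelAnswer_triangle hs hD r1 r2 rj).trans ?_
  have h0 : panelAnswer lo s m D 1 k 2 k ≤ 0 := by
    refine (panelAnswer_le_edge hs hD r1 r2).trans (le_of_eq ?_)
    rw [panelEdge, if_neg (by omega), if_pos (by omega)]
  calc _ ≤ 0 + F k j := add_le_add h0 (hX.answer_le_right h hs hD _ k j rfl hk hk' hj hj')
    _ = _ := zero_add _

/-- A panel step solves the first `s` rows and columns of the block, and adds the splits in
`[lo, lo + s)` to the rest. -/
theorem PanelReady.update (hX : PanelReady n w F X lo s m) (h : IJKSystem n w F) (hs : s ≤ m)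
    {D : WMatrix (2 * m + 2 * s)}
    (hD : APSP.IsSolution (panelGraph w X lo s m) D) {x y : ℕ} (hx : x < m) (hy : y < m) :
    min (X (lo + x) (lo + y)) (entry D (panelSource s m x) (panelTarget s m y)) =
      if s ≤ x ∧ s ≤ y then partialValue n w F (lo + s) (lo + x) (lo + y) else
      F (lo + x) (lo + y) := by
  apply le_antisymm
  · by_cases hxs : x < s <;> by_cases hys : y < s
    · rw [if_neg (by omega), hX.solved _ _ (by omega) (by omega) (by omega) (by omega)]
      exact min_le_left _ _
    · rw [if_neg (by omega)]
      refine (min_le_right _ _).trans ?_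
      have := hX.answer_le_right h hs hD _ (lo + x) (lo + y) rfl (by omega) (by omega) (by omega)
        (by omega)
      simpa [panelAnswer, panelSource, panelTarget, hxs, hys] using this
    · rw [if_neg (by omega)]
      refine (min_le_right _ _).trans ?_
      have := hX.answer_le_left h hs hD _ (lo + x) (lo + y) rfl (by omega) (by omega) (by omega)
        (by omega)
      simpa [panelAnswer, panelSource, panelTarget, hxs, hys] using this
    · rw [if_pos (by omega)]
      have hpart := hX.partly (lo + x) (lo + y) (by omega) (by omega) (by omega) (by omega)
        (.inl (by omega))
      refine le_partialValue ?_ fun k hk => ?_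
      · refine (min_le_left _ _).trans ?_
        rw [hpart]; exact partialValue_le_peakValue _ _ _ _ _ _
      -- Splits below `lo` are present in `X`; those through the solved rows are supplied by the
      -- answer.
      · by_cases hk' : k < lo
        · refine (min_le_left _ _).trans ?_
          rw [hpart]; exact partialValue_le hk'
        · refine (min_le_right _ _).trans ?_
          have := hX.answer_le_last h hs hD (i := lo + x) (j := lo + y) (by omega) (by omega)
            (by omega) (by omega) (not_lt.1 hk') hk
          simpa [panelAnswer, panelSource, panelTarget, hxs, hys] using this
  · refine le_min ?_ (hX.le_answer h hs hD hx hy)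
    split_ifs with hc
    · rw [hX.partly _ _ (by omega) (by omega) (by omega) (by omega) (.inl (by omega))]
      exact partialValue_anti (by omega) _ _
    · exact hX.ge h (by omega) (by omega) (by omega) (by omega)

end

/-! ### The first query -/

/-- The block of a node in the graph of the first query. -/
def peakBlock (n p : ℕ) : ℕ := (if n ≤ p then 1 else 0) + (if 2 * n ≤ p then 1 else 0)

/-- The row of a node in the graph of the first query. -/
def peakRow (n p : ℕ) : ℕ := if 2 * n ≤ p then p - 2 * n else if n ≤ p then p - n else p

/-- Edges from row `x` of block `a` to row `y` of block `b` in the first query. -/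
def peakEdge (w : ℕ → ℕ → WithTop ℤ) (a x b y : ℕ) : WithTop ℤ :=
  if (a = 0 ∧ b = 1 ∧ x < y) ∨ (a = 1 ∧ b = 2 ∧ y < x) then w x y else ⊤

/-- The graph of the first query. -/
def peakGraph (n : ℕ) (w : ℕ → ℕ → WithTop ℤ) : WMatrix (3 * n) := fun p q =>
  peakEdge w (peakBlock n p) (peakRow n p) (peakBlock n q) (peakRow n q)

theorem peakEdge_cases {w : ℕ → ℕ → WithTop ℤ} {a x b y : ℕ} (h : peakEdge w a x b y ≠ ⊤) :
    ((a = 0 ∧ b = 1 ∧ x < y) ∨ (a = 1 ∧ b = 2 ∧ y < x)) ∧ peakEdge w a x b y = w x y := by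
  unfold peakEdge at *
  split_ifs at h ⊢ with h1
  · exact ⟨h1, rfl⟩
  · exact absurd rfl h

theorem peakGraph_noNegativeCycle (n : ℕ) (w : ℕ → ℕ → WithTop ℤ) :
    NoNegativeCycle (peakGraph n w) := by
  refine noNegativeCycle_of_rank (fun p => peakBlock n p) fun p q h => ?_
  rcases (peakEdge_cases h).1 with h | h <;> omega

theorem peakRow_lt {n p : ℕ} (hp : p < 3 * n) : peakRow n p < n := by
  unfold peakRow; split_ifs <;> omega

/-- With three copies of the vertices, a path from the first to the last copy has exactly two edges,
up to a peak and down again. The distance is thus a (min, +) product restricted to peaks. -/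
theorem peak_answer_eq {n : ℕ} {w : ℕ → ℕ → WithTop ℤ} {D : WMatrix (3 * n)}
    (hD : APSP.IsSolution (peakGraph n w) D) {i j : ℕ} (hi : i < n) (hj : j < n) :
    min (w i j) (entry D i (2 * n + j)) = peakValue n w i j := by
  have hG := peakGraph_noNegativeCycle n w
  have hi3 : i < 3 * n := by omega
  have hj3 : 2 * n + j < 3 * n := by omega
  rw [entry, dif_pos ⟨hi3, hj3⟩]
  have b0 : ∀ i, i < n → peakBlock n i = 0 ∧ peakRow n i = i := by
    intro i hi; unfold peakBlock peakRow; constructor <;> split_ifs <;> omega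
  have b1 : ∀ i, i < n → peakBlock n (n + i) = 1 ∧ peakRow n (n + i) = i := by
    intro i hi; unfold peakBlock peakRow; constructor <;> split_ifs <;> omega
  have b2 : ∀ i, i < n → peakBlock n (2 * n + i) = 2 ∧ peakRow n (2 * n + i) = i := by
    intro i hi; unfold peakBlock peakRow; constructor <;> split_ifs <;> omega
  apply le_antisymm
  · refine le_peakValue (min_le_left _ _) fun k hk h1 h2 => (min_le_right _ _).trans ?_
    have hk3 : n + k < 3 * n := by omega
    refine (APSP_solution_triangle hG hD ⟨i, hi3⟩ ⟨n + k, hk3⟩ ⟨2 * n + j, hj3⟩).trans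
      (add_le_add ((APSP_solution_le_edge hG hD _ _).trans (le_of_eq ?_))
        ((APSP_solution_le_edge hG hD _ _).trans (le_of_eq ?_)))
    · rw [peakGraph, peakEdge, (b0 i hi).1, (b0 i hi).2, (b1 k hk).1, (b1 k hk).2, if_pos (by omega)]
    · rw [peakGraph, peakEdge, (b2 j hj).1, (b2 j hj).2, (b1 k hk).1, (b1 k hk).2, if_pos (by omega)]
  · refine le_min (peakValue_le_weight _ _ _ _) (APSP_solution_ge hD fun x hx => ?_)
    have := hx.forward_induct (fun q x =>
      (peakBlock n q = 0 → peakRow n q = i ∧ x = 0) ∧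
      (peakBlock n q = 1 → i < peakRow n q ∧ w i (peakRow n q) ≤ x) ∧
      (peakBlock n q = 2 → peakValue n w i (peakRow n q) ≤ x)) (by
        intro p q x c hI hc
        have hp := peakRow_lt p.2
        have hne : peakEdge w (peakBlock n p) (peakRow n p) (peakBlock n q) (peakRow n q) ≠ ⊤ := by
          unfold peakGraph at hc; rw [hc]; exact WithTop.coe_ne_top
        obtain ⟨h1, h2⟩ := peakEdge_cases hne
        unfold peakGraph at hc
        rw [hc] at h2
        rw [WithTop.coe_add, h2]
        rcases h1 with ⟨e1, e2, e3⟩ | ⟨e1, e2, e3⟩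
        · obtain ⟨e4, rfl⟩ := hI.1 e1
          refine ⟨by omega, fun _ => ⟨by omega, ?_⟩, by omega⟩
          rw [e4]; simp
        · obtain ⟨e4, e5⟩ := hI.2.1 e1
          refine ⟨by omega, by omega, fun _ => (peakValue_le hp e4 e3).trans ?_⟩
          gcongr) (by simp [(b0 i hi).1, (b0 i hi).2])
    have h2 := this.2.2 (b2 j hj).1
    rwa [(b2 j hj).2] at h2

/-! ### The dyadic schedule -/

/-- The largest power of two that divides a positive number. -/
def lowBit (t : ℕ) : ℕ := if h : t ≠ 0 ∧ t % 2 = 0 then 2 * lowBit (t / 2) else 1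
termination_by t
decreasing_by omega

theorem lowBit_odd {t : ℕ} (h : t % 2 = 1) : lowBit t = 1 := by
  rw [lowBit, dif_neg (by omega)]

theorem lowBit_two_mul {t : ℕ} (h : t ≠ 0) : lowBit (2 * t) = 2 * lowBit t := by
  rw [lowBit, dif_pos (by omega), Nat.mul_div_cancel_left t two_pos]

theorem lowBit_pos (t : ℕ) : 0 < lowBit t := by
  induction t using Nat.strong_induction_on with
  | _ t ih =>
    rw [lowBit]
    split_ifs with h
    · have := ih (t / 2) (by omega); omega
    · omega

theorem lowBit_le {t : ℕ} (ht : t ≠ 0) : lowBit t ≤ t := by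
  induction t using Nat.strong_induction_on with
  | _ t ih =>
    rw [lowBit]
    split_ifs with h
    · have := ih (t / 2) (by omega) (by omega); omega
    · omega

/-- The step at the midpoint of an aligned block has exactly the half width of that block. -/
theorem lowBit_add_pow (l : ℕ) : ∀ lo, 2 ^ (l + 1) ∣ lo → lowBit (lo + 2 ^ l) = 2 ^ l := by
  induction l with
  | zero => rintro lo ⟨k, rfl⟩; exact lowBit_odd (by omega)
  | succ l ih =>
    rintro lo ⟨k, rfl⟩
    have h2 : 0 < 2 ^ l := by positivity
    have : 2 ^ (l + 1 + 1) * k + 2 ^ (l + 1) = 2 * (2 ^ (l + 1) * k + 2 ^ l) := by ring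
    rw [this, lowBit_two_mul (by omega), ih _ ⟨k, rfl⟩, pow_succ]; ring

/-- The value `2 ^ l` occurs about `T / 2 ^ (l + 1)` times, so the squares form a geometric series
dominated by its largest terms. The extra summand `T` in `key` makes the induction through `heven`
close. -/
theorem sum_lowBit_sq (T : ℕ) :
    ∑ t ∈ Finset.Icc 1 T, lowBit t ^ 2 ≤ 2 * T ^ 2 := by
  have hsucc : ∀ T, ∑ t ∈ Finset.Icc 1 (T + 1), lowBit t ^ 2 =
      ∑ t ∈ Finset.Icc 1 T, lowBit t ^ 2 + lowBit (T + 1) ^ 2 := fun T =>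
    Finset.sum_Icc_succ_top (by omega) _
  have heven : ∀ T, ∑ t ∈ Finset.Icc 1 (2 * T), lowBit t ^ 2 =
      T + 4 * ∑ t ∈ Finset.Icc 1 T, lowBit t ^ 2 := by
    intro T
    induction T with
    | zero => simp
    | succ T ih =>
      rw [show 2 * (T + 1) = 2 * T + 1 + 1 by ring, hsucc, hsucc, ih, hsucc,
        lowBit_odd (by omega), show 2 * T + 1 + 1 = 2 * (T + 1) by ring,
        lowBit_two_mul (by omega)]
      ring
  have key : ∀ T, ∑ t ∈ Finset.Icc 1 T, lowBit t ^ 2 + T ≤ 2 * T ^ 2 := by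
    intro T
    induction T using Nat.strong_induction_on with
    | _ T ih =>
      rcases Nat.even_or_odd' T with ⟨S, rfl | rfl⟩
      · rcases Nat.eq_zero_or_pos S with rfl | hS
        · simp
        · have := ih S (by omega)
          rw [heven]; nlinarith
      · rw [hsucc, heven, lowBit_odd (by omega)]
        rcases Nat.eq_zero_or_pos S with rfl | hS
        · simp
        · have := ih S (by omega)
          nlinarith
  exact (Nat.le_add_right _ _).trans (key T)

/-- The state of the block treated at time `t`, in terms of the whole matrix. -/
def StepReady (n : ℕ) (w F X : ℕ → ℕ → WithTop ℤ) (t : ℕ) : Prop :=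
  ∀ i j, i < n → j < n → t - lowBit t ≤ i → i < t + lowBit t → t - lowBit t ≤ j →
    j < t + lowBit t →
    X i j = if i < t ∧ j < t then F i j else partialValue n w F (t - lowBit t) i j

/-- What the step at time `t` does to the whole matrix. -/
structure IsStep (n : ℕ) (w F X Y : ℕ → ℕ → WithTop ℤ) (t : ℕ) : Prop where
  off : ∀ i j, i < n → j < n → ¬(t - lowBit t ≤ i ∧ i < t + lowBit t ∧ t - lowBit t ≤ j ∧
    j < t + lowBit t) → Y i j = X i j
  on : StepReady n w F X t → ∀ i j, i < n → j < n → t - lowBit t ≤ i → i < t + lowBit t →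
    t - lowBit t ≤ j → j < t + lowBit t →
    Y i j = if t ≤ i ∧ t ≤ j then partialValue n w F t i j else F i j

theorem IsStep.of_le {n : ℕ} {w F X : ℕ → ℕ → WithTop ℤ} {t : ℕ} (ht : n ≤ t) :
    IsStep n w F X X t where
  off _ _ _ _ _ := rfl
  on h i j hi hj h1 h2 h3 h4 := by
    rw [h i j hi hj h1 h2 h3 h4, if_pos (by omega), if_neg (by omega)]

/-- The dyadic recursion, unrolled: the steps at the times in `(lo, lo + 2 ^ l)` solve the block
`[lo, lo + 2 ^ l)`. -/
theorem dyadic_steps {n : ℕ} {w F : ℕ → ℕ → WithTop ℤ} (h : IJKSystem n w F)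
    {X : ℕ → ℕ → ℕ → WithTop ℤ} (hX : ∀ t, 1 ≤ t → IsStep n w F (X t) (X (t + 1)) t) (l : ℕ) :
    ∀ lo, 2 ^ l ∣ lo →
    (∀ i j, i < n → j < n → lo ≤ i → i < lo + 2 ^ l → lo ≤ j → j < lo + 2 ^ l →
      X (lo + 1) i j = partialValue n w F lo i j) →
    (∀ i j, i < n → j < n → lo ≤ i → i < lo + 2 ^ l → lo ≤ j → j < lo + 2 ^ l →
      X (lo + 2 ^ l) i j = F i j) ∧
    (∀ i j, i < n → j < n → ¬(lo ≤ i ∧ i < lo + 2 ^ l ∧ lo ≤ j ∧ j < lo + 2 ^ l) →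
      X (lo + 2 ^ l) i j = X (lo + 1) i j) ∧
    (∀ t, lo + 1 ≤ t → t ≤ lo + 2 ^ l → ∀ i j, i < n → j < n →
      X t i j = X (lo + 1) i j ∨ X t i j = F i j ∨ ∃ κ, X t i j = partialValue n w F κ i j) := by
  induction l with
  | zero =>
    intro lo _ hpre
    refine ⟨fun i j hi hj h1 h2 h3 h4 => ?_, fun i j _ _ _ => rfl, fun t h1 h2 i j _ _ => ?_⟩
    · have e1 : i = lo := by omega
      have e2 : j = lo := by omega
      subst e1; subst e2
      simp only [pow_zero] at hpre ⊢
      rw [hpre _ _ hi hj h1 h2 h3 h4, h.partial_diag hi le_rfl]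
    · rw [pow_zero] at h2
      left; rw [show t = lo + 1 by omega]
  | succ l ih =>
    intro lo hlo hpre
    have hpos : 0 < 2 ^ l := by positivity
    have hpow : 2 ^ (l + 1) = 2 ^ l + 2 ^ l := by ring
    have hb := lowBit_add_pow l lo hlo
    have hdvd : 2 ^ l ∣ lo := (pow_dvd_pow 2 (Nat.le_succ l)).trans hlo
    obtain ⟨a1, a2, a3⟩ := ih lo hdvd (fun i j hi hj h1 h2 h3 h4 =>
      hpre i j hi hj h1 (by omega) h3 (by omega))
    have hstep := hX (lo + 2 ^ l) (by omega)
    have hoff := hstep.off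
    have hon := hstep.on
    unfold StepReady at hon
    rw [hb, Nat.add_sub_cancel] at hoff hon
    -- The first half has solved its own square and left the other three quadrants alone, which is
    -- the readiness required at the midpoint. After that step the second square holds the partial
    -- values that its own recursion starts from.
    have hon' := hon (fun i j hi hj h1 h2 h3 h4 => by
      split_ifs with hc
      · exact a1 i j hi hj h1 hc.1 h3 hc.2
      · rw [a2 i j hi hj (by omega), hpre i j hi hj h1 (by omega) h3 (by omega)])
    obtain ⟨b1, b2, b3⟩ := ih (lo + 2 ^ l) (hdvd.add dvd_rfl) (fun i j hi hj h1 h2 h3 h4 => by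
      rw [hon' i j hi hj (by omega) (by omega) (by omega) (by omega), if_pos ⟨h1, h3⟩])
    have hend : lo + 2 ^ (l + 1) = lo + 2 ^ l + 2 ^ l := by omega
    have hmid : ∀ i j, i < n → j < n → X (lo + 2 ^ l + 1) i j = X (lo + 1) i j ∨
        X (lo + 2 ^ l + 1) i j = F i j ∨
        ∃ κ, X (lo + 2 ^ l + 1) i j = partialValue n w F κ i j := by
      intro i j hi hj
      by_cases hc : lo ≤ i ∧ i < lo + 2 ^ l + 2 ^ l ∧ lo ≤ j ∧ j < lo + 2 ^ l + 2 ^ l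
      · rw [hon' i j hi hj hc.1 hc.2.1 hc.2.2.1 hc.2.2.2]
        split_ifs
        · exact .inr (.inr ⟨_, rfl⟩)
        · exact .inr (.inl rfl)
      · rw [hoff i j hi hj hc]
        exact a3 (lo + 2 ^ l) (by omega) le_rfl i j hi hj
    rw [hend]
    refine ⟨fun i j hi hj h1 h2 h3 h4 => ?_, fun i j hi hj hc => ?_, fun t h1 h2 i j hi hj => ?_⟩
    · by_cases hc : lo + 2 ^ l ≤ i ∧ lo + 2 ^ l ≤ j
      · exact b1 i j hi hj hc.1 (by omega) hc.2 (by omega)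
      · rw [b2 i j hi hj (by omega), hon' i j hi hj h1 (by omega) h3 (by omega), if_neg hc]
    · rw [b2 i j hi hj (by omega), hoff i j hi hj (by omega), a2 i j hi hj (by omega)]
    · by_cases ht : t ≤ lo + 2 ^ l
      · exact a3 t h1 ht i j hi hj
      · rcases b3 t (by omega) (by omega) i j hi hj with e | e | e
        · rw [e]; exact hmid i j hi hj
        · exact .inr (.inl e)
        · exact .inr (.inr e)

/-! ### The whole schedule -/

/-- The width of the block treated at time `t`. -/
def stepWidth (n t : ℕ) : ℕ := lowBit t + min (lowBit t) (n - t)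

theorem isStep_of_update {n : ℕ} {w F X Y : ℕ → ℕ → WithTop ℤ} (h : IJKSystem n w F) {t : ℕ}
    (ht : 1 ≤ t) (htn : t < n)
    {D : WMatrix (2 * stepWidth n t + 2 * lowBit t)}
    (hD : APSP.IsSolution (panelGraph w X (t - lowBit t) (lowBit t) (stepWidth n t)) D)
    (hoff : ∀ i j, i < n → j < n → ¬(t - lowBit t ≤ i ∧ i < t - lowBit t + stepWidth n t ∧
      t - lowBit t ≤ j ∧ j < t - lowBit t + stepWidth n t) → Y i j = X i j)
    (hon : ∀ x y, x < stepWidth n t → y < stepWidth n t →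
      Y (t - lowBit t + x) (t - lowBit t + y) =
        min (X (t - lowBit t + x) (t - lowBit t + y))
          (entry D (panelSource (lowBit t) (stepWidth n t) x)
            (panelTarget (lowBit t) (stepWidth n t) y))) :
    IsStep n w F X Y t := by
  have hle : lowBit t ≤ t := lowBit_le (by omega)
  -- The block of the schedule is cut off at `n`, so the query concerns existing rows only.
  have hm : t - lowBit t + stepWidth n t = min (t + lowBit t) n := by unfold stepWidth; omega
  have hs : lowBit t ≤ stepWidth n t := by unfold stepWidth; omega
  refine ⟨fun i j hi hj hc => hoff i j hi hj (by omega), fun hr i j hi hj h1 h2 h3 h4 => ?_⟩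
  have hready : PanelReady n w F X (t - lowBit t) (lowBit t) (stepWidth n t) := by
    constructor
    · intro i j h1 h2 h3 h4
      rw [hr i j (by omega) (by omega) h1 (by omega) h3 (by omega), if_pos (by omega)]
    · intro i j h1 h2 h3 h4 h5
      rw [hr i j (by omega) (by omega) h1 (by omega) h3 (by omega), if_neg (by omega)]
  obtain ⟨x, rfl⟩ := Nat.exists_eq_add_of_le h1
  obtain ⟨y, rfl⟩ := Nat.exists_eq_add_of_le h3
  rw [hon x y (by omega) (by omega), hready.update h hs hD (by omega) (by omega),
    Nat.sub_add_cancel hle]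
  by_cases hc : lowBit t ≤ x ∧ lowBit t ≤ y
  · rw [if_pos hc, if_pos (by omega)]
  · rw [if_neg hc, if_neg (by omega)]

/-- The matrices held by the algorithm up to time `t`. -/
structure IsRun (n : ℕ) (w F : ℕ → ℕ → WithTop ℤ) (t : ℕ) (X : ℕ → ℕ → ℕ → WithTop ℤ) : Prop where
  start : ∀ i j, i < n → j < n → X 1 i j = peakValue n w i j
  step : ∀ u, 1 ≤ u → u < t → IsStep n w F (X u) (X (u + 1)) u

/-- The dyadic recursion needs steps at all times, while a run knows only those made so far and the
program stops at `n`. The missing steps are supplied here; from time `n` on they change nothing. -/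
theorem exists_isStep (n : ℕ) (w F X : ℕ → ℕ → WithTop ℤ) (t : ℕ) :
    ∃ Y, IsStep n w F X Y t ∧ (n ≤ t → Y = X) := by
  by_cases ht : n ≤ t
  · exact ⟨X, .of_le ht, fun _ => rfl⟩
  · refine ⟨fun i j => if t - lowBit t ≤ i ∧ i < t + lowBit t ∧ t - lowBit t ≤ j ∧ j < t + lowBit t
      then (if t ≤ i ∧ t ≤ j then partialValue n w F t i j else F i j) else X i j,
      ⟨fun i j _ _ hc => if_neg hc, fun _ i j _ _ h1 h2 h3 h4 => if_pos ⟨h1, h2, h3, h4⟩⟩,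
      fun h => absurd h ht⟩

/-- A run can be continued for ever. -/
theorem IsRun.extend {n : ℕ} {w F : ℕ → ℕ → WithTop ℤ} {t : ℕ}
    {X : ℕ → ℕ → ℕ → WithTop ℤ} (hX : IsRun n w F t X) :
    ∃ Y : ℕ → ℕ → ℕ → WithTop ℤ, (∀ u ≤ t, Y u = X u) ∧
      (∀ u, 1 ≤ u → IsStep n w F (Y u) (Y (u + 1)) u) ∧ (n ≤ t → ∀ u, t ≤ u → Y u = X t) := by
  choose next h1 h2 using exists_isStep n w F
  let Z : ℕ → ℕ → ℕ → WithTop ℤ := fun k => Nat.rec (X t) (fun k Z => next Z (t + k)) k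
  have hZ0 : Z 0 = X t := rfl
  have hZs : ∀ k, Z (k + 1) = next (Z k) (t + k) := fun _ => rfl
  have hY : ∀ u, t ≤ u → (if u ≤ t then X u else Z (u - t)) = Z (u - t) := by
    intro u hu
    split_ifs with hc
    · rw [le_antisymm hc hu, Nat.sub_self, hZ0]
    · rfl
  refine ⟨fun u => if u ≤ t then X u else Z (u - t), fun u hu => if_pos hu, fun u hu => ?_,
    fun hn u hu => ?_⟩
  · by_cases hut : u < t
    · simp only [hut.le, Nat.succ_le_of_lt hut, if_true]
      exact hX.step u hu hut
    · simp only [hY u (by omega), hY (u + 1) (by omega)]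
      rw [Nat.sub_add_comm (by omega), hZs, Nat.add_sub_cancel' (by omega)]
      exact h1 _ _
  · simp only [hY u hu]
    have : ∀ k, Z k = X t := by
      intro k
      induction k with
      | zero => rfl
      | succ k ih => rw [hZs, h2 _ _ (by omega), ih]
    exact this _

/-- A power of two above `n + t` gives one block, starting at `0`, that contains the whole matrix
and the time `t`. The second claim serves to bound the words during the run. -/
theorem IsRun.all_steps {n : ℕ} {w F : ℕ → ℕ → WithTop ℤ} (h : IJKSystem n w F) {t : ℕ}
    (ht : 1 ≤ t) {X : ℕ → ℕ → ℕ → WithTop ℤ} (hX : IsRun n w F t X) {i j : ℕ} (hi : i < n)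
    (hj : j < n) :
    (n ≤ t → X t i j = F i j) ∧
    (X t i j = F i j ∨ ∃ κ, X t i j = partialValue n w F κ i j) := by
  obtain ⟨Y, hY0, hY1, hYt⟩ := hX.extend
  have hpow : n + t < 2 ^ (n + t) := Nat.lt_two_pow_self
  obtain ⟨a1, -, a3⟩ := dyadic_steps h hY1 (n + t) 0 (dvd_zero _)
    (fun i j hi hj _ _ _ _ => by
      rw [partialValue_zero, zero_add, hY0 1 ht, hX.start i j hi hj])
  constructor
  · intro hn
    have := a1 i j hi hj (by omega) (by omega) (by omega) (by omega)
    rwa [hYt hn _ (by omega)] at this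
  · have := a3 t (by omega) (by omega) i j hi hj
    rw [hY0 t le_rfl, zero_add, hY0 1 ht, hX.start i j hi hj] at this
    rcases this with e | e | e
    · exact .inr ⟨0, by rw [e, partialValue_zero]⟩
    · exact .inl e
    · exact .inr e

/-- Below, `F` is bounded because it is a path weight. Above, it may exceed the distance, so the
structural bound `IJKSystem.le` is needed. -/
theorem ijkValue_abs_le {n : ℕ} {G : WMatrix n} (hG : NoNegativeCycle G) {M : ℕ}
    (hM : ∀ (i j : Fin n) (x : ℤ), G i j = (x : WithTop ℤ) → |x| ≤ M) {i j : ℕ} {x : ℤ}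
    (hx : ijkValue n (entry (adjacencyMatrix G)) i j = x) : |x| ≤ 3 * M * n := by
  have h := ijkSystem hG
  obtain ⟨hi, hj⟩ := h.range i j (by rw [hx]; exact WithTop.coe_ne_top)
  rw [abs_le]
  constructor
  · obtain ⟨x', h1, h2, -⟩ := HasPath.exists_short hG hM
      (ijkValue_hasPath HasPath.of_adjacencyMatrix ⟨i, hi⟩ ⟨j, hj⟩ x hx)
    have := (abs_le.1 h2).1
    have : (0 : ℤ) ≤ n * M := by positivity
    linarith
  · have := h.le (M := M) (fun i j hw => by
      obtain ⟨hi, hj⟩ := h.weight_range i j hw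
      rw [entry, dif_pos ⟨hi, hj⟩, adjacencyMatrix]
      rw [entry, dif_pos ⟨hi, hj⟩, adjacencyMatrix] at hw
      split_ifs with hij
      · exact WithTop.coe_le_coe.2 (by positivity)
      · rw [if_neg hij] at hw
        obtain ⟨y, hy⟩ := WithTop.ne_top_iff_exists.1 hw
        rw [← hy]
        exact WithTop.coe_le_coe.2 ((le_abs_self y).trans (hM _ _ y hy.symm)))
      (i := i) (j := j) (by rw [hx]; exact WithTop.coe_ne_top)
    rw [hx] at this
    exact WithTop.coe_le_coe.1 this

theorem adjacency_abs_le {n : ℕ} {G : WMatrix n} {M : ℕ}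
    (hM : ∀ (i j : Fin n) (x : ℤ), G i j = (x : WithTop ℤ) → |x| ≤ M) {i j : ℕ} {x : ℤ}
    (hx : entry (adjacencyMatrix G) i j = x) : |x| ≤ M := by
  unfold entry at hx
  split_ifs at hx with h
  · unfold adjacencyMatrix at hx
    split_ifs at hx with hij
    · have : x = 0 := by exact_mod_cast hx.symm
      subst this; simp
    · exact hM _ _ _ hx
  · exact absurd hx WithTop.top_ne_coe

/-- Weights of queries must be small while the run is under way. Each entry is a value of `F` or a
partial value, the latter being a sum of at most two bounded numbers; hence the doubled constant. -/
theorem IsRun.abs_le {n : ℕ} {G : WMatrix n} (hG : NoNegativeCycle G) {M : ℕ}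
    (hM : ∀ (i j : Fin n) (x : ℤ), G i j = (x : WithTop ℤ) → |x| ≤ M) {t : ℕ}
    (ht : 1 ≤ t) {X : ℕ → ℕ → ℕ → WithTop ℤ} (hX : IsRun n (entry (adjacencyMatrix G))
      (ijkValue n (entry (adjacencyMatrix G))) t X) {i j : ℕ} (hi : i < n) (hj : j < n) {x : ℤ}
    (hx : X t i j = x) : |x| ≤ 6 * M * n := by
  have hF := fun (i j : ℕ) (x : ℤ) => ijkValue_abs_le hG hM (i := i) (j := j) (x := x)
  have hn : (1 : ℤ) ≤ n := by omega
  have hM0 : (0 : ℤ) ≤ M := by positivity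
  rcases (hX.all_steps (ijkSystem hG) ht hi hj).2 with e | ⟨κ, e⟩
  · have := hF i j x (by rw [← e, hx])
    nlinarith
  · have := abs_partialValue_le (B := 3 * M * n) (by positivity)
      (fun i j x hx => (adjacency_abs_le hM hx).trans (by nlinarith)) hF (e.symm.trans hx)
    linarith

/-! ### Bounded states -/

/-- All registers and memory cells are at most `β` in absolute value. -/
structure Bounded (β : ℕ) (s : State) : Prop where
  reg : ∀ r, |s.reg r| ≤ β
  mem : ∀ a, |s.mem a| ≤ β

/-- The values of all subexpressions are at most `β ^ degree` in a state bounded by `β`. -/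
def Expr.degree : Expr → ℕ
  | .lit c => c.natAbs + 1
  | .reg _ => 1
  | .load a => a.degree + 1
  | .add a b => a.degree + b.degree + 1
  | .sub a b => a.degree + b.degree + 1
  | .mul a b => a.degree + b.degree + 1
  | .lt a b => a.degree + b.degree + 1

theorem two_mul_pow_le {β a b : ℕ} (hβ : 2 ≤ β) : β ^ a + β ^ b ≤ β ^ (a + b + 1) := by
  have h1 : β ^ a ≤ β ^ (a + b) := Nat.pow_le_pow_right (by omega) (by omega)
  have h2 : β ^ b ≤ β ^ (a + b) := Nat.pow_le_pow_right (by omega) (by omega)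
  calc β ^ a + β ^ b ≤ β ^ (a + b) * 2 := by omega
    _ ≤ β ^ (a + b) * β := by gcongr
    _ = _ := (pow_succ _ _).symm

theorem Expr.fits_of_bounded {β W : ℕ} (hβ : 2 ≤ β) {s : State} (hs : Bounded β s) (e : Expr) :
    |e.eval s| ≤ (β ^ e.degree : ℕ) ∧ (β ^ e.degree ≤ W → e.Fits W s) := by
  have hmono : ∀ {a b : ℕ}, a ≤ b → β ^ a ≤ β ^ b := fun h => Nat.pow_le_pow_right (by omega) h
  have hcast : ∀ {x : ℤ} {a : ℕ}, |x| ≤ (β ^ a : ℕ) → β ^ a ≤ W → |x| ≤ W := fun h h' =>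
    h.trans (by exact_mod_cast h')
  have hadd : ∀ {x y : ℤ} {a b : ℕ}, |x| ≤ (β ^ a : ℕ) → |y| ≤ (β ^ b : ℕ) →
      |x| + |y| ≤ (β ^ (a + b + 1) : ℕ) := fun h h' =>
    (add_le_add h h').trans (by exact_mod_cast two_mul_pow_le hβ)
  induction e with
  | lit c =>
    have h : |c| ≤ (β ^ (c.natAbs + 1) : ℕ) := by
      rw [Int.abs_eq_natAbs]
      have h1 : c.natAbs < 2 ^ c.natAbs := Nat.lt_two_pow_self
      have h2 : 2 ^ c.natAbs ≤ β ^ c.natAbs := Nat.pow_le_pow_left hβ _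
      have h3 := hmono (Nat.le_succ c.natAbs)
      exact_mod_cast (h1.le.trans h2).trans h3
    exact ⟨h, fun hW => hcast h hW⟩
  | reg r =>
    have h : |s.reg r| ≤ (β ^ 1 : ℕ) := by rw [pow_one]; exact hs.reg r
    exact ⟨h, fun hW => hcast h hW⟩
  | load a ih =>
    have h : |s.mem (a.eval s)| ≤ (β ^ (a.degree + 1) : ℕ) :=
      (hs.mem _).trans (by exact_mod_cast Nat.le_self_pow (by omega) β)
    exact ⟨h, fun hW => ⟨ih.2 ((hmono (Nat.le_succ _)).trans hW), hcast h hW⟩⟩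
  | add a b iha ihb =>
    have h := (abs_add_le (a.eval s) (b.eval s)).trans (hadd iha.1 ihb.1)
    exact ⟨h, fun hW => ⟨iha.2 ((hmono (by simp only [Expr.degree]; omega)).trans hW),
      ihb.2 ((hmono (by simp only [Expr.degree]; omega)).trans hW), hcast h hW⟩⟩
  | sub a b iha ihb =>
    have h := (abs_sub (a.eval s) (b.eval s)).trans (hadd iha.1 ihb.1)
    exact ⟨h, fun hW => ⟨iha.2 ((hmono (by simp only [Expr.degree]; omega)).trans hW),
      ihb.2 ((hmono (by simp only [Expr.degree]; omega)).trans hW), hcast h hW⟩⟩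
  | mul a b iha ihb =>
    have h : |a.eval s * b.eval s| ≤ (β ^ (a.degree + b.degree + 1) : ℕ) := by
      rw [abs_mul]
      refine (mul_le_mul iha.1 ihb.1 (abs_nonneg _) (by positivity)).trans ?_
      rw [← Nat.cast_mul, ← pow_add]
      exact_mod_cast hmono (Nat.le_succ _)
    exact ⟨h, fun hW => ⟨iha.2 ((hmono (by simp only [Expr.degree]; omega)).trans hW),
      ihb.2 ((hmono (by simp only [Expr.degree]; omega)).trans hW), hcast h hW⟩⟩
  | lt a b iha ihb =>
    have h : |(Expr.lt a b).eval s| ≤ (β ^ (a.degree + b.degree + 1) : ℕ) := by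
      have : 1 ≤ β ^ (a.degree + b.degree + 1) := Nat.one_le_pow _ _ (by omega)
      simp only [Expr.eval]
      split_ifs
      · simpa using mod_cast this
      · simp
    exact ⟨h, fun hW => ⟨iha.2 ((hmono (by simp only [Expr.degree]; omega)).trans hW),
      ihb.2 ((hmono (by simp only [Expr.degree]; omega)).trans hW), hcast h hW⟩⟩

/-- A bound for the degrees of the expressions in use. -/
def degreeBound : ℕ := 5000

/-- The machine: an oracle, a bound `W` for the words and a bound `β` for the states between two
commands, far enough apart for the expressions in use. -/
structure Machine where
  O : Oracle
  W : ℕ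
  β : ℕ
  two_le : 2 ≤ β
  pow_le : β ^ degreeBound ≤ W

theorem Machine.fits (μ : Machine) {s : State} (hs : Bounded μ.β s) {e : Expr}
    (he : e.degree ≤ degreeBound) : e.Fits μ.W s :=
  (Expr.fits_of_bounded μ.two_le hs e).2
    ((Nat.pow_le_pow_right (by have := μ.two_le; omega) he).trans μ.pow_le)

theorem Machine.le_W (μ : Machine) : μ.β ≤ μ.W :=
  (Nat.le_self_pow (by unfold degreeBound; norm_num) μ.β).trans μ.pow_le

/-! ### Total correctness with running times -/

/-- Started in `s`, the program halts after at most `T` steps in a state that satisfies `Post`. -/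
def Reaches (μ : Machine) (p : Program) (s : State) (T : ℕ) (Post : State → Prop) : Prop :=
  ∃ s' t Q, Exec μ.O μ.W p s s' t Q ∧ t ≤ T ∧ Post s'

namespace Reaches

variable {μ : Machine}

theorem mono {p : Program} {s : State} {T T' : ℕ} {Post Post' : State → Prop}
    (h : Reaches μ p s T Post) (hT : T ≤ T') (hP : ∀ s', Post s' → Post' s') :
    Reaches μ p s T' Post' := by
  obtain ⟨s', t, Q, h1, h2, h3⟩ := h
  exact ⟨s', t, Q, h1, h2.trans hT, hP _ h3⟩

theorem seq {p q : Program} {s : State} {T T' : ℕ} {Mid Post : State → Prop}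
    (hp : Reaches μ p s T Mid) (hq : ∀ s', Mid s' → Reaches μ q s' T' Post) :
    Reaches μ (.seq p q) s (T + T') Post := by
  obtain ⟨s', t, Q, h1, h2, h3⟩ := hp
  obtain ⟨s'', t', Q', h4, h5, h6⟩ := hq s' h3
  exact ⟨s'', t + t', Q ++ Q', .seq h1 h4, add_le_add h2 h5, h6⟩

theorem assign {s : State} {r : ℕ} {e : Expr} {Post : State → Prop} (hs : Bounded μ.β s)
    (he : e.degree ≤ degreeBound)
    (hP : Post { s with reg := Function.update s.reg r (e.eval s) }) :
    Reaches μ (.assign r e) s (e.cost + 1) Post :=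
  ⟨_, _, _, .assign s r e (μ.fits hs he), le_rfl, hP⟩

theorem store {s : State} {a e : Expr} {Post : State → Prop} (hs : Bounded μ.β s)
    (ha : a.degree ≤ degreeBound) (he : e.degree ≤ degreeBound)
    (hP : Post { s with mem := Function.update s.mem (a.eval s) (e.eval s) }) :
    Reaches μ (.store a e) s (a.cost + e.cost + 1) Post :=
  ⟨_, _, _, .store s a e (μ.fits hs ha) (μ.fits hs he), le_rfl, hP⟩

theorem le_time {p : Program} {s : State} {T T' : ℕ} {Post : State → Prop}
    (h : Reaches μ p s T Post) (hT : T ≤ T') : Reaches μ p s T' Post :=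
  h.mono hT fun _ h => h

theorem assign_seq {s : State} {r : ℕ} {e : Expr} {q : Program} {T : ℕ} {Post : State → Prop}
    (hs : Bounded μ.β s) (he : e.degree ≤ degreeBound) {v : ℤ} (hv : e.eval s = v)
    (hq : Reaches μ q { s with reg := Function.update s.reg r v } T Post) :
    Reaches μ (.seq (.assign r e) q) s (e.cost + 1 + T) Post := by
  subst hv
  exact seq (Mid := fun t => t = { s with reg := Function.update s.reg r (e.eval s) })
    (assign hs he rfl) (by rintro _ rfl; exact hq)

theorem store_seq {s : State} {a e : Expr} {q : Program} {T : ℕ} {Post : State → Prop}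
    (hs : Bounded μ.β s) (ha : a.degree ≤ degreeBound) (he : e.degree ≤ degreeBound) {b v : ℤ}
    (hb : a.eval s = b) (hv : e.eval s = v)
    (hq : Reaches μ q { s with mem := Function.update s.mem b v } T Post) :
    Reaches μ (.seq (.store a e) q) s (a.cost + e.cost + 1 + T) Post := by
  subst hb hv
  exact seq (Mid := fun t => t = { s with mem := Function.update s.mem (a.eval s) (e.eval s) })
    (store hs ha he rfl) (by rintro _ rfl; exact hq)

/-- The time bound depends on the round, because the steps of the schedule differ widely in length
and only their sum is small. -/
theorem loop {e : Expr} {p : Program} {N : ℕ} {T : ℕ → ℕ} (I : ℕ → State → Prop)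
    (he : e.degree ≤ degreeBound) (hI : ∀ k s, I k s → Bounded μ.β s)
    (hstep : ∀ k < N, ∀ s, I k s → e.eval s ≠ 0 ∧ Reaches μ p s (T k) (I (k + 1)))
    (hdone : ∀ s, I N s → e.eval s = 0) {s : State} (h0 : I 0 s) :
    Reaches μ (.loop e p) s (∑ k ∈ Finset.range N, (T k + (e.cost + 1)) + (e.cost + 1)) (I N) := by
  have key : ∀ m k, k + m = N → ∀ s, I k s → Reaches μ (.loop e p) s
      (∑ i ∈ Finset.Ico k N, (T i + (e.cost + 1)) + (e.cost + 1)) (I N) := by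
    intro m
    induction m with
    | zero =>
      rintro k rfl s hs
      exact ⟨s, _, _, .loop_done (μ.fits (hI _ _ hs) he) (hdone s hs), by simp, hs⟩
    | succ m ih =>
      rintro k hk s hs
      obtain ⟨hc, s', t, Q, h1, h2, h3⟩ := hstep k (by omega) s hs
      obtain ⟨s'', t', Q', h4, h5, h6⟩ := ih (k + 1) (by omega) s' h3
      refine ⟨s'', _, _, .loop_step (μ.fits (hI _ _ hs) he) hc h1 h4, ?_, h6⟩
      rw [Finset.sum_eq_sum_Ico_succ_bot (by omega)]
      omega
  have := key N 0 (by omega) s h0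
  rwa [← Finset.range_eq_Ico] at this

end Reaches

/-! ### Matrices in memory -/

/-- The extended integer that is stored in the two cells from `a` on. -/
def cellValue (mem : ℤ → ℤ) (a : ℤ) : WithTop ℤ :=
  if mem a = 0 then ⊤ else (mem (a + 1) : ℤ)

/-- The address of the entry `(p, q)` of a matrix with rows of length `stride`. -/
def cellAddr (base : ℤ) (stride p q : ℕ) : ℤ := base + 2 * ((p : ℤ) * stride + q)

theorem readMatrix_eq (mem : ℤ → ℤ) (base : ℤ) (n : ℕ) (i j : Fin n) :
    readMatrix mem base n i j = cellValue mem (cellAddr base n i j) := rfl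

theorem cellAddr_inj {base : ℤ} {stride p q p' q' : ℕ} (hq : q < stride) (hq' : q' < stride)
    (h : cellAddr base stride p q = cellAddr base stride p' q') : p = p' ∧ q = q' := by
  unfold cellAddr at h
  have h1 : p * stride + q = p' * stride + q' := by
    have : ((p * stride + q : ℕ) : ℤ) = (p' * stride + q' : ℕ) := by push_cast; linarith
    exact_mod_cast this
  have hpos : 0 < stride := by omega
  have h2 : p = p' := by
    have := congrArg (· / stride) h1
    simpa [Nat.mul_comm p, Nat.mul_comm p', Nat.mul_add_div hpos, Nat.div_eq_of_lt hq,
      Nat.div_eq_of_lt hq'] using this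
  subst h2
  exact ⟨rfl, by omega⟩

theorem cellAddr_ne {base : ℤ} {stride p q p' q' : ℕ} (hq : q < stride) (hq' : q' < stride)
    (h : ¬(p = p' ∧ q = q')) :
    cellAddr base stride p q ≠ cellAddr base stride p' q' ∧
    cellAddr base stride p q + 1 ≠ cellAddr base stride p' q' ∧
    cellAddr base stride p q ≠ cellAddr base stride p' q' + 1 ∧
    cellAddr base stride p q + 1 ≠ cellAddr base stride p' q' + 1 := by
  have h1 := fun hc => h (cellAddr_inj (base := base) hq hq' hc)
  refine ⟨h1, ?_, ?_, fun hc => h1 (by linarith)⟩ <;>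
  · unfold cellAddr; omega

/-! ### Filling a matrix -/

/-- The loop body of `fill`. -/
def fillBody (ef ev : Expr) : Program :=
  .seq (.assign 8 ef) (.seq (.assign 9 ev)
    (.seq (.store (.add (.reg 4) (.mul (.lit 2) (.add (.mul (.reg 6) (.reg 10)) (.reg 7)))) (.reg 8))
    (.seq (.store (.add (.add (.reg 4) (.mul (.lit 2) (.add (.mul (.reg 6) (.reg 10)) (.reg 7))))
      (.lit 1)) (.reg 9))
    (.seq (.assign 6 (.add (.reg 6) (.sub (.lit 1) (.lt (.add (.reg 7) (.lit 1)) (.reg 5)))))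
    (.assign 7 (.mul (.add (.reg 7) (.lit 1)) (.lt (.add (.reg 7) (.lit 1)) (.reg 5))))))))

/-- For all `p, q` less than register `5`, write the values of `ef` and `ev`, which may refer to
`p` and `q` as registers `6` and `7`, to the two cells of the entry `(p, q)` of the matrix at the
address in register `4`, with rows of the length in register `10`. -/
def fill (ef ev : Expr) : Program :=
  .seq (.assign 6 (.lit 0)) (.seq (.assign 7 (.lit 0))
    (.loop (.lt (.reg 6) (.reg 5)) (fillBody ef ev)))

/-- The registers other than the scratch registers of `fill` are unchanged. -/
def SameRegs (s s' : State) : Prop := ∀ r, r < 6 ∨ 9 < r → s'.reg r = s.reg r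

theorem Bounded.setReg {β : ℕ} {s : State} (hs : Bounded β s) {r : ℕ} {v : ℤ} (hv : |v| ≤ β) :
    Bounded β { s with reg := Function.update s.reg r v } := by
  refine ⟨fun r' => ?_, hs.mem⟩
  simp only [Function.update_apply]
  split_ifs
  · exact hv
  · exact hs.reg r'

theorem Bounded.setMem {β : ℕ} {s : State} (hs : Bounded β s) {a v : ℤ} (hv : |v| ≤ β) :
    Bounded β { s with mem := Function.update s.mem a v } := by
  refine ⟨hs.reg, fun a' => ?_⟩
  simp only [Function.update_apply]
  split_ifs
  · exact hv
  · exact hs.mem a'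

/-- The memory `mem'` differs from `mem` at most in those entries `(p, q)` of the `N × N` matrix for
which `C p q` holds. -/
def SameMem (base : ℤ) (stride N : ℕ) (C : ℕ → ℕ → Prop) (mem mem' : ℤ → ℤ) : Prop :=
  ∀ a, (∀ p q, p < N → q < N → C p q →
    a ≠ cellAddr base stride p q ∧ a ≠ cellAddr base stride p q + 1) → mem' a = mem a

/-- The loop invariant of `fill` after `k` rounds. -/
structure FillInvariant (β : ℕ) (s : State) (base : ℤ) (stride N : ℕ) (f v : ℕ → ℕ → ℤ) (k : ℕ)
    (s' : State) : Prop where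
  bounded : Bounded β s'
  regs : SameRegs s s'
  row : s'.reg 6 = (k / N : ℕ)
  col : s'.reg 7 = (k % N : ℕ)
  done : ∀ p q, p < N → q < N → p * N + q < k → s'.mem (cellAddr base stride p q) = f p q ∧
    s'.mem (cellAddr base stride p q + 1) = v p q
  same : SameMem base stride N (fun p q => p * N + q < k) s.mem s'.mem

/-- The values of `ef` and `ev` in the round for `(p, q)`. -/
def FillValues (s : State) (base : ℤ) (stride N : ℕ) (ef ev : Expr) (f v : ℕ → ℕ → ℤ) : Prop :=
  ∀ p q, p < N → q < N → ∀ s' : State, SameRegs s s' → s'.reg 6 = p → s'.reg 7 = q →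
    SameMem base stride N (fun p' q' => ¬(p' = p ∧ q' = q)) s.mem s'.mem →
    ef.eval s' = f p q ∧ ev.eval s' = v p q

/-- Both values are computed before either cell is written, so `ef` and `ev` may read the old
contents of the entry being replaced. This permits minima in place. -/
theorem reaches_fillBody {μ : Machine} {s : State} {base : ℤ} {stride N : ℕ} {f v : ℕ → ℕ → ℤ}
    {ef ev : Expr} (hef : ef.degree ≤ degreeBound) (hev : ev.degree ≤ degreeBound)
    (h4 : s.reg 4 = base) (h5 : s.reg 5 = N) (h10 : s.reg 10 = stride) (hN : N ≤ stride)
    (hNβ : N ≤ μ.β)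
    (hval : FillValues s base stride N ef ev f v)
    (hf : ∀ p q, p < N → q < N → |f p q| ≤ μ.β) (hv : ∀ p q, p < N → q < N → |v p q| ≤ μ.β)
    {k : ℕ} (hk : k < N * N) {s' : State} (hI : FillInvariant μ.β s base stride N f v k s') :
    Reaches μ (fillBody ef ev) s' (ef.cost + ev.cost + 60)
      (FillInvariant μ.β s base stride N f v (k + 1)) := by
  have hN0 : 0 < N := by by_contra h; simp [show N = 0 by omega] at hk
  obtain ⟨p, hp⟩ : ∃ p, p = k / N := ⟨_, rfl⟩
  obtain ⟨q, hq⟩ : ∃ q, q = k % N := ⟨_, rfl⟩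
  have hpN : p < N := hp ▸ Nat.div_lt_of_lt_mul hk
  have hqN : q < N := hq ▸ Nat.mod_lt _ hN0
  have hpq : p * N + q = k := by rw [hp, hq, mul_comm]; exact Nat.div_add_mod k N
  have hsame : SameMem base stride N (fun p' q' => ¬(p' = p ∧ q' = q)) s.mem s'.mem := by
    intro a ha
    refine hI.same a fun p' q' h1 h2 h3 => ha p' q' h1 h2 ?_
    rintro ⟨rfl, rfl⟩
    omega
  obtain ⟨hB, hR, h6, h7, hdone, hsm⟩ := hI
  rw [← hp] at h6
  rw [← hq] at h7
  obtain ⟨v1, -⟩ := hval p q hpN hqN s' hR h6 h7 hsame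
  have r4 : s'.reg 4 = base := by rw [hR 4 (by omega), h4]
  have r5 : s'.reg 5 = N := by rw [hR 5 (by omega), h5]
  have r10 : s'.reg 10 = stride := by rw [hR 10 (by omega), h10]
  have hdiv : (k + 1) / N = p + (if q + 1 < N then 0 else 1) := by
    split_ifs with hc
    · rw [← hpq, add_assoc, mul_comm, Nat.mul_add_div hN0, Nat.div_eq_of_lt hc]
    · have e : k + 1 = N * (p + 1) := by
        rw [← hpq, add_assoc, show q + 1 = N by omega]; ring
      rw [e, Nat.mul_div_cancel_left _ hN0]
  have hmod : (k + 1) % N = if q + 1 < N then q + 1 else 0 := by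
    split_ifs with hc
    · rw [← hpq, add_assoc, mul_comm, Nat.mul_add_mod, Nat.mod_eq_of_lt hc]
    · have e : k + 1 = N * (p + 1) := by
        rw [← hpq, add_assoc, show q + 1 = N by omega]; ring
      rw [e, Nat.mul_mod_right]
  -- The two indices advance like an odometer: the comparison decides between the next column and a
  -- carry into the next row, without branching.
  have hp' : (p : ℤ) + (1 - if (q : ℤ) + 1 < N then 1 else 0) = ((k + 1) / N : ℕ) := by
    rw [hdiv]
    by_cases hc : q + 1 < N
    · have : (q : ℤ) + 1 < N := by exact_mod_cast hc
      simp [hc, this]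
    · have : ¬ (q : ℤ) + 1 < N := by exact_mod_cast hc
      simp [hc, this]
  have hq' : ((q : ℤ) + 1) * (if (q : ℤ) + 1 < N then 1 else 0) = ((k + 1) % N : ℕ) := by
    rw [hmod]
    by_cases hc : q + 1 < N
    · have : (q : ℤ) + 1 < N := by exact_mod_cast hc
      simp [hc, this]
    · have : ¬ (q : ℤ) + 1 < N := by exact_mod_cast hc
      simp [hc, this]
  obtain ⟨p', hp''⟩ : ∃ p', p' = (k + 1) / N := ⟨_, rfl⟩
  obtain ⟨q', hq''⟩ : ∃ q', q' = (k + 1) % N := ⟨_, rfl⟩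
  rw [← hp''] at hp'
  rw [← hq''] at hq'
  have hple : |(p' : ℤ)| ≤ μ.β := by
    rw [Nat.abs_cast, hp'']
    have : (k + 1) / N ≤ N := Nat.div_le_of_le_mul hk
    exact_mod_cast this.trans hNβ
  have hqle : |(q' : ℤ)| ≤ μ.β := by
    rw [Nat.abs_cast, hq'']
    exact_mod_cast (Nat.mod_lt _ hN0).le.trans hNβ
  have hB1 := hB.setReg (r := 8) (hf p q hpN hqN)
  obtain ⟨-, v2⟩ := hval p q hpN hqN { s' with reg := Function.update s'.reg 8 (f p q) }
    (fun r hr => by simp only [Function.update_apply]; rw [if_neg (by omega)]; exact hR r hr)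
    (by simpa using h6) (by simpa using h7) hsame
  have hB2 := hB1.setReg (r := 9) (hv p q hpN hqN)
  have hB3 := hB2.setMem (a := cellAddr base stride p q) (hf p q hpN hqN)
  have hB4 := hB3.setMem (a := cellAddr base stride p q + 1) (hv p q hpN hqN)
  have hB5 := hB4.setReg (r := 6) hple
  unfold fillBody
  refine Reaches.le_time (T := ?T) ?h ?hT
  case h =>
    refine .assign_seq hB hef v1 (.assign_seq hB1 hev v2 (.store_seq
      (b := cellAddr base stride p q) (v := f p q) hB2 ?_ ?_ ?_ ?_
      (.store_seq (b := cellAddr base stride p q + 1) (v := v p q) hB3 ?_ ?_ ?_ ?_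
      (.assign_seq (v := p') hB4 ?_ ?_ (.assign hB5 ?_ ?_)))))
    · decide
    · decide
    · simp [Expr.eval, r4, r10, h6, h7, cellAddr]
    · simp [Expr.eval]
    · decide
    · decide
    · simp [Expr.eval, r4, r10, h6, h7, cellAddr]
    · simp [Expr.eval]
    · decide
    · rw [← hp']; simp [Expr.eval, r5, h6, h7]
    · decide
    have heval : (Expr.mul (.add (.reg 7) (.lit 1)) (.lt (.add (.reg 7) (.lit 1)) (.reg 5))).eval
      { reg := Function.update (Function.update (Function.update s'.reg 8 (f p q)) 9 (v p q)) 6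
          (p' : ℤ)
        mem := Function.update (Function.update s'.mem (cellAddr base stride p q) (f p q))
          (cellAddr base stride p q + 1) (v p q) } = (q' : ℤ) := by
      rw [← hq']; simp [Expr.eval, r5, h7]
    simp only [heval]
    refine ⟨hB5.setReg hqle, ?_, ?_, ?_, ?_, ?_⟩
    · intro r hr
      simp only [Function.update_apply]
      rw [if_neg (by omega), if_neg (by omega), if_neg (by omega), if_neg (by omega)]
      exact hR r hr
    · simp [hp'']
    · simp [hq'']
    · intro a b h1 h2 h3
      by_cases hc : a = p ∧ b = q
      · obtain ⟨rfl, rfl⟩ := hc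
        simp
      · obtain ⟨e1, e2, e3, e4⟩ := cellAddr_ne (base := base) (h2.trans_le hN) (hqN.trans_le hN) hc
        have hlt : a * N + b < k := by
          refine lt_of_le_of_ne (Nat.lt_succ_iff.1 h3) fun he => hc ?_
          exact cellAddr_inj (base := 0) (stride := N) (p := a) (p' := p) h2 hqN (by
            unfold cellAddr
            have : ((a * N + b : ℕ) : ℤ) = (p * N + q : ℕ) := by rw [he, hpq]
            push_cast at this
            rw [this])
        simp only [Function.update_apply]
        rw [if_neg e3, if_neg e1, if_neg e4, if_neg e2]
        exact hdone a b h1 h2 hlt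
    · intro a ha
      have h1 := ha p q hpN hqN (by omega)
      simp only [Function.update_apply]
      rw [if_neg h1.2, if_neg h1.1]
      exact hsm a fun p' q' h2 h3 h4 => ha p' q' h2 h3 (by omega)
  case hT =>
    simp only [Expr.cost]
    omega

/-- The effect of `fill`. -/
structure FillPost (β : ℕ) (s : State) (base : ℤ) (stride N : ℕ) (f v : ℕ → ℕ → ℤ)
    (s' : State) : Prop where
  bounded : Bounded β s'
  regs : SameRegs s s'
  done : ∀ p q, p < N → q < N → s'.mem (cellAddr base stride p q) = f p q ∧
    s'.mem (cellAddr base stride p q + 1) = v p q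
  same : SameMem base stride N (fun _ _ => True) s.mem s'.mem

theorem reaches_fill {μ : Machine} {s : State} {base : ℤ} {stride N : ℕ} {f v : ℕ → ℕ → ℤ}
    {ef ev : Expr} (hef : ef.degree ≤ degreeBound) (hev : ev.degree ≤ degreeBound)
    (hs : Bounded μ.β s)
    (h4 : s.reg 4 = base) (h5 : s.reg 5 = N) (h10 : s.reg 10 = stride) (hN : N ≤ stride)
    (hNβ : N ≤ μ.β)
    (hval : FillValues s base stride N ef ev f v)
    (hf : ∀ p q, p < N → q < N → |f p q| ≤ μ.β) (hv : ∀ p q, p < N → q < N → |v p q| ≤ μ.β) :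
    Reaches μ (fill ef ev) s (N * N * (ef.cost + ev.cost + 64) + 8)
      (FillPost μ.β s base stride N f v) := by
  have h0 : |(0 : ℤ)| ≤ μ.β := by simp
  have hB1 := hs.setReg (r := 6) h0
  have hB2 := hB1.setReg (r := 7) h0
  unfold fill
  refine Reaches.le_time (T := ?T) ?h ?hT
  case h =>
    refine .assign_seq (v := 0) hs ?_ ?_ (.assign_seq (v := 0) hB1 ?_ ?_
      (.mono (.loop (N := N * N) (T := fun _ => ef.cost + ev.cost + 60)
        (FillInvariant μ.β s base stride N f v) ?_ (fun _ _ h => h.bounded) ?_ ?_ ?_)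
        le_rfl ?_))
    · decide
    · rfl
    · decide
    · rfl
    · decide
    · intro k hk s' hI
      refine ⟨?_, reaches_fillBody hef hev h4 h5 h10 hN hNβ hval hf hv hk hI⟩
      have : k / N < N := Nat.div_lt_of_lt_mul hk
      have : ((k / N : ℕ) : ℤ) < N := by exact_mod_cast this
      simp only [Expr.eval, hI.row, hI.regs 5 (by omega), h5]
      rw [if_pos this]; norm_num
    · intro s' hI
      have : ¬ (((N * N / N : ℕ) : ℤ) < N) := by
        rcases Nat.eq_zero_or_pos N with rfl | h
        · simp
        · rw [Nat.mul_div_cancel_left _ h]; omega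
      simp only [Expr.eval, hI.row, hI.regs 5 (by omega), h5]
      rw [if_neg this]
    · refine ⟨hB2, fun r hr => ?_, by simp, by simp, fun p q _ _ h => absurd h (by omega),
        fun a _ => rfl⟩
      simp only [Function.update_apply]
      rw [if_neg (by omega), if_neg (by omega)]
    · intro s' hI
      have hlt : ∀ p q, p < N → q < N → p * N + q < N * N := by intro p q h1 h2; nlinarith
      exact ⟨hI.bounded, hI.regs, fun p q h1 h2 => hI.done p q h1 h2 (hlt p q h1 h2),
        fun a ha => hI.same a fun p q h1 h2 _ => ha p q h1 h2 trivial⟩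
  case hT =>
    simp only [Expr.cost, Finset.sum_const, Finset.card_range, smul_eq_mul]
    have : N * N * (ef.cost + ev.cost + 60 + (1 + 1 + 1 + 1)) =
      N * N * (ef.cost + ev.cost + 64) := by ring
    omega

/-! ### Oracle calls -/

/-- The extended integer given by a flag and a value. -/
def pairValue (f v : ℤ) : WithTop ℤ := if f = 0 then ⊤ else v

theorem cellValue_eq (mem : ℤ → ℤ) (a : ℤ) : cellValue mem a = pairValue (mem a) (mem (a + 1)) := rfl

theorem index_lt {N p q : ℕ} (hp : p < N) (hq : q < N) : (p : ℤ) * N + q + 1 ≤ N * N := by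
  have : p * N + q + 1 ≤ N * N := by nlinarith
  exact_mod_cast this

theorem matrixCell_index {N p q : ℕ} (R : WMatrix N) (hp : p < N) (hq : q < N) :
    matrixCell R (2 * (p * N + q)) = (if R ⟨p, hp⟩ ⟨q, hq⟩ = ⊤ then 0 else 1) ∧
    matrixCell R (2 * (p * N + q) + 1) = (R ⟨p, hp⟩ ⟨q, hq⟩).untopD 0 := by
  have hN : 0 < N := by omega
  have e1 : (p * N + q) / N = p := by
    rw [mul_comm, Nat.mul_add_div hN, Nat.div_eq_of_lt hq, add_zero]
  have e2 : (p * N + q) % N = q := by rw [mul_comm, Nat.mul_add_mod, Nat.mod_eq_of_lt hq]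
  have e3 : 2 * (p * N + q) / 2 = p * N + q := by omega
  have e4 : (2 * (p * N + q) + 1) / 2 = p * N + q := by omega
  constructor
  · simp only [matrixCell, e3, e1, e2, hp, hq, and_self, dif_pos]
    rw [if_pos (by omega)]
  · simp only [matrixCell, e4, e1, e2, hp, hq, and_self, dif_pos]
    rw [if_neg (by omega)]

theorem writeMatrix_apply {N : ℕ} (mem : ℤ → ℤ) (base : ℤ) (R : WMatrix N) {p q : ℕ} (hp : p < N)
    (hq : q < N) : cellValue (writeMatrix mem base R) (cellAddr base N p q) = R ⟨p, hp⟩ ⟨q, hq⟩ := by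
  have h := index_lt hp hq
  have h0 : (0 : ℤ) ≤ (p : ℤ) * N + q := by positivity
  have e1 : (cellAddr base N p q - base).toNat = 2 * (p * N + q) := by
    unfold cellAddr
    have : base + 2 * ((p : ℤ) * N + q) - base = ((2 * (p * N + q) : ℕ) : ℤ) := by push_cast; ring
    rw [this, Int.toNat_natCast]
  have e2 : (cellAddr base N p q + 1 - base).toNat = 2 * (p * N + q) + 1 := by
    unfold cellAddr
    have : base + 2 * ((p : ℤ) * N + q) + 1 - base = ((2 * (p * N + q) + 1 : ℕ) : ℤ) := by
      push_cast; ring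
    rw [this, Int.toNat_natCast]
  have c1 : writeMatrix mem base R (cellAddr base N p q) = matrixCell R (2 * (p * N + q)) := by
    unfold writeMatrix
    rw [if_pos (by unfold cellAddr; push_cast; constructor <;> linarith), e1]
  have c2 : writeMatrix mem base R (cellAddr base N p q + 1) =
      matrixCell R (2 * (p * N + q) + 1) := by
    unfold writeMatrix
    rw [if_pos (by unfold cellAddr; push_cast; constructor <;> linarith), e2]
  rw [cellValue, c1, c2, (matrixCell_index R hp hq).1, (matrixCell_index R hp hq).2]
  by_cases hR : R ⟨p, hp⟩ ⟨q, hq⟩ = ⊤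
  · rw [if_pos hR, if_pos rfl, hR]
  · rw [if_neg hR, if_neg one_ne_zero]
    obtain ⟨x, hx⟩ := WithTop.ne_top_iff_exists.1 hR
    rw [← hx]; rfl

theorem matrixCell_abs_le {N β : ℕ} (hβ : 1 ≤ β) {R : WMatrix N}
    (hR : ∀ (i j : Fin N) (x : ℤ), R i j = (x : WithTop ℤ) → |x| ≤ β) (q : ℕ) :
    |matrixCell R q| ≤ β := by
  have h1 : |(1 : ℤ)| ≤ β := by simpa using mod_cast hβ
  have h0 : |(0 : ℤ)| ≤ β := by simp
  unfold matrixCell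
  by_cases h : q / 2 / N < N ∧ q / 2 % N < N
  · rw [dif_pos h]
    change |if q % 2 = 0 then (if R ⟨q / 2 / N, h.1⟩ ⟨q / 2 % N, h.2⟩ = ⊤ then (0 : ℤ) else 1)
      else (R ⟨q / 2 / N, h.1⟩ ⟨q / 2 % N, h.2⟩).untopD 0| ≤ (β : ℤ)
    split_ifs
    · exact h0
    · exact h1
    · rcases hx : R ⟨q / 2 / N, h.1⟩ ⟨q / 2 % N, h.2⟩ with _ | x
      · exact h0
      · exact hR _ _ _ hx
  · rw [dif_neg h]; exact h0

theorem writeMatrix_abs_le {N β : ℕ} (hβ : 1 ≤ β) {mem : ℤ → ℤ} (hm : ∀ a, |mem a| ≤ β) {base : ℤ}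
    {R : WMatrix N} (hR : ∀ (i j : Fin N) (x : ℤ), R i j = (x : WithTop ℤ) → |x| ≤ β) (a : ℤ) :
    |writeMatrix mem base R a| ≤ β := by
  unfold writeMatrix
  split_ifs
  · exact matrixCell_abs_le hβ hR _
  · exact hm a

/-- Fill in the query at the address in register `4`, of the size in register `5`, and replace it
by the answer. -/
def query (ef ev : Expr) : Program := .seq (fill ef ev) (.call (.reg 5) (.reg 4) (.reg 4))

/-- The effect of `query`. -/
structure QueryPost (β : ℕ) (s : State) (base : ℤ) {N : ℕ} (G : WMatrix N) (s' : State) : Prop where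
  bounded : Bounded β s'
  regs : SameRegs s s'
  answer : ∃ D : WMatrix N, APSP.IsSolution G D ∧
    ∀ p q, p < N → q < N → cellValue s'.mem (cellAddr base N p q) = entry D p q
  same : ∀ a < base, s'.mem a = s.mem a

theorem cellAddr_ge (base : ℤ) (stride p q : ℕ) : base ≤ cellAddr base stride p q := by
  unfold cellAddr
  have : (0 : ℤ) ≤ (p : ℤ) * stride + q := by positivity
  linarith

/-- The expressions may rely on addresses below `base`, which neither the filling nor the answer
touches. Distances are at most `N * B` in absolute value, so the answer keeps the state bounded. -/
theorem reaches_query {μ : Machine} (hO : μ.O.Solves APSP) {s : State} {base : ℤ} {N B : ℕ}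
    {f v : ℕ → ℕ → ℤ} {ef ev : Expr} (hef : ef.degree ≤ degreeBound)
    (hev : ev.degree ≤ degreeBound) (hs : Bounded μ.β s) (h0 : 0 ≤ base)
    (h4 : s.reg 4 = base) (h5 : s.reg 5 = N) (h10 : s.reg 10 = N)
    (hNβ : base + 2 * (N * N) ≤ μ.β)
    (hval : ∀ p q, p < N → q < N → ∀ s' : State, SameRegs s s' → s'.reg 6 = p → s'.reg 7 = q →
      (∀ a < base, s'.mem a = s.mem a) → ef.eval s' = f p q ∧ ev.eval s' = v p q)
    (hf : ∀ p q, p < N → q < N → |f p q| ≤ μ.β) (hv : ∀ p q, p < N → q < N → |v p q| ≤ μ.β)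
    {G : WMatrix N} (hG : NoNegativeCycle G)
    (hfG : ∀ p q : Fin N, pairValue (f p q) (v p q) = G p q)
    (hB : ∀ (i j : Fin N) (x : ℤ), G i j = (x : WithTop ℤ) → |x| ≤ B) (hNB : N * B ≤ μ.β) :
    Reaches μ (query ef ev) s (N * N * (ef.cost + ev.cost + 66) + 12) (QueryPost μ.β s base G) := by
  have hNN : N ≤ N * N := Nat.le_mul_self N
  have hβ := μ.two_le
  have hNβ' : N ≤ μ.β := by
    have : ((N : ℕ) : ℤ) ≤ (N * N : ℕ) := by exact_mod_cast hNN
    push_cast at this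
    have h2 : (0 : ℤ) ≤ N := by positivity
    zify; linarith
  refine Reaches.le_time (T := ?T) ?h ?hT
  case h =>
    refine Reaches.seq (reaches_fill (f := f) (v := v) hef hev hs h4 h5 h10 le_rfl hNβ' ?_ hf hv)
      (T' := 3 + 2 * (N * N) + 1) ?_
    · intro p q hp hq s' hR h6 h7 hsame
      refine hval p q hp hq s' hR h6 h7 fun a ha => hsame a fun p' q' _ _ _ => ?_
      have := cellAddr_ge base N p' q'
      constructor <;> omega
    · intro s' hF
      have r4 : s'.reg 4 = base := by rw [hF.regs 4 (by omega), h4]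
      have r5 : s'.reg 5 = N := by rw [hF.regs 5 (by omega), h5]
      have hread : readMatrix s'.mem base N = G := by
        ext i j
        rw [readMatrix_eq, cellValue_eq, (hF.done i j i.2 j.2).1, (hF.done i j i.2 j.2).2, hfG]
      have hD := hO N G hG
      have hDle : ∀ (i j : Fin N) (x : ℤ), μ.O N G i j = (x : WithTop ℤ) → |x| ≤ μ.β := by
        intro i j x hx
        exact (APSP_solution_abs_le hG hB hD i j x hx).trans (by exact_mod_cast hNB)
      have hβW : (μ.β : ℤ) ≤ μ.W := by exact_mod_cast μ.le_W
      have hcall := Exec.call (O := μ.O) (W := μ.W) s' (.reg 5) (.reg 4) (.reg 4) N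
        (μ.fits hF.bounded (by decide)) (μ.fits hF.bounded (by decide))
        (μ.fits hF.bounded (by decide)) r5
        (by simp only [Expr.eval, r4]; rw [abs_of_nonneg h0]; push_cast; linarith)
        (by simp only [Expr.eval, r4]; rw [abs_of_nonneg h0]; push_cast; linarith)
        (by
          intro i j x hx
          simp only [Expr.eval, r4, hread] at hx
          exact (hDle i j x hx).trans hβW)
      refine ⟨_, _, _, hcall, ?_, ?_⟩
      · simp [Expr.cost]
      · simp only [Expr.eval, r4, hread]
        refine ⟨⟨hF.bounded.reg, writeMatrix_abs_le (by omega) hF.bounded.mem hDle⟩, hF.regs,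
          ⟨μ.O N G, hD, fun p q hp hq => ?_⟩, fun a ha => ?_⟩
        · rw [writeMatrix_apply _ _ _ hp hq, entry, dif_pos ⟨hp, hq⟩]
        · simp only [writeMatrix]
          rw [if_neg (by omega)]
          refine hF.same a fun p' q' _ _ _ => ?_
          have := cellAddr_ge base N p' q'
          constructor <;> omega
  case hT =>
    nlinarith

/-! ### Expressions -/

/-- `1` if the value is not `0`. -/
def Expr.nz (e : Expr) : Expr := .add (.lt e (.lit 0)) (.lt (.lit 0) e)

/-- `1` if the values are equal. -/
def Expr.eq (a b : Expr) : Expr := .sub (.sub (.lit 1) (.lt a b)) (.lt b a)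

/-- `1` if the second value is at most the first. -/
def Expr.ge (a b : Expr) : Expr := .sub (.lit 1) (.lt a b)

/-- The address of an entry. -/
def Expr.cell (base stride p q : Expr) : Expr :=
  .add base (.mul (.lit 2) (.add (.mul p stride) q))

theorem Expr.eval_nz (s : State) (e : Expr) : e.nz.eval s = if e.eval s = 0 then 0 else 1 := by
  simp only [Expr.nz, Expr.eval]
  split_ifs <;> omega

theorem Expr.eval_eq (s : State) (a b : Expr) :
    (Expr.eq a b).eval s = if a.eval s = b.eval s then 1 else 0 := by
  simp only [Expr.eq, Expr.eval]
  split_ifs <;> omega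

theorem Expr.eval_ge (s : State) (a b : Expr) :
    (Expr.ge a b).eval s = if b.eval s ≤ a.eval s then 1 else 0 := by
  simp only [Expr.ge, Expr.eval]
  split_ifs <;> omega

theorem Expr.eval_cell {s : State} {base stride p q : Expr} {b : ℤ} {n i j : ℕ}
    (hb : base.eval s = b) (hn : stride.eval s = n) (hi : p.eval s = i) (hj : q.eval s = j) :
    (Expr.cell base stride p q).eval s = cellAddr b n i j := by
  simp only [Expr.cell, Expr.eval, cellAddr, hb, hn, hi, hj]

/-- Whether the second of two extended integers, given by flags and values, is the smaller one. -/
def UseSecond (fa va fb vb : ℤ) : Prop := fb ≠ 0 ∧ (fa = 0 ∨ vb < va)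

instance (fa va fb vb : ℤ) : Decidable (UseSecond fa va fb vb) := by
  unfold UseSecond; infer_instance

/-- The test for `UseSecond`. -/
def Expr.useSecond (fa va fb vb : Expr) : Expr :=
  .mul fb.nz (.sub (.lit 1) (.mul fa.nz (.sub (.lit 1) (.lt vb va))))

/-- The flag of a minimum. -/
def Expr.minFlag (fa va fb vb : Expr) : Expr :=
  .add (.mul (.sub (.lit 1) (.useSecond fa va fb vb)) fa.nz) (.useSecond fa va fb vb)

/-- The value of a minimum. -/
def Expr.minVal (fa va fb vb : Expr) : Expr :=
  .add (.mul (.sub (.lit 1) (.useSecond fa va fb vb)) va) (.mul (.useSecond fa va fb vb) vb)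

theorem Expr.eval_useSecond (s : State) (fa va fb vb : Expr) :
    (Expr.useSecond fa va fb vb).eval s =
      if UseSecond (fa.eval s) (va.eval s) (fb.eval s) (vb.eval s) then 1 else 0 := by
  simp only [Expr.useSecond, Expr.eval, Expr.eval_nz, UseSecond]
  by_cases h1 : fb.eval s = 0 <;> by_cases h2 : fa.eval s = 0 <;>
    by_cases h3 : vb.eval s < va.eval s <;> simp [h1, h2, h3]

theorem Expr.eval_minFlag (s : State) (fa va fb vb : Expr) :
    (Expr.minFlag fa va fb vb).eval s =
      if UseSecond (fa.eval s) (va.eval s) (fb.eval s) (vb.eval s) ∨ fa.eval s ≠ 0 then 1 else 0 := by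
  simp only [Expr.minFlag, Expr.eval, Expr.eval_nz, Expr.eval_useSecond]
  by_cases h1 : UseSecond (fa.eval s) (va.eval s) (fb.eval s) (vb.eval s) <;>
    by_cases h2 : fa.eval s = 0 <;> simp [h1, h2]

theorem Expr.eval_minVal (s : State) (fa va fb vb : Expr) :
    (Expr.minVal fa va fb vb).eval s =
      if UseSecond (fa.eval s) (va.eval s) (fb.eval s) (vb.eval s) then vb.eval s
      else va.eval s := by
  simp only [Expr.minVal, Expr.eval, Expr.eval_useSecond]
  by_cases h1 : UseSecond (fa.eval s) (va.eval s) (fb.eval s) (vb.eval s) <;> simp [h1]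

theorem pairValue_min (fa va fb vb : ℤ) :
    pairValue (if UseSecond fa va fb vb ∨ fa ≠ 0 then 1 else 0)
      (if UseSecond fa va fb vb then vb else va) = min (pairValue fa va) (pairValue fb vb) := by
  unfold pairValue
  by_cases hb : fb = 0
  · by_cases ha : fa = 0 <;> simp [UseSecond, ha, hb]
  · by_cases ha : fa = 0
    · simp [UseSecond, ha, hb]
    · by_cases hv : vb < va
      · have : ((vb : ℤ) : WithTop ℤ) ≤ va := WithTop.coe_le_coe.2 hv.le
        simp [UseSecond, ha, hb, hv, this]
      · have : ((va : ℤ) : WithTop ℤ) ≤ vb := WithTop.coe_le_coe.2 (not_lt.1 hv)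
        simp [UseSecond, ha, hb, hv, this]

/-- Replace the entry at the address `a` by its minimum with the entry at the address `b`. -/
def minFill (a b : Expr) : Program :=
  fill (.minFlag (.load a) (.load (.add a (.lit 1))) (.load b) (.load (.add b (.lit 1))))
    (.minVal (.load a) (.load (.add a (.lit 1))) (.load b) (.load (.add b (.lit 1))))

/-- The effect of `minFill`. -/
structure MinFillPost (β : ℕ) (s : State) (base : ℤ) (stride N : ℕ) (x y : ℕ → ℕ → ℤ)
    (s' : State) : Prop where
  bounded : Bounded β s'
  regs : SameRegs s s'
  done : ∀ p q, p < N → q < N → cellValue s'.mem (cellAddr base stride p q) =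
    min (cellValue s.mem (x p q)) (cellValue s.mem (y p q))
  same : SameMem base stride N (fun _ _ => True) s.mem s'.mem

/-- The hypothesis `hval` asks that both source entries be intact when `(p, q)` is treated, even if
all other target entries have been overwritten. -/
theorem reaches_minFill {μ : Machine} {s : State} {base : ℤ} {stride N : ℕ} {x y : ℕ → ℕ → ℤ}
    {a b : Expr} (ha : a.degree ≤ 200) (hb : b.degree ≤ 200)
    (hs : Bounded μ.β s)
    (h4 : s.reg 4 = base) (h5 : s.reg 5 = N) (h10 : s.reg 10 = stride) (hN : N ≤ stride)
    (hNβ : N ≤ μ.β)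
    (hval : ∀ p q, p < N → q < N → ∀ s' : State, SameRegs s s' → s'.reg 6 = p → s'.reg 7 = q →
      SameMem base stride N (fun p' q' => ¬(p' = p ∧ q' = q)) s.mem s'.mem →
      a.eval s' = x p q ∧ b.eval s' = y p q ∧ s'.mem (x p q) = s.mem (x p q) ∧
      s'.mem (x p q + 1) = s.mem (x p q + 1) ∧ s'.mem (y p q) = s.mem (y p q) ∧
      s'.mem (y p q + 1) = s.mem (y p q + 1)) :
    Reaches μ (minFill a b) s (N * N * (20 * a.cost + 20 * b.cost + 200) + 8)
      (MinFillPost μ.β s base stride N x y) := by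
  have h1 : |(1 : ℤ)| ≤ μ.β := by
    have := μ.two_le
    rw [abs_one]; exact_mod_cast (by omega : 1 ≤ μ.β)
  have h0 : |(0 : ℤ)| ≤ μ.β := by simp
  unfold minFill
  refine Reaches.mono (reaches_fill
    (f := fun p q => if UseSecond (s.mem (x p q)) (s.mem (x p q + 1)) (s.mem (y p q))
      (s.mem (y p q + 1)) ∨ s.mem (x p q) ≠ 0 then 1 else 0)
    (v := fun p q => if UseSecond (s.mem (x p q)) (s.mem (x p q + 1)) (s.mem (y p q))
      (s.mem (y p q + 1)) then s.mem (y p q + 1) else s.mem (x p q + 1))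
    ?_ ?_ hs h4 h5 h10 hN hNβ ?_ ?_ ?_) ?_ ?_
  · simp only [Expr.minFlag, Expr.useSecond, Expr.nz, Expr.degree, degreeBound]
    norm_num; omega
  · simp only [Expr.minVal, Expr.useSecond, Expr.nz, Expr.degree, degreeBound]
    norm_num; omega
  · intro p q hp hq s' hR h6 h7 hsame
    obtain ⟨e1, e2, e3, e4, e5, e6⟩ := hval p q hp hq s' hR h6 h7 hsame
    simp only [Expr.eval_minFlag, Expr.eval_minVal, Expr.eval, e1, e2, e3, e4, e5, e6, and_self]
  · intro p q _ _
    split_ifs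
    · exact h1
    · exact h0
  · intro p q _ _
    split_ifs <;> exact hs.mem _
  · simp only [Expr.minFlag, Expr.minVal, Expr.useSecond, Expr.nz, Expr.cost]
    exact Nat.add_le_add_right (Nat.mul_le_mul_left _ (by omega)) _
  · intro s' h
    refine ⟨h.bounded, h.regs, fun p q hp hq => ?_, h.same⟩
    rw [cellValue_eq, (h.done p q hp hq).1, (h.done p q hp hq).2, pairValue_min]
    rfl

/-! ### The first phase of the program -/

/-- Set the registers `4`, `5` and `10`, then run `q`. -/
def setup (e₄ e₅ e₁₀ : Expr) (q : Program) : Program :=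
  .seq (.assign 4 e₄) (.seq (.assign 5 e₅) (.seq (.assign 10 e₁₀) q))

/-- The states agree but for the registers `4`, `5` and `10`. -/
def SameSetup (s s' : State) : Prop :=
  (∀ r, r ≠ 4 → r ≠ 5 → r ≠ 10 → s'.reg r = s.reg r) ∧ s'.mem = s.mem

theorem reaches_setup {μ : Machine} {s : State} {e₄ e₅ e₁₀ : Expr} {q : Program} {T : ℕ}
    {Post : State → Prop} {v₄ v₅ v₁₀ : ℤ} (hs : Bounded μ.β s) (h₄ : e₄.degree ≤ degreeBound)
    (h₅ : e₅.degree ≤ degreeBound) (h₁₀ : e₁₀.degree ≤ degreeBound)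
    (hv : ∀ s', SameSetup s s' → e₄.eval s' = v₄ ∧ e₅.eval s' = v₅ ∧ e₁₀.eval s' = v₁₀)
    (b₄ : |v₄| ≤ μ.β) (b₅ : |v₅| ≤ μ.β) (b₁₀ : |v₁₀| ≤ μ.β)
    (hq : ∀ s', Bounded μ.β s' → SameSetup s s' → s'.reg 4 = v₄ → s'.reg 5 = v₅ →
      s'.reg 10 = v₁₀ → Reaches μ q s' T Post) :
    Reaches μ (setup e₄ e₅ e₁₀ q) s (e₄.cost + e₅.cost + e₁₀.cost + 3 + T) Post := by
  have hB1 := hs.setReg (r := 4) b₄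
  have hB2 := hB1.setReg (r := 5) b₅
  have hB3 := hB2.setReg (r := 10) b₁₀
  refine Reaches.le_time (T := ?T) ?h ?hT
  case h =>
    refine .assign_seq hs h₄ (hv s ⟨fun _ _ _ _ => rfl, rfl⟩).1 (.assign_seq (v := v₅) hB1 h₅ ?_
      (.assign_seq (v := v₁₀) hB2 h₁₀ ?_ (hq _ hB3 ?_ ?_ ?_ ?_)))
    · exact (hv { s with reg := Function.update s.reg 4 v₄ }
        ⟨fun r h1 _ _ => by simp [h1], rfl⟩).2.1
    · exact (hv { s with reg := Function.update (Function.update s.reg 4 v₄) 5 v₅ }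
        ⟨fun r h1 h2 _ => by simp [h1, h2], rfl⟩).2.2
    · exact ⟨fun r h1 h2 h3 => by simp [h1, h2, h3], rfl⟩
    · simp
    · simp
    · simp
  case hT => omega

/-- The states agree in the registers that are not scratch registers. -/
def SameMain (s s' : State) : Prop :=
  ∀ r, r ≠ 4 → r ≠ 5 → r ≠ 6 → r ≠ 7 → r ≠ 8 → r ≠ 9 → r ≠ 10 → s'.reg r = s.reg r

theorem SameSetup.main {s s' s'' : State} (h : SameSetup s s') (h' : SameRegs s' s'') :
    SameMain s s'' := fun r h4 h5 h6 h7 h8 h9 h10 => by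
  rw [h' r (by omega), h.1 r h4 h5 h10]

/-- The matrices `X` and `w` are stored at the addresses `0` and `2 * n * n`, and register `0`
holds `n`. -/
structure Holds (n : ℕ) (w X : ℕ → ℕ → WithTop ℤ) (s : State) : Prop where
  size : s.reg 0 = n
  current : ∀ i j, i < n → j < n → cellValue s.mem (cellAddr 0 n i j) = X i j
  weight : ∀ i j, i < n → j < n → cellValue s.mem (cellAddr (2 * n * n) n i j) = w i j

theorem cellAddr_lt (base : ℤ) {n i j : ℕ} (hi : i < n) (hj : j < n) :
    cellAddr base n i j + 1 < base + 2 * n * n := by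
  have := index_lt hi hj
  unfold cellAddr
  linarith

theorem Holds.congr {n : ℕ} {w X : ℕ → ℕ → WithTop ℤ} {s s' : State} (h : Holds n w X s)
    (h0 : s'.reg 0 = s.reg 0) (hm : ∀ a : ℤ, 0 ≤ a → a < 4 * n * n → s'.mem a = s.mem a) :
    Holds n w X s' := by
  have hn : (0 : ℤ) ≤ n * n := by positivity
  refine ⟨h0.trans h.size, fun i j hi hj => ?_, fun i j hi hj => ?_⟩
  · have h1 := cellAddr_ge 0 n i j
    have h2 := cellAddr_lt 0 hi hj
    rw [← h.current i j hi hj, cellValue, cellValue, hm _ (by linarith) (by linarith),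
      hm _ (by linarith) (by linarith)]
  · have h1 := cellAddr_ge (2 * n * n) n i j
    have h2 := cellAddr_lt (2 * n * n) hi hj
    rw [← h.weight i j hi hj, cellValue, cellValue, hm _ (by linarith) (by linarith),
      hm _ (by linarith) (by linarith)]

/-- `c * n * n`. -/
def Expr.region (c : ℤ) : Expr := .mul (.mul (.lit c) (.reg 0)) (.reg 0)

theorem Expr.eval_region {s : State} {n : ℕ} (h : s.reg 0 = n) (c : ℤ) :
    (Expr.region c).eval s = c * n * n := by simp [Expr.region, Expr.eval, h]

/-- The address of the entry `(p, q)` of the current matrix. -/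
def currentCell : Expr := .cell (.lit 0) (.reg 0) (.reg 6) (.reg 7)

/-- Copy the input to `2 * n * n`, with zeros on the diagonal. -/
def copyPhase : Program :=
  setup (.region 2) (.reg 0) (.reg 0) (fill
    (.add (.eq (.reg 6) (.reg 7)) (.mul (.sub (.lit 1) (.eq (.reg 6) (.reg 7)))
      (.load currentCell)))
    (.mul (.sub (.lit 1) (.eq (.reg 6) (.reg 7))) (.load (.add currentCell (.lit 1)))))

theorem reaches_copyPhase {μ : Machine} {n : ℕ} {G : WMatrix n} {s : State}
    (hs : Bounded μ.β s) (h0 : s.reg 0 = n) (hβ : 40 * (n * n) ≤ μ.β)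
    (hG : ∀ i j, i < n → j < n → cellValue s.mem (cellAddr 0 n i j) = entry G i j) :
    Reaches μ copyPhase s (200 * (n * n) + 40) (fun s' => Bounded μ.β s' ∧ SameMain s s' ∧
      Holds n (entry (adjacencyMatrix G)) (entry G) s' ∧ ∀ a : ℤ, a < 0 → s'.mem a = s.mem a) := by
  have hnn : n ≤ n * n := Nat.le_mul_self n
  have hnβ : n ≤ μ.β := by omega
  have hn2 : |(2 * n * n : ℤ)| ≤ μ.β := by
    rw [abs_of_nonneg (by positivity)]
    have : 2 * n * n ≤ μ.β := by nlinarith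
    exact_mod_cast this
  have hn1 : |(n : ℤ)| ≤ μ.β := by rw [Nat.abs_cast]; exact_mod_cast hnβ
  have hpos : (0 : ℤ) ≤ n * n := by positivity
  refine Reaches.le_time (T := ?T) ?h ?hT
  case h =>
    refine reaches_setup (T := 180 * (n * n) + 20) (v₄ := 2 * n * n) (v₅ := n) (v₁₀ := n) hs ?_ ?_ ?_ ?_ hn2 hn1 hn1 ?_
    · decide
    · decide
    · decide
    · intro s' h
      have : s'.reg 0 = n := by rw [h.1 0 (by omega) (by omega) (by omega), h0]
      exact ⟨Expr.eval_region this 2, this, this⟩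
    intro s₁ hB hS r4 r5 r10
    have r0 : s₁.reg 0 = n := by rw [hS.1 0 (by omega) (by omega) (by omega), h0]
    refine Reaches.mono (reaches_fill
      (f := fun p q => if p = q then 1 else s₁.mem (cellAddr 0 n p q))
      (v := fun p q => if p = q then 0 else s₁.mem (cellAddr 0 n p q + 1))
      ?_ ?_ hB r4 r5 r10 le_rfl hnβ ?_ ?_ ?_) ?_ ?_
    · decide
    · decide
    · intro p q hp hq s' hR h6 h7 hsame
      have e0 : s'.reg 0 = n := by rw [hR 0 (by omega), r0]
      have ec : currentCell.eval s' = cellAddr 0 n p q :=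
        Expr.eval_cell rfl e0 h6 h7
      have hlt := cellAddr_lt 0 hp hq
      -- The copy is written above the input, so reading is not disturbed.
      have hm : ∀ a : ℤ, a < 2 * n * n → s'.mem a = s₁.mem a := fun a ha =>
        hsame a fun p' q' _ _ _ => by
          have := cellAddr_ge (2 * n * n) n p' q'
          constructor <;> omega
      simp only [Expr.eval, Expr.eval_eq, ec, h6, h7, hm _ (show cellAddr 0 n p q < 2 * n * n by
        linarith), hm _ (show cellAddr 0 n p q + 1 < 2 * n * n by linarith)]
      by_cases hpq : p = q <;> simp [hpq]
    · intro p q _ _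
      split_ifs
      · have := μ.two_le
        rw [abs_one]; exact_mod_cast (by omega : 1 ≤ μ.β)
      · exact hB.mem _
    · intro p q _ _
      split_ifs
      · simp
      · exact hB.mem _
    · simp only [currentCell, Expr.eq, Expr.cell, Expr.cost]
      ring_nf
      omega
    · intro s' h
      have hm : ∀ a : ℤ, a < 2 * n * n → s'.mem a = s₁.mem a := fun a ha =>
        h.same a fun p' q' _ _ _ => by
          have := cellAddr_ge (2 * n * n) n p' q'
          constructor <;> omega
      refine ⟨h.bounded, hS.main h.regs, ⟨?_, fun i j hi hj => ?_, fun i j hi hj => ?_⟩,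
        fun a ha => ?_⟩
      · rw [h.regs 0 (by omega), r0]
      · have hlt := cellAddr_lt 0 hi hj
        rw [cellValue, hm _ (by linarith), hm _ (by linarith), hS.2]
        exact hG i j hi hj
      · rw [cellValue_eq, (h.done i j hi hj).1, (h.done i j hi hj).2, entry, dif_pos ⟨hi, hj⟩,
          adjacencyMatrix]
        by_cases hij : i = j
        · simp [hij, pairValue]
        · simp only [hij, if_false, Fin.mk.injEq]
          rw [hS.2]
          have := hG i j hi hj
          rwa [entry, dif_pos ⟨hi, hj⟩] at this
      · rw [hm a (by linarith), hS.2]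
  case hT =>
    simp only [Expr.region, Expr.cost]
    omega

/-- The block of a node in the first query. -/
def peakBlockExpr (p : Expr) : Expr := .add (.ge p (.reg 0)) (.ge p (.mul (.lit 2) (.reg 0)))

/-- The row of a node in the first query. -/
def peakRowExpr (p : Expr) : Expr := .sub p (.mul (.reg 0) (peakBlockExpr p))

theorem eval_peakBlockExpr {s : State} {n p : ℕ} {e : Expr} (h0 : s.reg 0 = n)
    (hp : e.eval s = p) : (peakBlockExpr e).eval s = peakBlock n p := by
  simp only [peakBlockExpr, Expr.eval, Expr.eval_ge, hp, h0, peakBlock]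
  split_ifs <;> omega

theorem eval_peakRowExpr {s : State} {n p : ℕ} {e : Expr} (h0 : s.reg 0 = n)
    (hp : e.eval s = p) : (peakRowExpr e).eval s = peakRow n p := by
  have h := eval_peakBlockExpr h0 hp
  simp only [peakRowExpr, Expr.eval, h, hp, h0]
  unfold peakBlock peakRow
  split_ifs <;> push_cast <;> omega

/-- The test for an edge of the first query. -/
def peakTest : Expr :=
  .add (.mul (.mul (.eq (peakBlockExpr (.reg 6)) (.lit 0)) (.eq (peakBlockExpr (.reg 7)) (.lit 1)))
      (.lt (peakRowExpr (.reg 6)) (peakRowExpr (.reg 7))))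
    (.mul (.mul (.eq (peakBlockExpr (.reg 6)) (.lit 1)) (.eq (peakBlockExpr (.reg 7)) (.lit 2)))
      (.lt (peakRowExpr (.reg 7)) (peakRowExpr (.reg 6))))

theorem eval_peakTest {s : State} {n p q : ℕ} (h0 : s.reg 0 = n) (h6 : s.reg 6 = p)
    (h7 : s.reg 7 = q) : peakTest.eval s =
      if (peakBlock n p = 0 ∧ peakBlock n q = 1 ∧ peakRow n p < peakRow n q) ∨
        (peakBlock n p = 1 ∧ peakBlock n q = 2 ∧ peakRow n q < peakRow n p) then 1 else 0 := by
  have e1 := eval_peakBlockExpr (e := .reg 6) h0 h6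
  have e2 := eval_peakBlockExpr (e := .reg 7) h0 h7
  have e3 := eval_peakRowExpr (e := .reg 6) h0 h6
  have e4 := eval_peakRowExpr (e := .reg 7) h0 h7
  simp only [peakTest, Expr.eval, Expr.eval_eq, e1, e2, e3, e4]
  have c0 : ∀ x : ℕ, ((x : ℤ) = 0) = (x = 0) := fun x => by simp
  have c1 : ∀ x : ℕ, ((x : ℤ) = 1) = (x = 1) := fun x => by simp
  have c2 : ∀ x : ℕ, ((x : ℤ) = 2) = (x = 2) := fun x => by norm_cast
  simp only [c0, c1, c2, Nat.cast_lt]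
  split_ifs <;> omega

/-- The address of the weight between the rows of two nodes of the first query. -/
def peakCell : Expr :=
  .cell (.region 2) (.reg 0) (peakRowExpr (.reg 6)) (peakRowExpr (.reg 7))

/-- The first query. -/
def peakPhase : Program :=
  setup (.region 4) (.mul (.lit 3) (.reg 0)) (.mul (.lit 3) (.reg 0))
    (query (.mul peakTest (.load peakCell)) (.mul peakTest (.load (.add peakCell (.lit 1)))))

theorem reaches_peakPhase {μ : Machine} (hO : μ.O.Solves APSP) {n M : ℕ}
    {w X : ℕ → ℕ → WithTop ℤ} {s : State} (hs : Bounded μ.β s) (h : Holds n w X s)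
    (hβ : 40 * (n * n) * (M + 1) ≤ μ.β)
    (hw : ∀ i j (x : ℤ), w i j = x → |x| ≤ M) :
    Reaches μ peakPhase s (10000 * (n * n) + 100) (fun s' => Bounded μ.β s' ∧ SameMain s s' ∧
      (∃ D : WMatrix (3 * n), APSP.IsSolution (peakGraph n w) D ∧ ∀ p q, p < 3 * n → q < 3 * n →
        cellValue s'.mem (cellAddr (4 * n * n) (3 * n) p q) = entry D p q) ∧
      ∀ a : ℤ, a < 4 * n * n → s'.mem a = s.mem a) := by
  have hnn : n ≤ n * n := Nat.le_mul_self n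
  have hnM : n * n ≤ n * n * (M + 1) := Nat.le_mul_of_pos_right _ (by omega)
  have hn4 : |(4 * n * n : ℤ)| ≤ μ.β := by
    rw [abs_of_nonneg (by positivity)]
    have : 4 * n * n ≤ μ.β := by nlinarith
    exact_mod_cast this
  have hn3 : |((3 * n : ℕ) : ℤ)| ≤ (μ.β : ℤ) := by
    rw [Nat.abs_cast]
    have : 3 * n ≤ μ.β := by nlinarith
    exact_mod_cast this
  have hpos : (0 : ℤ) ≤ n * n := by positivity
  refine Reaches.le_time (T := ?T) ?h ?hT
  case h =>
    refine reaches_setup (T := 9000 * (n * n) + 40) (v₄ := 4 * n * n) (v₅ := (3 * n : ℕ)) (v₁₀ := (3 * n : ℕ)) hs ?_ ?_ ?_ ?_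
      hn4 hn3 hn3 ?_
    · decide
    · decide
    · decide
    · intro s' hS
      have : s'.reg 0 = n := by rw [hS.1 0 (by omega) (by omega) (by omega), h.size]
      exact ⟨Expr.eval_region this 4, by simp [Expr.eval, this], by simp [Expr.eval, this]⟩
    intro s₁ hB hS r4 r5 r10
    have r0 : s₁.reg 0 = n := by rw [hS.1 0 (by omega) (by omega) (by omega), h.size]
    have hH : Holds n w X s₁ := h.congr (hS.1 0 (by omega) (by omega) (by omega))
      (fun a _ _ => by rw [hS.2])
    refine Reaches.mono (reaches_query hO (B := M)
      (f := fun p q => if (peakBlock n p = 0 ∧ peakBlock n q = 1 ∧ peakRow n p < peakRow n q) ∨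
        (peakBlock n p = 1 ∧ peakBlock n q = 2 ∧ peakRow n q < peakRow n p) then
        s₁.mem (cellAddr (2 * n * n) n (peakRow n p) (peakRow n q)) else 0)
      (v := fun p q => if (peakBlock n p = 0 ∧ peakBlock n q = 1 ∧ peakRow n p < peakRow n q) ∨
        (peakBlock n p = 1 ∧ peakBlock n q = 2 ∧ peakRow n q < peakRow n p) then
        s₁.mem (cellAddr (2 * n * n) n (peakRow n p) (peakRow n q) + 1) else 0)
      ?_ ?_ hB (by linarith) r4 r5 r10 ?_ ?_ ?_ ?_ (peakGraph_noNegativeCycle n w) ?_ ?_ ?_) ?_ ?_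
    · decide
    · decide
    · push_cast
      have : 4 * n * n + 2 * (3 * n * (3 * n)) ≤ μ.β := by nlinarith
      exact_mod_cast this
    · intro p q hp hq s' hR h6 h7 hm
      have e0 : s'.reg 0 = n := by rw [hR 0 (by omega), r0]
      have ec : peakCell.eval s' = cellAddr (2 * n * n) n (peakRow n p) (peakRow n q) :=
        Expr.eval_cell (Expr.eval_region e0 2) e0 (eval_peakRowExpr e0 h6) (eval_peakRowExpr e0 h7)
      have hlt := cellAddr_lt (2 * n * n) (peakRow_lt hp) (peakRow_lt hq)
      simp only [Expr.eval, eval_peakTest e0 h6 h7, ec]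
      rw [hm _ (by linarith), hm _ (by linarith)]
      split_ifs <;> simp
    · intro p q _ _
      split_ifs
      · exact hB.mem _
      · simp
    · intro p q _ _
      split_ifs
      · exact hB.mem _
      · simp
    · intro p q
      rw [peakGraph, peakEdge]
      split_ifs
      · rw [← hH.weight _ _ (peakRow_lt p.2) (peakRow_lt q.2)]; rfl
      · simp [pairValue]
    · intro p q x hx
      rw [peakGraph, peakEdge] at hx
      split_ifs at hx
      · exact hw _ _ x hx
      · exact absurd hx WithTop.top_ne_coe
    · nlinarith
    · simp only [Expr.region, peakTest, peakCell, peakRowExpr, peakBlockExpr, Expr.ge, Expr.eq,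
        Expr.cell, Expr.cost]
      ring_nf
      omega
    · intro s' hQ
      refine ⟨hQ.bounded, hS.main hQ.regs, hQ.answer, fun a ha => ?_⟩
      rw [hQ.same a ha, hS.2]
  case hT =>
    simp only [Expr.region, Expr.cost]
    omega

/-- The address of the answer of the first query that is used for the entry `(p, q)`. -/
def peakAnswerCell : Expr :=
  .cell (.region 4) (.mul (.lit 3) (.reg 0)) (.reg 6) (.add (.mul (.lit 2) (.reg 0)) (.reg 7))

/-- Use the answer of the first query. -/
def peakUpdate : Program :=
  setup (.lit 0) (.reg 0) (.reg 0)
    (minFill (.cell (.region 2) (.reg 0) (.reg 6) (.reg 7)) peakAnswerCell)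

theorem reaches_peakUpdate {μ : Machine} {n : ℕ}
    {w X : ℕ → ℕ → WithTop ℤ} {s : State} (hs : Bounded μ.β s) (h : Holds n w X s)
    (hβ : 40 * (n * n) ≤ μ.β)
    {D : WMatrix (3 * n)} (hD : APSP.IsSolution (peakGraph n w) D)
    (hcell : ∀ p q, p < 3 * n → q < 3 * n →
      cellValue s.mem (cellAddr (4 * n * n) (3 * n) p q) = entry D p q) :
    Reaches μ peakUpdate s (2000 * (n * n) + 100) (fun s' => Bounded μ.β s' ∧ SameMain s s' ∧
      Holds n w (peakValue n w) s' ∧ ∀ a : ℤ, a < 0 → s'.mem a = s.mem a) := by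
  have hnn : n ≤ n * n := Nat.le_mul_self n
  have hnβ : n ≤ μ.β := by omega
  have hn1 : |(n : ℤ)| ≤ μ.β := by rw [Nat.abs_cast]; exact_mod_cast hnβ
  have hpos : (0 : ℤ) ≤ n * n := by positivity
  refine Reaches.le_time (T := ?T) ?h ?hT
  case h =>
    refine reaches_setup (T := 1900 * (n * n) + 40) (v₄ := 0) (v₅ := n) (v₁₀ := n) hs ?_ ?_ ?_ ?_ ?_ hn1 hn1 ?_
    · decide
    · decide
    · decide
    · intro s' hS
      have : s'.reg 0 = n := by rw [hS.1 0 (by omega) (by omega) (by omega), h.size]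
      exact ⟨rfl, this, this⟩
    · simp
    intro s₁ hB hS r4 r5 r10
    have r0 : s₁.reg 0 = n := by rw [hS.1 0 (by omega) (by omega) (by omega), h.size]
    have hout : ∀ (m' : ℤ → ℤ) (C : ℕ → ℕ → Prop), SameMem 0 n n C s₁.mem m' →
        ∀ a : ℤ, (a < 0 ∨ 2 * n * n ≤ a) → m' a = s₁.mem a := by
      intro m' C hC a ha
      refine hC a fun p q hp hq _ => ?_
      have h1 := cellAddr_ge 0 n p q
      have h2 := cellAddr_lt 0 hp hq
      constructor <;> omega
    refine Reaches.mono (reaches_minFill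
      (x := fun p q => cellAddr (2 * n * n) n p q)
      (y := fun p q => cellAddr (4 * n * n) (3 * n) p (2 * n + q))
      ?_ ?_ hB r4 r5 r10 le_rfl hnβ ?_) ?_ ?_
    · decide
    · decide
    · intro p q hp hq s' hR h6 h7 hsame
      have e0 : s'.reg 0 = n := by rw [hR 0 (by omega), r0]
      have hm := hout _ _ hsame
      have h1 := cellAddr_ge (2 * n * n) n p q
      have h2 := cellAddr_ge (4 * n * n) (3 * n) p (2 * n + q)
      refine ⟨Expr.eval_cell (Expr.eval_region e0 2) e0 h6 h7,
        Expr.eval_cell (Expr.eval_region e0 4) (by simp [Expr.eval, e0]) h6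
          (by simp [Expr.eval, e0, h7]), hm _ (.inr h1), hm _ (.inr (by linarith)),
        hm _ (.inr (by linarith)), hm _ (.inr (by linarith))⟩
    · simp only [Expr.region, peakAnswerCell, Expr.cell, Expr.cost]
      ring_nf
      omega
    · intro s' hQ
      have hm := hout _ _ hQ.same
      refine ⟨hQ.bounded, hS.main hQ.regs, ⟨?_, fun i j hi hj => ?_, fun i j hi hj => ?_⟩,
        fun a ha => ?_⟩
      · rw [hQ.regs 0 (by omega), r0]
      · rw [hQ.done i j hi hj, hS.2, h.weight i j hi hj,
          hcell i (2 * n + j) (by omega) (by omega), peak_answer_eq hD hi hj]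
      · have h1 := cellAddr_ge (2 * n * n) n i j
        rw [cellValue, hm _ (.inr h1), hm _ (.inr (by linarith)), hS.2]
        exact h.weight i j hi hj
      · rw [hm a (.inl ha), hS.2]
  case hT =>
    simp only [Expr.cost]
    omega

/-! ### A panel step of the program

The registers `0`, `2`, `3` and `11` hold `n`, the number of solved rows of the block, its first row
and its width. -/

/-- Whether an edge of the panel graph carries an entry of a matrix. -/
def PanelEntry (a x b y : ℕ) : Prop :=
  (((a = 0 ∧ b ≤ 1) ∨ (a = 2 ∧ b = 2)) ∧ y < x) ∨ (((a = 1 ∧ b = 1) ∨ (2 ≤ a ∧ b = 3)) ∧ x < y)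

/-- Whether this matrix is the input. -/
def PanelWeight (a b : ℕ) : Prop := (a = 0 ∧ b = 0) ∨ (a = 3 ∧ b = 3)

/-- Whether it is an edge of weight `0` between two blocks. -/
def PanelJoin (a x b y : ℕ) : Prop := a = 1 ∧ b = 2 ∧ x = y

instance (a x b y : ℕ) : Decidable (PanelEntry a x b y) := by unfold PanelEntry; infer_instance
instance (a b : ℕ) : Decidable (PanelWeight a b) := by unfold PanelWeight; infer_instance
instance (a x b y : ℕ) : Decidable (PanelJoin a x b y) := by unfold PanelJoin; infer_instance

theorem panelEdge_eq (w X : ℕ → ℕ → WithTop ℤ) (a x b y : ℕ) : panelEdge w X a x b y =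
    if PanelEntry a x b y then (if PanelWeight a b then w x y else X x y)
    else if PanelJoin a x b y then 0 else ⊤ := rfl

/-- The test for `PanelEntry`. -/
def panelEntryExpr (a x b y : Expr) : Expr :=
  .add (.mul (.add (.mul (.eq a (.lit 0)) (.lt b (.lit 2)))
      (.mul (.eq a (.lit 2)) (.eq b (.lit 2)))) (.lt y x))
    (.mul (.add (.mul (.eq a (.lit 1)) (.eq b (.lit 1)))
      (.mul (.lt (.lit 1) a) (.eq b (.lit 3)))) (.lt x y))

/-- The test for `PanelWeight`. -/
def panelWeightExpr (a b : Expr) : Expr :=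
  .add (.mul (.eq a (.lit 0)) (.eq b (.lit 0))) (.mul (.eq a (.lit 3)) (.eq b (.lit 3)))

/-- The test for `PanelJoin`. -/
def panelJoinExpr (a x b y : Expr) : Expr :=
  .mul (.mul (.eq a (.lit 1)) (.eq b (.lit 2))) (.eq x y)

theorem cast_eq_lit (x : ℕ) : ((x : ℤ) = 0) = (x = 0) ∧ ((x : ℤ) = 1) = (x = 1) ∧
    ((x : ℤ) = 2) = (x = 2) ∧ ((x : ℤ) = 3) = (x = 3) ∧ ((x : ℤ) < 2) = (x ≤ 1) ∧
    (1 < (x : ℤ)) = (2 ≤ x) := by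
  refine ⟨?_, ?_, ?_, ?_, ?_, ?_⟩ <;> exact propext (by omega)

theorem indicator_mul (p q : Prop) [Decidable p] [Decidable q] :
    (if p then (1 : ℤ) else 0) * (if q then 1 else 0) = if p ∧ q then 1 else 0 := by
  by_cases hp : p <;> by_cases hq : q <;> simp [hp, hq]

theorem indicator_add {p q : Prop} [Decidable p] [Decidable q] (h : ¬(p ∧ q)) :
    (if p then (1 : ℤ) else 0) + (if q then 1 else 0) = if p ∨ q then 1 else 0 := by
  by_cases hp : p <;> by_cases hq : q <;> simp_all

theorem eval_panelEntryExpr {s : State} {a x b y : ℕ} {ea ex eb ey : Expr} (ha : ea.eval s = a)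
    (hx : ex.eval s = x) (hb : eb.eval s = b) (hy : ey.eval s = y) :
    (panelEntryExpr ea ex eb ey).eval s = if PanelEntry a x b y then 1 else 0 := by
  obtain ⟨a0, a1, a2, -, -, a5⟩ := cast_eq_lit a
  obtain ⟨-, b1, b2, b3, b4, -⟩ := cast_eq_lit b
  simp only [panelEntryExpr, Expr.eval, Expr.eval_eq, ha, hb, hx, hy, a0, a1, a2, a5, b1, b2,
    b3, b4, Nat.cast_lt, PanelEntry, indicator_mul]
  rw [indicator_add (by omega), indicator_add (by omega), indicator_mul, indicator_mul,
    indicator_add (by omega)]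

theorem eval_panelJoinExpr {s : State} {a x b y : ℕ} {ea ex eb ey : Expr} (ha : ea.eval s = a)
    (hx : ex.eval s = x) (hb : eb.eval s = b) (hy : ey.eval s = y) :
    (panelJoinExpr ea ex eb ey).eval s = if PanelJoin a x b y then 1 else 0 := by
  obtain ⟨-, a1, -, -, -, -⟩ := cast_eq_lit a
  obtain ⟨-, -, b2, -, -, -⟩ := cast_eq_lit b
  simp only [panelJoinExpr, Expr.eval, Expr.eval_eq, ha, hb, hx, hy, a1, b2, Nat.cast_inj,
    PanelJoin, indicator_mul, and_assoc]

theorem eval_panelWeightExpr {s : State} {a b : ℕ} {ea eb : Expr} (ha : ea.eval s = a)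
    (hb : eb.eval s = b) :
    (panelWeightExpr ea eb).eval s = if PanelWeight a b then 1 else 0 := by
  obtain ⟨a0, -, -, a3, -, -⟩ := cast_eq_lit a
  obtain ⟨b0, -, -, b3, -, -⟩ := cast_eq_lit b
  simp only [panelWeightExpr, Expr.eval, Expr.eval_eq, ha, hb, a0, a3, b0, b3, PanelWeight,
    indicator_mul]
  rw [indicator_add (by omega)]

/-- The block of a node of the panel graph. -/
def panelBlockExpr (p : Expr) : Expr :=
  .add (.add (.ge p (.reg 11)) (.ge p (.add (.reg 11) (.reg 2))))
    (.ge p (.add (.reg 11) (.mul (.lit 2) (.reg 2))))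

/-- The row of a node of the panel graph. -/
def panelRowExpr (p : Expr) : Expr :=
  .sub (.add (.reg 3) p) (.add (.add (.mul (.ge p (.reg 11)) (.reg 11))
    (.mul (.ge p (.add (.reg 11) (.reg 2))) (.reg 2)))
    (.mul (.ge p (.add (.reg 11) (.mul (.lit 2) (.reg 2)))) (.reg 2)))

theorem eval_panelBlockExpr {s : State} {w m p : ℕ} {e : Expr} (h2 : s.reg 2 = w)
    (h11 : s.reg 11 = m) (hp : e.eval s = p) :
    (panelBlockExpr e).eval s = panelBlock w m p := by
  simp only [panelBlockExpr, Expr.eval, Expr.eval_ge, hp, h2, h11, panelBlock]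
  split_ifs <;> omega

theorem eval_panelRowExpr {s : State} {w lo m p : ℕ} {e : Expr} (h2 : s.reg 2 = w)
    (h3 : s.reg 3 = lo) (h11 : s.reg 11 = m) (hp : e.eval s = p) :
    (panelRowExpr e).eval s = panelRow lo w m p := by
  simp only [panelRowExpr, Expr.eval, Expr.eval_ge, hp, h2, h3, h11, panelRow]
  split_ifs <;> omega

/-- The test `PanelEntry` for the nodes in the registers `6` and `7`. -/
def panelTest : Expr := panelEntryExpr (panelBlockExpr (.reg 6)) (panelRowExpr (.reg 6))
  (panelBlockExpr (.reg 7)) (panelRowExpr (.reg 7))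

/-- The address of the matrix entry for the nodes in the registers `6` and `7`. -/
def panelCell : Expr :=
  .cell (.mul (panelWeightExpr (panelBlockExpr (.reg 6)) (panelBlockExpr (.reg 7))) (.region 2))
    (.reg 0) (panelRowExpr (.reg 6)) (panelRowExpr (.reg 7))

/-- The flag of the edge of the panel graph between the nodes in the registers `6` and `7`. -/
def panelFlag : Expr := .add (.mul panelTest (.load panelCell))
  (panelJoinExpr (panelBlockExpr (.reg 6)) (panelRowExpr (.reg 6)) (panelBlockExpr (.reg 7))
    (panelRowExpr (.reg 7)))

/-- Its value. -/
def panelVal : Expr := .mul panelTest (.load (.add panelCell (.lit 1)))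

/-- The query of a panel step. -/
def panelQuery : Program :=
  setup (.region 4) (.mul (.lit 2) (.add (.reg 11) (.reg 2)))
    (.mul (.lit 2) (.add (.reg 11) (.reg 2))) (query panelFlag panelVal)

/-- The registers used by a panel step. -/
structure PanelRegs (w lo m : ℕ) (s : State) : Prop where
  solved : s.reg 2 = w
  first : s.reg 3 = lo
  width : s.reg 11 = m

theorem PanelRegs.congr {w lo m : ℕ} {s s' : State} (h : PanelRegs w lo m s) (h' : SameMain s s') :
    PanelRegs w lo m s' where
  solved := by rw [h' 2 (by omega) (by omega) (by omega) (by omega) (by omega) (by omega) (by omega),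
    h.solved]
  first := by rw [h' 3 (by omega) (by omega) (by omega) (by omega) (by omega) (by omega) (by omega),
    h.first]
  width := by rw [h' 11 (by omega) (by omega) (by omega) (by omega) (by omega) (by omega) (by omega),
    h.width]

theorem SameSetup.sameMain {s s' : State} (h : SameSetup s s') : SameMain s s' :=
  h.main fun _ _ => rfl

theorem SameRegs.sameMain {s s' : State} (h : SameRegs s s') : SameMain s s' :=
  fun r _ _ h6 h7 h8 h9 _ => h r (by omega)

theorem SameMain.size {s s' : State} (h : SameMain s s') : s'.reg 0 = s.reg 0 :=
  h 0 (by omega) (by omega) (by omega) (by omega) (by omega) (by omega) (by omega)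

theorem reaches_panelQuery {μ : Machine} (hO : μ.O.Solves APSP) {n M σ lo m : ℕ}
    {w X : ℕ → ℕ → WithTop ℤ} {s : State} (hs : Bounded μ.β s) (h : Holds n w X s)
    (hP : PanelRegs σ lo m s) (hσ : 1 ≤ σ) (hσm : σ ≤ m) (hmσ : m ≤ 2 * σ) (hlo : lo + m ≤ n)
    (hβ : 40 * (n * n) * (M + 1) ≤ μ.β)
    (hw : ∀ i j (x : ℤ), w i j = x → |x| ≤ M)
    (hX : ∀ i j (x : ℤ), i < n → j < n → X i j = x → |x| ≤ 6 * M * n) :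
    Reaches μ panelQuery s (200000 * (σ * σ)) (fun s' => Bounded μ.β s' ∧ SameMain s s' ∧
      (∃ D : WMatrix (2 * m + 2 * σ), APSP.IsSolution (panelGraph w X lo σ m) D ∧
        ∀ p q, p < 2 * m + 2 * σ → q < 2 * m + 2 * σ →
        cellValue s'.mem (cellAddr (4 * n * n) (2 * m + 2 * σ) p q) = entry D p q) ∧
      ∀ a : ℤ, a < 4 * n * n → s'.mem a = s.mem a) := by
  have hnn : n ≤ n * n := Nat.le_mul_self n
  have hnM : n * n ≤ n * n * (M + 1) := Nat.le_mul_of_pos_right _ (by omega)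
  have hn4 : |(4 * n * n : ℤ)| ≤ μ.β := by
    rw [abs_of_nonneg (by positivity)]
    have : 4 * n * n ≤ μ.β := by nlinarith
    exact_mod_cast this
  -- The first bound keeps addresses and weights small; the second makes the cost proportional to `σ
  -- * σ`, independently of `n`.
  have hN4 : 2 * m + 2 * σ ≤ 4 * n := by omega
  have hN6 : 2 * m + 2 * σ ≤ 6 * σ := by omega
  have hn3 : |((2 * m + 2 * σ : ℕ) : ℤ)| ≤ (μ.β : ℤ) := by
    rw [Nat.abs_cast]
    have : 2 * m + 2 * σ ≤ μ.β := by nlinarith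
    exact_mod_cast this
  have hpos : (0 : ℤ) ≤ n * n := by positivity
  have h4pos : (0 : ℤ) ≤ 4 * n * n := by positivity
  have hσσ : 1 ≤ σ * σ := Nat.mul_pos hσ hσ
  refine Reaches.le_time (T := ?T) ?h ?hT
  case h =>
    refine reaches_setup (T := 190000 * (σ * σ)) (v₄ := 4 * n * n) (v₅ := (2 * m + 2 * σ : ℕ))
      (v₁₀ := (2 * m + 2 * σ : ℕ)) hs ?_ ?_ ?_ ?_ hn4 hn3 hn3 ?_
    · decide
    · decide
    · decide
    · intro s' hS
      have h0 : s'.reg 0 = n := by rw [hS.sameMain.size, h.size]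
      obtain ⟨h2, -, h11⟩ := hP.congr hS.sameMain
      have e : 2 * ((m : ℤ) + σ) = (2 * m + 2 * σ : ℕ) := by push_cast; ring
      exact ⟨Expr.eval_region h0 4, by simp only [Expr.eval, h2, h11, e],
        by simp only [Expr.eval, h2, h11, e]⟩
    intro s₁ hB hS r4 r5 r10
    have r0 : s₁.reg 0 = n := by rw [hS.sameMain.size, h.size]
    have hH : Holds n w X s₁ := h.congr hS.sameMain.size (fun a _ _ => by rw [hS.2])
    have hP₁ := hP.congr hS.sameMain
    have hrow : ∀ p < 2 * m + 2 * σ, panelRow lo σ m p < n := fun p hp =>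
      (panelRow_lt hp hσm).trans_le hlo
    refine Reaches.mono (reaches_query hO (G := panelGraph w X lo σ m) (B := 6 * M * n)
      (f := fun p q =>
        -- The factor from `PanelWeight` selects the base address without branching: `0` for the
        -- current matrix, `2 * n * n` for the weights. A zero edge has flag `1` and, through the
        -- missing second summand in `v`, value `0`.
        (if PanelEntry (panelBlock σ m p) (panelRow lo σ m p) (panelBlock σ m q) (panelRow lo σ m q)
          then 1 else 0) * s₁.mem (cellAddr ((if PanelWeight (panelBlock σ m p) (panelBlock σ m q)
          then 1 else 0) * (2 * n * n)) n (panelRow lo σ m p) (panelRow lo σ m q)) +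
        (if PanelJoin (panelBlock σ m p) (panelRow lo σ m p) (panelBlock σ m q) (panelRow lo σ m q)
          then 1 else 0))
      (v := fun p q =>
        (if PanelEntry (panelBlock σ m p) (panelRow lo σ m p) (panelBlock σ m q) (panelRow lo σ m q)
          then 1 else 0) * s₁.mem (cellAddr ((if PanelWeight (panelBlock σ m p) (panelBlock σ m q)
          then 1 else 0) * (2 * n * n)) n (panelRow lo σ m p) (panelRow lo σ m q) + 1))
      ?_ ?_ hB h4pos r4 r5 r10 ?_ ?_ ?_ ?_ (panelGraph_noNegativeCycle w X hσm) ?_ ?_ ?_)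
      ?_ ?_
    · decide
    · decide
    -- The query has at most `4 * n` vertices and lies above two matrices, so it ends by `4 * n * n
    -- + 32 * n * n`; the factor `40` leaves room for this.
    · have : 4 * n * n + 2 * ((2 * m + 2 * σ) * (2 * m + 2 * σ)) ≤ μ.β := by nlinarith
      exact_mod_cast this
    · intro p q hp hq s' hR h6 h7 hm
      have e0 : s'.reg 0 = n := by rw [hR 0 (by omega), r0]
      obtain ⟨h2, h3, h11⟩ := hP₁.congr hR.sameMain
      have b6 := eval_panelBlockExpr (e := .reg 6) h2 h11 h6
      have b7 := eval_panelBlockExpr (e := .reg 7) h2 h11 h7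
      have x6 := eval_panelRowExpr (e := .reg 6) h2 h3 h11 h6
      have x7 := eval_panelRowExpr (e := .reg 7) h2 h3 h11 h7
      have ec : panelCell.eval s' = cellAddr ((if PanelWeight (panelBlock σ m p) (panelBlock σ m q)
          then 1 else 0) * (2 * n * n)) n (panelRow lo σ m p) (panelRow lo σ m q) :=
        Expr.eval_cell (by
          simp only [Expr.eval, eval_panelWeightExpr b6 b7, Expr.eval_region e0]) e0 x6 x7
      have hlt := cellAddr_lt ((if PanelWeight (panelBlock σ m p) (panelBlock σ m q)
          then 1 else 0) * (2 * n * n)) (hrow p hp) (hrow q hq)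
      have hle : (if PanelWeight (panelBlock σ m p) (panelBlock σ m q) then (1 : ℤ) else 0) *
          (2 * n * n) ≤ 2 * n * n := by split_ifs <;> linarith
      simp only [panelFlag, panelVal, panelTest, Expr.eval, eval_panelEntryExpr b6 x6 b7 x7,
        eval_panelJoinExpr b6 x6 b7 x7, ec]
      rw [hm _ (by linarith), hm _ (by linarith)]
      exact ⟨rfl, rfl⟩
    · intro p q _ _
      by_cases hc : PanelEntry (panelBlock σ m p) (panelRow lo σ m p) (panelBlock σ m q)
        (panelRow lo σ m q)
      · have hj : ¬ PanelJoin (panelBlock σ m p) (panelRow lo σ m p) (panelBlock σ m q)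
          (panelRow lo σ m q) := by unfold PanelEntry at hc; unfold PanelJoin; omega
        rw [if_pos hc, if_neg hj, one_mul, add_zero]
        exact hB.mem _
      · rw [if_neg hc, zero_mul, zero_add]
        have := μ.two_le
        split_ifs
        · rw [abs_one]; exact_mod_cast (by omega : 1 ≤ μ.β)
        · simp
    · intro p q _ _
      split_ifs
      all_goals first | (rw [one_mul]; exact hB.mem _) | simp
    · intro p q
      rw [panelGraph, panelEdge_eq]
      by_cases hc : PanelEntry (panelBlock σ m p) (panelRow lo σ m p) (panelBlock σ m q)
        (panelRow lo σ m q)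
      · have hj : ¬ PanelJoin (panelBlock σ m p) (panelRow lo σ m p) (panelBlock σ m q)
          (panelRow lo σ m q) := by unfold PanelEntry at hc; unfold PanelJoin; omega
        simp only [if_pos hc, if_neg hj, one_mul, add_zero]
        split_ifs
        · rw [one_mul, ← hH.weight _ _ (hrow p p.2) (hrow q q.2)]; rfl
        · rw [zero_mul, ← hH.current _ _ (hrow p p.2) (hrow q q.2)]; rfl
      · simp only [if_neg hc, zero_mul, zero_add]
        split_ifs <;> rfl
    · intro p q x hx
      rw [panelGraph, panelEdge_eq] at hx
      have hn1 : (1 : ℤ) ≤ n := by omega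
      have hM0 : (0 : ℤ) ≤ M := by positivity
      push_cast
      split_ifs at hx
      · exact (hw _ _ x hx).trans (by nlinarith)
      · exact hX _ _ x (hrow p p.2) (hrow q q.2) hx
      · have : x = 0 := by exact_mod_cast hx.symm
        subst this
        simp only [abs_zero]; positivity
      · exact absurd hx WithTop.top_ne_coe
    · calc (2 * m + 2 * σ) * (6 * M * n) ≤ 4 * n * (6 * M * n) := Nat.mul_le_mul_right _ hN4
        _ ≤ 40 * (n * n) * (M + 1) := by nlinarith
        _ ≤ _ := hβ
    · have hc1 : panelFlag.cost + panelVal.cost + 66 ≤ 3000 := by decide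
      have hc2 : (2 * m + 2 * σ) * (2 * m + 2 * σ) ≤ 36 * (σ * σ) := by nlinarith
      calc _ ≤ 36 * (σ * σ) * 3000 + 12 := Nat.add_le_add_right (Nat.mul_le_mul hc2 hc1) _
        _ ≤ _ := by omega
    · intro s' hQ
      refine ⟨hQ.bounded, hS.main hQ.regs, hQ.answer, fun a ha => ?_⟩
      rw [hQ.same a ha, hS.2]
  case hT =>
    simp only [Expr.region, Expr.cost]
    omega

/-- The source of the answer for the row in register `6`. -/
def panelSourceExpr : Expr :=
  .add (.reg 6) (.mul (.lt (.reg 6) (.reg 2)) (.add (.reg 11) (.reg 2)))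

/-- The target of the answer for the column in register `7`. -/
def panelTargetExpr : Expr :=
  .add (.reg 7) (.add (.reg 11) (.mul (.ge (.reg 7) (.reg 2)) (.mul (.lit 2) (.reg 2))))

theorem eval_panelSourceExpr {s : State} {w lo m p : ℕ} (h : PanelRegs w lo m s)
    (hp : s.reg 6 = p) : panelSourceExpr.eval s = panelSource w m p := by
  have e0 : panelNode w m 0 p = 0 + p := rfl
  have e2 : panelNode w m 2 p = m + w + p := rfl
  simp only [panelSourceExpr, Expr.eval, hp, h.solved, h.width, panelSource, e0, e2]
  split_ifs <;> omega

theorem eval_panelTargetExpr {s : State} {w lo m p : ℕ} (h : PanelRegs w lo m s)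
    (hp : s.reg 7 = p) : panelTargetExpr.eval s = panelTarget w m p := by
  have e1 : panelNode w m 1 p = m + p := rfl
  have e3 : panelNode w m 3 p = m + 2 * w + p := rfl
  simp only [panelTargetExpr, Expr.eval, Expr.eval_ge, hp, h.solved, h.width, panelTarget, e1, e3]
  split_ifs <;> omega

/-- Use the answer of a panel step. -/
def panelUpdate : Program :=
  setup (.cell (.lit 0) (.reg 0) (.reg 3) (.reg 3)) (.reg 11) (.reg 0)
    (minFill (.cell (.reg 4) (.reg 0) (.reg 6) (.reg 7))
      (.cell (.region 4) (.mul (.lit 2) (.add (.reg 11) (.reg 2))) panelSourceExpr panelTargetExpr))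

/-- A diagonal block keeps the row length `n`, so it can be treated as a matrix based at its corner.
-/
theorem cellAddr_cellAddr (base : ℤ) (n lo lo' x y : ℕ) :
    cellAddr (cellAddr base n lo lo') n x y = cellAddr base n (lo + x) (lo' + y) := by
  unfold cellAddr; push_cast; ring

theorem reaches_panelUpdate {μ : Machine} {n σ lo m : ℕ}
    {w X : ℕ → ℕ → WithTop ℤ} {s : State} (hs : Bounded μ.β s) (h : Holds n w X s)
    (hP : PanelRegs σ lo m s) (hσ : 1 ≤ σ) (hmσ : m ≤ 2 * σ) (hlo : lo + m ≤ n)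
    (hβ : 40 * (n * n) ≤ μ.β) {D : WMatrix (2 * m + 2 * σ)}
    (hσm : σ ≤ m)
    (hcell : ∀ p q, p < 2 * m + 2 * σ → q < 2 * m + 2 * σ →
      cellValue s.mem (cellAddr (4 * n * n) (2 * m + 2 * σ) p q) = entry D p q) :
    Reaches μ panelUpdate s (20000 * (σ * σ)) (fun s' => Bounded μ.β s' ∧ SameMain s s' ∧
      (∃ Y, Holds n w Y s' ∧
        (∀ i j, i < n → j < n → ¬(lo ≤ i ∧ i < lo + m ∧ lo ≤ j ∧ j < lo + m) → Y i j = X i j) ∧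
        ∀ x y, x < m → y < m → Y (lo + x) (lo + y) =
          min (X (lo + x) (lo + y)) (entry D (panelSource σ m x) (panelTarget σ m y))) ∧
      ∀ a : ℤ, a < 0 → s'.mem a = s.mem a) := by
  have hnn : n ≤ n * n := Nat.le_mul_self n
  have hnβ : n ≤ μ.β := by omega
  have hn1 : |(n : ℤ)| ≤ μ.β := by rw [Nat.abs_cast]; exact_mod_cast hnβ
  have hm1 : |(m : ℤ)| ≤ μ.β := by
    rw [Nat.abs_cast]; exact_mod_cast (by omega : m ≤ μ.β)
  have hpos : (0 : ℤ) ≤ n * n := by positivity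
  have hlon : lo < n := by omega
  have hbase : |cellAddr 0 n lo lo| ≤ μ.β := by
    have h1 := cellAddr_ge 0 n lo lo
    have h2 := cellAddr_lt 0 hlon hlon
    have h3 : (40 * (n * n) : ℤ) ≤ μ.β := by exact_mod_cast hβ
    rw [abs_of_nonneg h1]
    linarith
  have hσσ : 1 ≤ σ * σ := Nat.mul_pos hσ hσ
  refine Reaches.le_time (T := ?T) ?h ?hT
  case h =>
    refine reaches_setup (T := 19000 * (σ * σ)) (v₄ := cellAddr 0 n lo lo) (v₅ := m) (v₁₀ := n) hs
      ?_ ?_ ?_ ?_ hbase hm1 hn1 ?_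
    · decide
    · decide
    · decide
    · intro s' hS
      have h0 : s'.reg 0 = n := by rw [hS.sameMain.size, h.size]
      obtain ⟨-, h3, h11⟩ := hP.congr hS.sameMain
      exact ⟨Expr.eval_cell rfl h0 h3 h3, h11, h0⟩
    intro s₁ hB hS r4 r5 r10
    have r0 : s₁.reg 0 = n := by rw [hS.sameMain.size, h.size]
    have hP₁ := hP.congr hS.sameMain
    have hout : ∀ (m' : ℤ → ℤ) (C : ℕ → ℕ → Prop), SameMem (cellAddr 0 n lo lo) n m C s₁.mem m' →
        ∀ a : ℤ, (a < 0 ∨ 2 * n * n ≤ a) → m' a = s₁.mem a := by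
      intro m' C hC a ha
      refine hC a fun p q hp hq _ => ?_
      rw [cellAddr_cellAddr]
      have h1 := cellAddr_ge 0 n (lo + p) (lo + q)
      have h2 := cellAddr_lt 0 (show lo + p < n by omega) (show lo + q < n by omega)
      constructor <;> omega
    refine Reaches.mono (reaches_minFill
      (x := fun p q => cellAddr (cellAddr 0 n lo lo) n p q)
      (y := fun p q => cellAddr (4 * n * n) (2 * m + 2 * σ) (panelSource σ m p)
        (panelTarget σ m q))
      ?_ ?_ hB r4 r5 r10 (by omega) (by omega) ?_) ?_ ?_
    · decide
    · decide
    · intro p q hp hq s' hR h6 h7 hsame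
      have e0 : s'.reg 0 = n := by rw [hR 0 (by omega), r0]
      have e4 : s'.reg 4 = cellAddr 0 n lo lo := by rw [hR 4 (by omega), r4]
      have hPs := hP₁.congr hR.sameMain
      have hm := hout _ _ hsame
      have h2 := cellAddr_ge (4 * n * n) (2 * m + 2 * σ) (panelSource σ m p) (panelTarget σ m q)
      have hne : ∀ p' q', p' < m → q' < m → ¬(p' = p ∧ q' = q) → _ := fun p' q' _ hq' hc =>
        cellAddr_ne (base := cellAddr 0 n lo lo) (stride := n) (p := p) (q := q) (p' := p')
          (q' := q') (by omega) (by omega) (fun hc' => hc ⟨hc'.1.symm, hc'.2.symm⟩)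
      have e : 2 * ((m : ℤ) + σ) = (2 * m + 2 * σ : ℕ) := by push_cast; ring
      refine ⟨Expr.eval_cell e4 e0 h6 h7,
        Expr.eval_cell (Expr.eval_region e0 4) ?_ (eval_panelSourceExpr hPs h6)
          (eval_panelTargetExpr hPs h7),
        hsame _ fun p' q' h1 h2 h3 => ⟨(hne p' q' h1 h2 h3).1, (hne p' q' h1 h2 h3).2.2.1⟩,
        hsame _ fun p' q' h1 h2 h3 => ⟨(hne p' q' h1 h2 h3).2.1, (hne p' q' h1 h2 h3).2.2.2⟩,
        hm _ (.inr (by linarith)), hm _ (.inr (by linarith))⟩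
      simp only [Expr.eval, hPs.solved, hPs.width, e]
    · have hc1 : 20 * (Expr.cell (.reg 4) (.reg 0) (.reg 6) (.reg 7)).cost +
        20 * (Expr.cell (.region 4) (.mul (.lit 2) (.add (.reg 11) (.reg 2))) panelSourceExpr
          panelTargetExpr).cost + 200 ≤ 3000 := by decide
      have hc2 : m * m ≤ 4 * (σ * σ) := by nlinarith
      calc _ ≤ 4 * (σ * σ) * 3000 + 8 := Nat.add_le_add_right (Nat.mul_le_mul hc2 hc1) _
        _ ≤ _ := by omega
    · intro s' hQ
      have hm := hout _ _ hQ.same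
      have hsrc : ∀ {x}, x < m → panelSource σ m x < 2 * m + 2 * σ := fun hx => by
        unfold panelSource; split_ifs <;> exact panelNode_lt hx
      have htgt : ∀ {x}, x < m → panelTarget σ m x < 2 * m + 2 * σ := fun hx => by
        unfold panelTarget; split_ifs <;> exact panelNode_lt hx
      refine ⟨hQ.bounded, hS.main hQ.regs, ⟨fun i j => cellValue s'.mem (cellAddr 0 n i j),
        ⟨?_, fun _ _ _ _ => rfl, fun i j hi hj => ?_⟩, fun i j hi hj hc => ?_,
        fun x y hx hy => ?_⟩, fun a ha => ?_⟩
      · rw [hQ.regs 0 (by omega), r0]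
      · have h1 := cellAddr_ge (2 * n * n) n i j
        rw [cellValue, hm _ (.inr h1), hm _ (.inr (by linarith)), hS.2]
        exact h.weight i j hi hj
      · change cellValue s'.mem (cellAddr 0 n i j) = X i j
        have hne : ∀ p q, p < m → q < m → _ := fun p q hp hq =>
          cellAddr_ne (base := 0) (stride := n) (p := i) (q := j) (p' := lo + p)
            (q' := lo + q) (by omega) (by omega) (by omega)
        rw [← h.current i j hi hj, cellValue, cellValue,
          hQ.same _ fun p q hp hq _ => by
            rw [cellAddr_cellAddr]; exact ⟨(hne p q hp hq).1, (hne p q hp hq).2.2.1⟩,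
          hQ.same _ fun p q hp hq _ => by
            rw [cellAddr_cellAddr]; exact ⟨(hne p q hp hq).2.1, (hne p q hp hq).2.2.2⟩, hS.2]
      · change cellValue s'.mem (cellAddr 0 n (lo + x) (lo + y)) = _
        have := hQ.done x y hx hy
        rw [cellAddr_cellAddr] at this
        rw [this, hS.2, h.current _ _ (by omega) (by omega), hcell _ _ (hsrc hx) (htgt hy)]
      · rw [hm a (.inl ha), hS.2]
  case hT =>
    simp only [Expr.cell, Expr.cost]
    omega

/-! ### The program -/

/-- The step at the time in register `1`. The largest power of two that divides `2 * v` is stored at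
the address `-(2 * v)` when it becomes known. -/
def stepProgram : Program :=
  .seq (.assign 2 (.add (.load (.sub (.lit 0) (.reg 1)))
    (.lt (.load (.sub (.lit 0) (.reg 1))) (.lit 1))))
  (.seq (.store (.sub (.lit 0) (.mul (.lit 2) (.reg 1))) (.mul (.lit 2) (.reg 2)))
  (.seq (.assign 3 (.sub (.reg 1) (.reg 2)))
  (.seq (.assign 11 (.add (.reg 2) (.add (.sub (.reg 0) (.reg 1))
    (.mul (.lt (.reg 2) (.sub (.reg 0) (.reg 1))) (.sub (.reg 2) (.sub (.reg 0) (.reg 1)))))))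
  (.seq panelQuery (.seq panelUpdate (.assign 1 (.add (.reg 1) (.lit 1))))))))

/-- The state before the step at time `t`. -/
structure StepInvariant (β n : ℕ) (w F : ℕ → ℕ → WithTop ℤ) (t : ℕ) (s : State) : Prop where
  bounded : Bounded β s
  time : s.reg 1 = t
  run : ∃ X, IsRun n w F t X ∧ Holds n w (X t) s
  even : ∀ v : ℕ, 1 ≤ v → v < t → s.mem (-(2 * v)) = 2 * lowBit v
  odd : ∀ u : ℕ, u % 2 = 1 → s.mem (-u) = 0

/-- For `t = 2 * v` the cell was filled at the earlier time `v`. For odd `t` it is still `0`, and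
the comparison supplies the `1`. Thus no division is needed. -/
theorem StepInvariant.lowBit_eq {β n t : ℕ} {w F : ℕ → ℕ → WithTop ℤ} {s : State}
    (h : StepInvariant β n w F t s) (ht : 1 ≤ t) :
    s.mem (-t) + (if s.mem (-t) < 1 then 1 else 0) = lowBit t := by
  rcases Nat.even_or_odd' t with ⟨v, rfl | rfl⟩
  · have h1 := h.even v (by omega) (by omega)
    have h2 := lowBit_pos v
    rw [Nat.cast_mul, Nat.cast_two, h1, if_neg (by omega), lowBit_two_mul (by omega)]
    push_cast; ring
  · rw [h.odd _ (by omega), lowBit_odd (by omega)]; norm_num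

theorem IsRun.snoc {n t : ℕ} {w F Y : ℕ → ℕ → WithTop ℤ} {X : ℕ → ℕ → ℕ → WithTop ℤ}
    (hX : IsRun n w F t X) (ht : 1 ≤ t) (hY : IsStep n w F (X t) Y t) :
    IsRun n w F (t + 1) (Function.update X (t + 1) Y) := by
  constructor
  · intro i j hi hj
    rw [Function.update_of_ne (by omega)]
    exact hX.start i j hi hj
  · intro u h1 h2
    rw [Function.update_of_ne (by omega)]
    rcases Nat.lt_succ_iff_lt_or_eq.1 h2 with h3 | rfl
    · rw [Function.update_of_ne (by omega)]
      exact hX.step u h1 h3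
    · rw [Function.update_self]; exact hY

/-- The step is shown to satisfy `IsStep`, whose main clause is conditional, so readiness of the
block plays no role here. The run enters through `IsRun.abs_le`, which bounds the query. -/
theorem reaches_stepProgram {μ : Machine} (hO : μ.O.Solves APSP) {n M t : ℕ} {G : WMatrix n}
    (hG : NoNegativeCycle G) (hM : ∀ (i j : Fin n) (x : ℤ), G i j = (x : WithTop ℤ) → |x| ≤ M)
    (hβ : 40 * (n * n) * (M + 1) ≤ μ.β) (ht : 1 ≤ t) (htn : t < n) {s : State}
    (hI : StepInvariant μ.β n (entry (adjacencyMatrix G))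
      (ijkValue n (entry (adjacencyMatrix G))) t s) :
    Reaches μ stepProgram s (230000 * lowBit t ^ 2)
      (StepInvariant μ.β n (entry (adjacencyMatrix G))
        (ijkValue n (entry (adjacencyMatrix G))) (t + 1)) := by
  obtain ⟨X, hX, hH⟩ := hI.run
  have hnn : n ≤ n * n := Nat.le_mul_self n
  have hnM : n * n ≤ n * n * (M + 1) := Nat.le_mul_of_pos_right _ (by omega)
  have hnβ : 40 * n ≤ μ.β := by nlinarith
  obtain ⟨σ, hσ⟩ : ∃ σ, σ = lowBit t := ⟨_, rfl⟩
  have hσ1 : 1 ≤ σ := hσ ▸ lowBit_pos t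
  have hσt : σ ≤ t := hσ ▸ lowBit_le (by omega)
  obtain ⟨m, hm⟩ : ∃ m, m = stepWidth n t := ⟨_, rfl⟩
  obtain ⟨lo, hlo⟩ : ∃ lo, lo = t - lowBit t := ⟨_, rfl⟩
  have hm' : m = σ + min σ (n - t) := by rw [hm, stepWidth, hσ]
  have b2 : |(σ : ℤ)| ≤ μ.β := by rw [Nat.abs_cast]; exact_mod_cast (by omega : σ ≤ μ.β)
  have b2' : |2 * (σ : ℤ)| ≤ μ.β := by
    rw [abs_of_nonneg (by positivity)]; exact_mod_cast (by omega : 2 * σ ≤ μ.β)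
  have b3 : |(lo : ℤ)| ≤ μ.β := by rw [Nat.abs_cast]; exact_mod_cast (by omega : lo ≤ μ.β)
  have b11 : |(m : ℤ)| ≤ μ.β := by rw [Nat.abs_cast]; exact_mod_cast (by omega : m ≤ μ.β)
  have hσσ : 1 ≤ σ * σ := Nat.mul_pos hσ1 hσ1
  have hB2 := hI.bounded.setReg (r := 2) b2
  have hB3 := hB2.setMem (a := -(2 * t)) b2'
  have hB4 := hB3.setReg (r := 3) b3
  have hB5 := hB4.setReg (r := 11) b11
  refine Reaches.le_time (T := ?T) ?h ?hT
  case h =>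
    refine .assign_seq (v := σ) hI.bounded ?_ ?_
      (.store_seq (b := -(2 * t)) (v := 2 * σ) hB2 ?_ ?_ ?_ ?_
      (.assign_seq (v := lo) hB3 ?_ ?_ (.assign_seq (v := m) hB4 ?_ ?_
      (.seq (reaches_panelQuery (M := M) (σ := σ) (lo := lo) (m := m)
        (w := entry (adjacencyMatrix G)) (X := X t) hO hB5 ?_ ?_ hσ1 ?_ ?_ ?_ hβ ?_ ?_)
        (T' := 20000 * (σ * σ) + 4) ?_))))
    · decide
    · simp only [Expr.eval, hI.time, zero_sub]
      rw [hI.lowBit_eq ht, hσ]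
    · decide
    · decide
    · simp [Expr.eval, hI.time]
    · simp [Expr.eval]
    · decide
    · simp [Expr.eval, hI.time]; omega
    · decide
    · simp [Expr.eval, hI.time, hH.size]
      split_ifs <;> omega
    · refine hH.congr ?_ fun a h0 _ => ?_
      · simp
      · simp only [Function.update_apply]
        rw [if_neg (by omega)]
    · constructor <;> simp
    · omega
    · omega
    · omega
    · exact fun i j x hx => adjacency_abs_le hM hx
    · exact fun i j x hi hj hx => hX.abs_le hG hM ht hi hj hx
    · rintro s₁ ⟨hB, hS, ⟨D, hD, hcell⟩, hmem⟩
      have hH₁ : Holds n (entry (adjacencyMatrix G)) (X t) s₁ := by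
        refine hH.congr ?_ fun a h0 h4 => ?_
        · rw [hS.size]; simp
        · rw [hmem a h4]
          simp only [Function.update_apply]
          rw [if_neg (by omega)]
      have hP₁ : PanelRegs σ lo m s₁ := PanelRegs.congr (by constructor <;> simp) hS
      refine Reaches.seq (reaches_panelUpdate hB hH₁ hP₁ hσ1 (by omega) (by omega)
        (by nlinarith) (by omega) hcell) ?_
      rintro s₂ ⟨hB', hS', ⟨Y, hY, hoff, hon⟩, hmem'⟩
      have hone : ∀ {s s' : State}, SameMain s s' → s'.reg 1 = s.reg 1 := fun h =>
        h 1 (by omega) (by omega) (by omega) (by omega) (by omega) (by omega) (by omega)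
      have ht2 : s₂.reg 1 = t := by
        rw [hone hS', hone hS]
        simp [hI.time]
      have hneg : ∀ a : ℤ, a < 0 → s₂.mem a = Function.update s.mem (-(2 * t)) (2 * σ) a := by
        intro a ha
        rw [hmem' a ha, hmem a (ha.trans_le (by positivity))]
      have hev : (Expr.add (.reg 1) (.lit 1)).eval s₂ = (t + 1 : ℕ) := by simp [Expr.eval, ht2]
      refine .assign hB' (by decide) ?_
      rw [hev]
      refine ⟨hB'.setReg ?_, by simp, ⟨Function.update X (t + 1) Y, ?_, ?_⟩, fun v h1 h2 => ?_,
        fun u hu => ?_⟩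
      · rw [Nat.abs_cast]; exact_mod_cast (by omega : t + 1 ≤ μ.β)
      · refine hX.snoc ht ?_
        subst hσ hm hlo
        exact isStep_of_update (ijkSystem hG) ht htn hD hoff hon
      · rw [Function.update_self]
        exact hY.congr (by simp) fun _ _ _ => rfl
      · change s₂.mem _ = _
        rw [hneg _ (by omega), Function.update_apply]
        split_ifs with hc
        · rw [show v = t by omega, hσ]
        · exact hI.even v h1 (by omega)
      · change s₂.mem _ = _
        rw [hneg _ (by omega), Function.update_of_ne (by omega)]
        exact hI.odd u hu
  case hT =>
    simp only [Expr.cost]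
    rw [← hσ, pow_two]
    omega

/-- The reduction. -/
def mainProgram : Program :=
  .seq copyPhase (.seq peakPhase (.seq peakUpdate (.seq (.assign 1 (.lit 1))
    (.loop (.lt (.reg 1) (.reg 0)) stepProgram))))

theorem sum_range_lowBit_sq (N : ℕ) : ∑ k ∈ Finset.range N, lowBit (k + 1) ^ 2 ≤ 2 * N ^ 2 := by
  refine le_trans (le_of_eq ?_) (sum_lowBit_sq N)
  rw [Finset.range_eq_Ico, Finset.sum_Ico_add' (fun k => lowBit k ^ 2) 0 N 1]
  exact Finset.sum_congr (by ext; simp) fun _ _ => rfl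

theorem reaches_mainProgram {μ : Machine} (hO : μ.O.Solves APSP) {n M : ℕ} {G : WMatrix n}
    (hn : 1 ≤ n)
    (hG : NoNegativeCycle G) (hM : ∀ (i j : Fin n) (x : ℤ), G i j = (x : WithTop ℤ) → |x| ≤ M)
    (hβ : 40 * (n * n) * (M + 1) ≤ μ.β) :
    Reaches μ mainProgram (initialState G) (500000 * (n * n)) fun s =>
      readMatrix s.mem 0 n = ijkAlgorithm (adjacencyMatrix G) := by
  have hnn : n ≤ n * n := Nat.le_mul_self n
  have hnM : n * n ≤ n * n * (M + 1) := Nat.le_mul_of_pos_right _ (by omega)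
  have hMn : M + 1 ≤ n * n * (M + 1) := Nat.le_mul_of_pos_left _ (by nlinarith)
  have hnβ : 40 * (n * n) ≤ μ.β := by nlinarith
  have h2 := μ.two_le
  have hMβ : (M : ℤ) ≤ μ.β := by exact_mod_cast (by linarith : M ≤ μ.β)
  have h1β : |(1 : ℤ)| ≤ μ.β := by rw [abs_one]; exact_mod_cast (by omega : 1 ≤ μ.β)
  have hB0 : Bounded μ.β (initialState G) := by
    constructor
    · intro r
      simp only [initialState]
      split_ifs
      · rw [Nat.abs_cast]; exact_mod_cast (by omega : n ≤ μ.β)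
      · simp
    · exact writeMatrix_abs_le (by omega) (fun _ => by simp)
        fun i j x hx => (hM i j x hx).trans hMβ
  refine Reaches.le_time (T := ?T) ?h ?hT
  case h =>
    refine Reaches.seq (reaches_copyPhase (G := G) hB0 rfl hnβ fun i j hi hj => ?_)
      (T' := 10000 * (n * n) + 100 + (2000 * (n * n) + 100 + (2 + (460000 * (n * n) + 4 * n)))) ?_
    · rw [entry, dif_pos ⟨hi, hj⟩]
      exact writeMatrix_apply _ _ _ hi hj
    rintro s₁ ⟨hB₁, -, hH₁, hneg₁⟩
    refine Reaches.seq (reaches_peakPhase hO hB₁ hH₁ hβ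
      fun i j x hx => adjacency_abs_le hM hx) ?_
    rintro s₂ ⟨hB₂, hS₂, ⟨D, hD, hcell⟩, hmem₂⟩
    have hH₂ : Holds n (entry (adjacencyMatrix G)) (entry G) s₂ :=
      hH₁.congr hS₂.size fun a _ h => hmem₂ a h
    refine Reaches.seq (reaches_peakUpdate hB₂ hH₂ hnβ hD hcell) ?_
    rintro s₃ ⟨hB₃, -, hH₃, hneg₃⟩
    have hneg : ∀ a : ℤ, a < 0 → s₃.mem a = 0 := by
      intro a ha
      rw [hneg₃ a ha, hmem₂ a (ha.trans_le (by positivity)), hneg₁ a ha]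
      exact if_neg (by omega)
    refine .assign_seq (v := 1) hB₃ (by decide) rfl ?_
    -- Round `k` is the step at time `k + 1`, so the loop ends with the matrix of time `n`.
    refine Reaches.mono (Reaches.loop (N := n - 1) (T := fun k => 230000 * lowBit (k + 1) ^ 2)
      (fun k => StepInvariant μ.β n (entry (adjacencyMatrix G))
        (ijkValue n (entry (adjacencyMatrix G))) (k + 1)) (by decide) (fun _ _ h => h.bounded)
      ?_ ?_ ?_) ?_ ?_
    · intro k hk s hI
      refine ⟨?_, reaches_stepProgram hO hG hM hβ (by omega) (by omega) hI⟩
      obtain ⟨X, -, hH⟩ := hI.run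
      simp only [Expr.eval, hI.time, hH.size]
      rw [if_pos (by omega)]
      exact one_ne_zero
    · intro s hI
      obtain ⟨X, -, hH⟩ := hI.run
      simp only [Expr.eval, hI.time, hH.size]
      rw [if_neg (by omega)]
    · refine ⟨hB₃.setReg h1β, by simp,
        ⟨fun _ => peakValue n (entry (adjacencyMatrix G)), ⟨fun _ _ _ _ => rfl, by omega⟩,
          hH₃.congr (by simp) fun _ _ _ => rfl⟩, fun v _ _ => by omega,
        fun u hu => hneg _ (by omega)⟩
    -- The loop bodies take at most `230000 * (2 * n * n)` steps; the tests account for the linear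
    -- term.
    · have h := sum_range_lowBit_sq (n - 1)
      have h' : (n - 1) ^ 2 ≤ n * n := by rw [pow_two]; exact Nat.mul_le_mul (by omega) (by omega)
      rw [Finset.sum_add_distrib, ← Finset.mul_sum, Finset.sum_const, Finset.card_range]
      simp only [Expr.cost, smul_eq_mul]
      omega
    · intro s hI
      obtain ⟨X, hX, hH⟩ := hI.run
      ext i j
      rw [readMatrix_eq, hH.current i j i.2 j.2, ijkAlgorithm_eq hG]
      exact (hX.all_steps (ijkSystem hG) (by omega) i.2 j.2).1 (by omega)
  case hT =>
    omega

/-! ### Resources -/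

/-- A call on `m` vertices is charged more than `2 * (m * m)` steps, so the running time alone
controls the queries. -/
theorem Exec.sum_sq_le {O : Oracle} {W : ℕ} {p : Program} {s s' : State} {t : ℕ} {Q : List ℕ}
    (h : Exec O W p s s' t Q) : (Q.map fun m => m * m + 1).sum ≤ t := by
  induction h with
  | call s eN x y N => simp; omega
  | _ => simp_all <;> omega

/-- Split off two factors `m`; the remaining exponent is at most `1 - min ε 1`, and `m ≤ K * n`
because `m * m ≤ K * (n * n)`. -/
theorem rpow_query_le {ε : ℝ} (hε : 0 < ε) {m K n : ℕ} (hK : 1 ≤ K) (hn : 1 ≤ n)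
    (hm : m * m ≤ K * (n * n)) :
    (m : ℝ) ^ (3 - ε) ≤ K * (n : ℝ) ^ (1 - min ε 1) * (m * m + 1) := by
  have hK' : (1 : ℝ) ≤ K := by exact_mod_cast hK
  have hn' : (1 : ℝ) ≤ n := by exact_mod_cast hn
  have hδ : 0 ≤ 1 - min ε 1 := sub_nonneg.2 (min_le_right _ _)
  have hbase : (1 : ℝ) ≤ K * (n : ℝ) ^ (1 - min ε 1) := by
    have := Real.one_le_rpow hn' hδ
    nlinarith
  rcases Nat.eq_zero_or_pos m with rfl | h0
  · have h1 : ((0 : ℕ) : ℝ) ^ (3 - ε) ≤ 1 := by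
      rw [Nat.cast_zero]
      by_cases h : 3 - ε = 0
      · rw [h, Real.rpow_zero]
      · rw [Real.zero_rpow h]; exact zero_le_one
    refine h1.trans (hbase.trans ?_)
    simp
  · have hm1 : (1 : ℝ) ≤ m := by exact_mod_cast h0
    have hmK : m ≤ K * n := by
      by_contra hc
      have h1 : K * (n * n) ≤ K * n * (K * n) := by nlinarith [Nat.mul_le_mul_right (K * (n * n)) hK]
      have h2 : K * n * (K * n) < m * m := Nat.mul_self_lt_mul_self (not_le.1 hc)
      omega
    have hmK' : (m : ℝ) ≤ K * n := by exact_mod_cast hmK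
    calc (m : ℝ) ^ (3 - ε) ≤ (m : ℝ) ^ ((2 : ℕ) + (1 - min ε 1)) :=
          Real.rpow_le_rpow_of_exponent_le hm1 (by
            have := min_le_left ε 1
            push_cast; linarith)
      _ = (m : ℝ) ^ (1 - min ε 1) * (m * m) := by
          rw [Real.rpow_add (by linarith), Real.rpow_natCast]; ring
      _ ≤ (K * n : ℝ) ^ (1 - min ε 1) * (m * m) := by gcongr
      _ ≤ K * (n : ℝ) ^ (1 - min ε 1) * (m * m) := by
          rw [Real.mul_rpow (by linarith) (by linarith)]
          gcongr
          calc (K : ℝ) ^ (1 - min ε 1) ≤ (K : ℝ) ^ (1 : ℝ) :=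
                Real.rpow_le_rpow_of_exponent_le hK' (by
                  have := lt_min hε one_pos
                  linarith)
            _ = K := Real.rpow_one _
      _ ≤ _ := by
          refine mul_le_mul_of_nonneg_left ?_ (by linarith)
          linarith

theorem sum_queries_le {ε : ℝ} (hε : 0 < ε) {t K n : ℕ} {Q : List ℕ} (hK : 1 ≤ K) (hn : 1 ≤ n)
    (hQ : (Q.map fun m => m * m + 1).sum ≤ t) (ht : t ≤ K * (n * n)) :
    (Q.map fun m : ℕ => (m : ℝ) ^ (3 - ε)).sum ≤ K * (n : ℝ) ^ (1 - min ε 1) * t := by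
  have hmem : ∀ m ∈ Q, m * m ≤ K * (n * n) := fun m hm => by
    have := List.le_sum_of_mem (List.mem_map_of_mem (f := fun m => m * m + 1) hm)
    omega
  calc (Q.map fun m : ℕ => (m : ℝ) ^ (3 - ε)).sum
      ≤ (Q.map fun m : ℕ => K * (n : ℝ) ^ (1 - min ε 1) * ((m : ℝ) * m + 1)).sum :=
        List.sum_le_sum fun m hm => rpow_query_le hε hK hn (hmem m hm)
    _ = K * (n : ℝ) ^ (1 - min ε 1) * ((Q.map fun m => m * m + 1).sum : ℕ) := by
        rw [List.sum_map_mul_left, Nat.cast_list_sum, List.map_map]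
        congr 3
        funext m
        simp
    _ ≤ K * (n : ℝ) ^ (1 - min ε 1) * t := by
        refine mul_le_mul_of_nonneg_left (by exact_mod_cast hQ) (by positivity)

end FineGrained

/-- There is a subcubic reduction from the problem of computing the output of the IJK variant of the
Floyd-Warshall algorithm to all-pairs shortest paths. -/
theorem theorem5p2 :
    FineGrained.SubcubicReduction FineGrained.IncorrectAPSP FineGrained.APSP := by
  -- The saving is capped at `1` because the program takes quadratic time. The constant is a
  -- product: one factor bounds the query sizes, the other the time. States are bounded by the
  -- seventh power of `n + M + 2`, and evaluation multiplies this exponent by at most `degreeBound`.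
  refine ⟨FineGrained.mainProgram, 7 * FineGrained.degreeBound, fun ε hε =>
    ⟨min ε 1, lt_min hε one_pos, 500000 * 500000, fun O hO n M G hn hG hM => ?_⟩⟩
  have hb : 3 ≤ n + M + 2 := by omega
  let μ : FineGrained.Machine :=
    { O := O
      W := (n + M + 2) ^ (7 * FineGrained.degreeBound)
      β := (n + M + 2) ^ 7
      two_le := (by omega : 2 ≤ n + M + 2).trans (Nat.le_self_pow (by omega) _)
      pow_le := by rw [← pow_mul] }
  have hβ : 40 * (n * n) * (M + 1) ≤ μ.β := by
    -- Four of the seven factors absorb the `40`, since `3 ^ 4 = 81`; the other three cover `n * n *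
    -- (M + 1)`.
    have h1 : 40 ≤ (n + M + 2) ^ 4 := le_trans (by norm_num) (Nat.pow_le_pow_left hb 4)
    calc 40 * (n * n) * (M + 1)
        ≤ (n + M + 2) ^ 4 * ((n + M + 2) * (n + M + 2)) * (n + M + 2) := by gcongr <;> omega
      _ = (n + M + 2) ^ 7 := by ring
  obtain ⟨s, t, Q, hE, ht, hs⟩ := FineGrained.reaches_mainProgram (μ := μ) hO hn hG hM hβ
  have hn0 : (0 : ℝ) < n := by exact_mod_cast hn
  have hpow : (n : ℝ) ^ (1 - min ε 1) * (n * n) = (n : ℝ) ^ (3 - min ε 1) := by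
    rw [show 3 - min ε 1 = (1 - min ε 1) + (2 : ℕ) by push_cast; ring, Real.rpow_add hn0,
      Real.rpow_natCast]
    ring
  have hle : (n : ℝ) * n ≤ (n : ℝ) ^ (3 - min ε 1) := by
    rw [← hpow]
    have : (1 : ℝ) ≤ (n : ℝ) ^ (1 - min ε 1) :=
      Real.one_le_rpow (by exact_mod_cast hn) (sub_nonneg.2 (min_le_right _ _))
    exact le_mul_of_one_le_left (by positivity) this
  have htR : (t : ℝ) ≤ 500000 * (n * n) := by exact_mod_cast ht
  refine ⟨s, t, Q, hE, hs, ?_, ?_⟩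
  · have : (0 : ℝ) ≤ n * n := by positivity
    linarith
  · have h := FineGrained.sum_queries_le hε (K := 500000) (by norm_num) hn hE.sum_sq_le ht
    -- In the goal the list of sizes is cast to real numbers through the list monad; this rewrites
    -- the cast as a map.
    rw [bind_pure_comp, List.map_eq_map, List.map_map]
    calc _ ≤ _ := h
      _ ≤ (500000 : ℕ) * (n : ℝ) ^ (1 - min ε 1) * (500000 * (n * n)) :=
          mul_le_mul_of_nonneg_left htR (by positivity)
      _ = _ := by rw [← hpow]; push_cast; ring
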